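/- Let $k\ge 2$ be a natural number, $p$ an integer with $\gcd(|p|,k)=1$, and let $$G(z)=e^{Az^k+A_0z^{-k}}\,z^{p}\;\frac{\prod_{\nu}\left(1+\frac{z^k}{a_\nu}\right)}{\prod_{\mu}\left(1-\frac{z^k}{b_\mu}\right)}\cdot\frac{\prod_{\nu}\left(1+\frac{z^{-k}}{c_\nu}\right)}{\prod_{\mu}\left(1-\frac{z^{-k}}{d_\mu}\right)},\qquad G\not\equiv z^p,$$ where $A,A_0\ge 0$, each product is empty, finite or infinite, $a_\nu,b_\mu,c_\nu,d_\mu>0$ for all $\nu,\mu$, and the products converge absolutely, i.e. $\sum 1/a_\nu$, $\sum 1/b_\mu$, $\sum 1/c_\nu$, $\sum 1/d_\mu<\infty$. Put $e_m=\exp\left(i\frac{m}{k}\pi\right)$ and $Q_s=\{z\in\mathbb{C}\setminus\{0\}:0<\operatorname{Arg}(ze_{-s})<\frac{\pi}{k}\}$ for integers $m,s$, where $\operatorname{Arg}$ is the principal argument; $\overline{Q}_s$ is the closure of $Q_s$. Given $\alpha\in\mathbb{C}\setminus\{0\}$, an $\alpha$-point of $G$ is a solution of $G(z)=\alpha$;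 it has multiplicity $n\ge1$ if $G'(z)=\dots=G^{(n-1)}(z)=0\ne G^{(n)}(z)$, and is simple or double if $n=1$ or $n=2$. Let $\Xi\subset(0,\infty)$ be the set of absolute values of all $\alpha$-points of $G$. It can be numbered in increasing order, $\cdots<\xi_i<\xi_{i+1}<\cdots$, by an interval of consecutive integers (possibly empty, finite, or infinite in one or both directions). For every such numbering, and for every choice of $\alpha$-points $z_i$ with $|z_i|=\xi_i$, one for each index $i$ of the numbering, the following holds; "$z_j$ exists" means that $j$ is an index of the numbering. **Theorem.** Let $\alpha\neq0$, $\operatorname{Im}\alpha^k=0$, and let $s$ be an integer such that $\operatorname{Im}(\alpha e_{ps})=0$. Put $z_i^*=\overline{z_i}\,e_{-2s}$. For every index $i$: (a) A point $z$ satisfies $G(z)=\alpha$ and $|z|=|z_i|$ if and only if $z\in\{z_i,z_i^*\}$. (b) If $z_i^*\ne z_i$, then $z_i\in Q_{2m}\cup Q_{-2s-2m-1}$ for some integer $m$. Conversely, if $z_i\in Q_{2m}\cup Q_{-2s-2m-1}$ for an integer $m$, then $z_i^*\neq z_i$ are both simple $\alpha$-points, and if $z_{i+1}$ exists then $z_{i+1}\in\overline{Q}_{2l}\cup\overline{Q}_{-2s-2l-1}$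 for every integer $l$ with $p(m-l)\equiv1\pmod k$. (c) If $z_i^*=z_i$, $z_{i+1}$ exists and $\arg z_i=\arg z_{i+1}$, then $z_i$ and $z_{i+1}$ are both simple; moreover $\arg z_i\neq\arg z_{i-1}$ if $z_{i-1}$ exists, and $\arg z_{i+1}\ne\arg z_{i+2}$ if $z_{i+2}$ exists. (d) If $z_i^*=z_i$, $z_{i+1}$ exists and $\arg z_i\neq\arg z_{i+1}$, then $z_i$ is simple or double. If in addition $z_{i-1}$ exists, then $z_i$ is simple if and only if $\arg z_i=\arg z_{i-1}$, and double if and only if $\arg z_i\ne\arg z_{i-1}$. Furthermore, there is an integer $m$ with $z_i\in\overline{Q}_{2m}\cap\overline{Q}_{-2s-2m-1}$, and for every such $m$ and every integer $l$ with $p(m-l)\equiv1\pmod k$ one has $z_{i+1}\in\overline{Q}_{2l}\cup\overline{Q}_{-2s-2l-1}$. (e) If $z_i^*=z_i$ and $z_{i+1}$ does not exist (that is, $\xi_i$ is the largest element of $\Xi$), then the multiplicity of $z_i$ is at most $2$. -/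

import Mathlib

namespace AlphaPoints

noncomputable section

/-- `e_m = exp (i m π / k)`. -/
def e (k : ℕ) (m : ℤ) : ℂ :=
  Complex.exp (Complex.I * (((m : ℝ) / (k : ℝ) * Real.pi : ℝ) : ℂ))

/-- The open sector `Q_s` of central angle `π / k`. -/
def Q (k : ℕ) (s : ℤ) : Set ℂ :=
  {z : ℂ | z ≠ 0 ∧ 0 < Complex.arg (z * e k (-s)) ∧
    Complex.arg (z * e k (-s)) < Real.pi / (k : ℝ)}

/-- The function `G`. The index types of the four products may be empty, finite or infinite; the
products converge absolutely as soon as the families of reciprocals of the coefficients are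
summable. At the origin and at a pole this total function takes the value `0` (for `p ≠ 0`), so
for `α ≠ 0` the solutions of `G z = α` are genuine `α`-points, at which `G` is holomorphic. -/
def G {ι₁ ι₂ ι₃ ι₄ : Type*} (k : ℕ) (p : ℤ) (A A₀ : ℝ)
    (a : ι₁ → ℝ) (b : ι₂ → ℝ) (c : ι₃ → ℝ) (d : ι₄ → ℝ) (z : ℂ) : ℂ :=
  Complex.exp ((A : ℂ) * z ^ k + (A₀ : ℂ) * (z ^ k)⁻¹) * z ^ p *
    ((∏' ν, (1 + z ^ k / (a ν : ℂ))) / (∏' μ, (1 - z ^ k / (b μ : ℂ)))) *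
    ((∏' ν, (1 + (z ^ k)⁻¹ / (c ν : ℂ))) / (∏' μ, (1 - (z ^ k)⁻¹ / (d μ : ℂ))))

/-- `z` is an `α`-point of `f` of multiplicity `n`. -/
def IsAlphaPointOfMult (f : ℂ → ℂ) (α z : ℂ) (n : ℕ) : Prop :=
  f z = α ∧ 1 ≤ n ∧ (∀ j : ℕ, 1 ≤ j → j < n → iteratedDeriv j f z = 0) ∧
    iteratedDeriv n f z ≠ 0

/-- A simple `α`-point. -/
def IsSimple (f : ℂ → ℂ) (α z : ℂ) : Prop := IsAlphaPointOfMult f α z 1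

/-- A double `α`-point. -/
def IsDouble (f : ℂ → ℂ) (α z : ℂ) : Prop := IsAlphaPointOfMult f α z 2

/-- The set `Ξ` of the (positive) absolute values of the solutions of `f z = α`. -/
def Xi (f : ℂ → ℂ) (α : ℂ) : Set ℝ :=
  {ξ : ℝ | 0 < ξ ∧ ∃ θ ∈ Set.Ioc (-Real.pi) Real.pi,
    f ((ξ : ℂ) * Complex.exp (Complex.I * (θ : ℂ))) = α}

/-- `z i`, `i ∈ I`, is a choice of `α`-points of `f`, one for each value of the modulus, numbered
in the order of increasing modulus by an interval `I` of consecutive integers. Thus `i + 1 ∈ I`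
says that `ξ_{i+1}` (hence `z_{i+1}`) exists. Values of `z` outside `I` play no role. -/
structure IsEnumeration (f : ℂ → ℂ) (α : ℂ) (I : Set ℤ) (z : ℤ → ℂ) : Prop where
  ordConnected : I.OrdConnected
  strictMonoOn : StrictMonoOn (fun i => ‖z i‖) I
  image_eq : (fun i => ‖z i‖) '' I = Xi f α
  map_eq : ∀ i ∈ I, f (z i) = α

/-- The reflection `z* = conj z * e_{-2s}` in the line `{z | Im (z e_s) = 0}`. -/
def reflPt (k : ℕ) (s : ℤ) (z : ℂ) : ℂ := (starRingEnd ℂ) z * e k (-2 * s)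

end

end AlphaPoints

open AlphaPoints

/-! In the variable ζ = log z^k the closed sector with number 2m is the image of the strip 0 ≤ Im ζ
≤ π under z = e_{2m} exp(ζ/k) (`sectorMap`). The reflection z ↦ z* preserves α-points because α
e_{ps} is real, and it carries odd sectors to even ones. With f = `logG`, one function for all m,
G(z) = e_{2pm} exp(f(ζ)/k). So z is an α-point iff f(ζ) = k log α + 2πin for an integer n with n +
pm ≡ 0 mod k. As p is prime to k, each n fixes m mod k: up to reflection, the α-points are the
points of a single level line Re f = k log|α| at which Im f takes equally spaced values.

The engine is Im f' > 0 in the open strip. Integrated over segments, it gives difference quotients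
of f a positive imaginary part (`StrictStripMap.cross_pos`). Hence Re f decreases strictly upwards,
so a vertical line meets the level line at most once, which is (a). Moreover Im f increases to the
right along the level line, strictly unless the two points lie on the same boundary line. Where the
level line is interrupted it is completed by pieces of the boundary (`levelPath`), on which Im f
lies in πℤ and so is locally constant. Thus Im f takes all intermediate values on the level set, and
n grows by 0 or 1 from one α-point to the next (`IsEnumeration.step`).

A step 1 is the sector rule p(m - l) ≡ 1. A step 0 requires two points on the same boundary line,
hence on one ray; convexity of Re f on the bottom line and concavity on the top line show that both
are non-critical and that no third level point lies between them (`StrictStripMap.plateau`).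
Conversely, a non-critical boundary point with level points on both sides has such a partner
(`StrictStripMap.exists_same_value`). An unpaired one is therefore critical, and it is only double
because f'' ≠ 0 on the boundary. Finally, n is monotone in the modulus and takes each value at most
twice, so Ξ is locally finite and can be numbered. -/

namespace AlphaPoints

open Complex Set Filter Topology ComplexConjugate

/-! ### Strip maps and their two symmetries -/

/-- `f` is holomorphic near the closed strip `0 ≤ Im ζ ≤ π` apart from a set `P` of boundary
singularities, `Im f' ≥ 0` in the strip, `f'` is real on the boundary, and `Im f` takes values in
`π ℤ` there. -/
structure StripMap (f : ℂ → ℂ) (P : Set ℂ) : Prop where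
  analyticAt : ∀ ζ : ℂ, 0 ≤ ζ.im → ζ.im ≤ Real.pi → ζ ∉ P → AnalyticAt ℂ f ζ
  boundary : ∀ ζ ∈ P, ζ.im = 0 ∨ ζ.im = Real.pi
  im_deriv_nonneg : ∀ ζ : ℂ, 0 < ζ.im → ζ.im < Real.pi → 0 ≤ (deriv f ζ).im
  im_deriv_eq_zero : ∀ ζ ∉ P, ζ.im = 0 ∨ ζ.im = Real.pi → (deriv f ζ).im = 0
  -- Re f is convex along the lower line and concave along the upper one.
  bottom : ∀ ζ ∉ P, ζ.im = 0 → 0 ≤ (deriv (deriv f) ζ).re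
  top : ∀ ζ ∉ P, ζ.im = Real.pi → (deriv (deriv f) ζ).re ≤ 0
  im_mem : ∀ ζ ∉ P, ζ.im = 0 ∨ ζ.im = Real.pi → ∃ n : ℤ, (f ζ).im = n * Real.pi
  -- One large value on each vertical line is enough: since Re f decreases with the height, it
  -- forces Re f → +∞ at a lower singularity. Likewise `zero` forces Re f → -∞ at an upper one.
  pole : ∀ ζ ∈ P, ζ.im = 0 → ∀ c : ℝ, ∃ t : ℝ, 0 < t ∧ t < Real.pi ∧ c < (f ⟨ζ.re, t⟩).re
  zero : ∀ ζ ∈ P, ζ.im = Real.pi → ∀ c : ℝ, ∃ t : ℝ, 0 < t ∧ t < Real.pi ∧ (f ⟨ζ.re, t⟩).re < c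

/-- The strict version of `StripMap`. -/
structure StrictStripMap (f : ℂ → ℂ) (P : Set ℂ) : Prop extends StripMap f P where
  im_deriv_pos : ∀ ζ : ℂ, 0 < ζ.im → ζ.im < Real.pi → 0 < (deriv f ζ).im
  bottom_pos : ∀ ζ ∉ P, ζ.im = 0 → 0 < (deriv (deriv f) ζ).re
  top_neg : ∀ ζ ∉ P, ζ.im = Real.pi → (deriv (deriv f) ζ).re < 0

/-- Conjugation with the reflection in the middle line of the strip. -/
noncomputable def flipMap (f : ℂ → ℂ) (ζ : ℂ) : ℂ := -conj (f (conj ζ + Real.pi * I))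

/-- Conjugation with the reflection in the imaginary axis. -/
noncomputable def invMap (f : ℂ → ℂ) (ζ : ℂ) : ℂ := conj (f (-conj ζ))

lemma analyticAt_conj_conj {f : ℂ → ℂ} {ζ : ℂ} (h : AnalyticAt ℂ f (conj ζ)) :
    AnalyticAt ℂ (conj ∘ f ∘ conj) ζ := by
  rw [Complex.analyticAt_iff_eventually_differentiableAt] at h ⊢
  have h2 : ∀ᶠ w in 𝓝 ζ, DifferentiableAt ℂ f (conj w) :=
    (Complex.continuous_conj.tendsto ζ).eventually h
  filter_upwards [h2] with w hw
  have := hw.conj_conj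
  simpa using this

lemma flipMap_eq (f : ℂ → ℂ) :
    flipMap f = fun ζ => -(conj ∘ f ∘ conj) (ζ - Real.pi * I) := by
  ext ζ; simp [flipMap]

lemma invMap_eq (f : ℂ → ℂ) : invMap f = fun ζ => (conj ∘ f ∘ conj) (-ζ) := by
  ext ζ; simp [invMap]

lemma analyticAt_flipMap {f : ℂ → ℂ} {ζ : ℂ} (h : AnalyticAt ℂ f (conj ζ + Real.pi * I)) :
    AnalyticAt ℂ (flipMap f) ζ := by
  rw [flipMap_eq]
  have h1 : AnalyticAt ℂ (conj ∘ f ∘ conj) (ζ - Real.pi * I) :=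
    analyticAt_conj_conj (by simpa using h)
  exact (h1.fun_comp (f := fun ζ : ℂ => ζ - Real.pi * I) (by fun_prop)).neg

lemma analyticAt_invMap {f : ℂ → ℂ} {ζ : ℂ} (h : AnalyticAt ℂ f (-conj ζ)) :
    AnalyticAt ℂ (invMap f) ζ := by
  rw [invMap_eq]
  have h1 : AnalyticAt ℂ (conj ∘ f ∘ conj) (-ζ) := analyticAt_conj_conj (by simpa using h)
  exact h1.fun_comp (f := fun ζ : ℂ => -ζ) (by fun_prop)

lemma deriv_flipMap (f : ℂ → ℂ) : deriv (flipMap f) = flipMap (deriv f) := by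
  ext ζ
  rw [flipMap_eq, flipMap_eq, deriv.fun_neg,
    deriv_comp_sub_const (f := conj ∘ f ∘ conj), deriv_conj_conj]

lemma deriv_invMap (f : ℂ → ℂ) : deriv (invMap f) = fun ζ => -invMap (deriv f) ζ := by
  ext ζ
  rw [invMap_eq, invMap_eq, deriv_comp_neg (f := conj ∘ f ∘ conj), deriv_conj_conj]

lemma deriv_deriv_invMap (f : ℂ → ℂ) :
    deriv (deriv (invMap f)) = invMap (deriv (deriv f)) := by
  ext ζ
  rw [deriv_invMap, deriv.fun_neg, deriv_invMap, neg_neg]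

/-- The reflection exchanges the boundary lines and the sign compensates, so Im f' keeps its sign
while poles and zeros swap roles. This turns the logarithm of 1 + e^ζ/b into that of 1/(1 - e^ζ/b),
and later reduces claims about the upper line to the lower one. -/
lemma StripMap.flip {f : ℂ → ℂ} {P : Set ℂ} (h : StripMap f P) :
    StripMap (flipMap f) {ζ | conj ζ + Real.pi * I ∈ P} where
  analyticAt ζ h0 h1 h2 := analyticAt_flipMap <| h.analyticAt _ (by simpa using h1)
    (by simpa using h0) h2
  boundary ζ hζ := by
    have := h.boundary _ hζ
    simp at this
    rcases this with h | h
    · right; linarith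
    · left; linarith
  im_deriv_nonneg ζ h0 h1 := by
    rw [deriv_flipMap]
    simpa [flipMap] using h.im_deriv_nonneg (conj ζ + Real.pi * I) (by simpa using h1)
      (by simpa using h0)
  im_deriv_eq_zero ζ hζ hb := by
    rw [deriv_flipMap]
    have := h.im_deriv_eq_zero (conj ζ + Real.pi * I) hζ
      (by rcases hb with hb | hb <;> simp [hb])
    simpa [flipMap] using this
  bottom ζ hζ hb := by
    rw [deriv_flipMap, deriv_flipMap]
    have := h.top (conj ζ + Real.pi * I) hζ (by simp [hb])
    simpa [flipMap] using this
  top ζ hζ hb := by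
    rw [deriv_flipMap, deriv_flipMap]
    have := h.bottom (conj ζ + Real.pi * I) hζ (by simp [hb])
    simpa [flipMap] using this
  im_mem ζ hζ hb := by
    have := h.im_mem (conj ζ + Real.pi * I) hζ
      (by rcases hb with hb | hb <;> simp [hb])
    simpa [flipMap] using this
  pole ζ hζ hb c := by
    obtain ⟨t, h0, h1, ht⟩ := h.zero _ hζ (by simp [hb]) (-c)
    refine ⟨Real.pi - t, by linarith, by linarith, ?_⟩
    have : conj (⟨ζ.re, Real.pi - t⟩ : ℂ) + Real.pi * I = ⟨ζ.re, t⟩ := by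
      apply Complex.ext <;> simp
    simp only [flipMap, this]
    simp at ht ⊢
    linarith
  zero ζ hζ hb c := by
    obtain ⟨t, h0, h1, ht⟩ := h.pole _ hζ (by simp [hb]) (-c)
    refine ⟨Real.pi - t, by linarith, by linarith, ?_⟩
    have : conj (⟨ζ.re, Real.pi - t⟩ : ℂ) + Real.pi * I = ⟨ζ.re, t⟩ := by
      apply Complex.ext <;> simp
    simp only [flipMap, this]
    simp at ht ⊢
    linarith

/-- This replaces e^ζ by e^{-ζ}. Differentiation produces a minus sign, which cancels the one that
conjugation gives to Im f'. -/
lemma StripMap.inv {f : ℂ → ℂ} {P : Set ℂ} (h : StripMap f P) :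
    StripMap (invMap f) {ζ | -conj ζ ∈ P} where
  analyticAt ζ h0 h1 h2 := analyticAt_invMap <| h.analyticAt _ (by simpa using h0)
    (by simpa using h1) h2
  boundary ζ hζ := by simpa using h.boundary _ hζ
  im_deriv_nonneg ζ h0 h1 := by
    rw [deriv_invMap]
    simpa [invMap] using h.im_deriv_nonneg (-conj ζ) (by simpa using h0) (by simpa using h1)
  im_deriv_eq_zero ζ hζ hb := by
    rw [deriv_invMap]
    simpa [invMap] using h.im_deriv_eq_zero (-conj ζ) hζ (by simpa using hb)
  bottom ζ hζ hb := by
    rw [deriv_deriv_invMap]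
    simpa [invMap] using h.bottom (-conj ζ) hζ (by simpa using hb)
  top ζ hζ hb := by
    rw [deriv_deriv_invMap]
    simpa [invMap] using h.top (-conj ζ) hζ (by simpa using hb)
  im_mem ζ hζ hb := by
    obtain ⟨n, hn⟩ := h.im_mem (-conj ζ) hζ (by simpa using hb)
    exact ⟨-n, by simp [invMap, hn]⟩
  pole ζ hζ hb c := by
    obtain ⟨t, h0, h1, ht⟩ := h.pole _ hζ (by simp [hb]) c
    refine ⟨t, h0, h1, ?_⟩
    have : -conj (⟨ζ.re, t⟩ : ℂ) = ⟨-ζ.re, t⟩ := by apply Complex.ext <;> simp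
    simpa [invMap, this] using ht
  zero ζ hζ hb c := by
    obtain ⟨t, h0, h1, ht⟩ := h.zero _ hζ (by simp [hb]) c
    refine ⟨t, h0, h1, ?_⟩
    have : -conj (⟨ζ.re, t⟩ : ℂ) = ⟨-ζ.re, t⟩ := by apply Complex.ext <;> simp
    simpa [invMap, this] using ht

lemma StrictStripMap.flip {f : ℂ → ℂ} {P : Set ℂ} (h : StrictStripMap f P) :
    StrictStripMap (flipMap f) {ζ | conj ζ + Real.pi * I ∈ P} where
  toStripMap := h.toStripMap.flip
  im_deriv_pos ζ h0 h1 := by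
    rw [deriv_flipMap]
    simpa [flipMap] using h.im_deriv_pos (conj ζ + Real.pi * I) (by simpa using h1)
      (by simpa using h0)
  bottom_pos ζ hζ hb := by
    rw [deriv_flipMap, deriv_flipMap]
    have := h.top_neg (conj ζ + Real.pi * I) hζ (by simp [hb])
    simpa [flipMap] using this
  top_neg ζ hζ hb := by
    rw [deriv_flipMap, deriv_flipMap]
    have := h.bottom_pos (conj ζ + Real.pi * I) hζ (by simp [hb])
    simpa [flipMap] using this

lemma StrictStripMap.inv {f : ℂ → ℂ} {P : Set ℂ} (h : StrictStripMap f P) :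
    StrictStripMap (invMap f) {ζ | -conj ζ ∈ P} where
  toStripMap := h.toStripMap.inv
  im_deriv_pos ζ h0 h1 := by
    rw [deriv_invMap]
    simpa [invMap] using h.im_deriv_pos (-conj ζ) (by simpa using h0) (by simpa using h1)
  bottom_pos ζ hζ hb := by
    rw [deriv_deriv_invMap]
    simpa [invMap] using h.bottom_pos (-conj ζ) hζ (by simpa using hb)
  top_neg ζ hζ hb := by
    rw [deriv_deriv_invMap]
    simpa [invMap] using h.top_neg (-conj ζ) hζ (by simpa using hb)

/-! ### Monotonicity from a positive imaginary part of the derivative -/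

lemma StripMap.not_mem_of_interior {f : ℂ → ℂ} {P : Set ℂ} (h : StripMap f P) {ζ : ℂ}
    (h0 : 0 < ζ.im) (h1 : ζ.im < Real.pi) : ζ ∉ P := fun hζ => by
  rcases h.boundary ζ hζ with h | h <;> linarith

lemma StripMap.analyticAt_of_interior {f : ℂ → ℂ} {P : Set ℂ} (h : StripMap f P) {ζ : ℂ}
    (h0 : 0 < ζ.im) (h1 : ζ.im < Real.pi) : AnalyticAt ℂ f ζ :=
  h.analyticAt ζ h0.le h1.le (h.not_mem_of_interior h0 h1)

lemma hasDerivAt_im_comp {g : ℝ → ℂ} {g' : ℂ} {t : ℝ} (h : HasDerivAt g g' t) :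
    HasDerivAt (fun x => (g x).im) g'.im t :=
  Complex.imCLM.hasFDerivAt.comp_hasDerivAt t h

lemma hasDerivAt_re_comp {g : ℝ → ℂ} {g' : ℂ} {t : ℝ} (h : HasDerivAt g g' t) :
    HasDerivAt (fun x => (g x).re) g'.re t :=
  Complex.reCLM.hasFDerivAt.comp_hasDerivAt t h

/-- Along a segment in direction `v`, `f / v` has derivative `f'`. -/
lemma hasDerivAt_segment {f : ℂ → ℂ} {z v : ℂ} (hv : v ≠ 0) {t : ℝ}
    (hf : DifferentiableAt ℂ f (z + t * v)) :
    HasDerivAt (fun x : ℝ => f (z + x * v) / v) (deriv f (z + t * v)) t := by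
  have h1 : HasDerivAt (fun x : ℝ => z + x * v) v t := by
    simpa using ((Complex.ofRealCLM.hasDerivAt (x := t)).mul_const v).const_add z
  have h2 := (hf.hasDerivAt.scomp t h1).div_const v
  exact h2.congr_deriv (mul_div_cancel_left₀ _ hv)

/-- If `Im f' > 0` on an open segment, the difference quotient of `f` along it has positive
imaginary part. -/
lemma StrictStripMap.im_slope_pos {f : ℂ → ℂ} {P : Set ℂ} (h : StrictStripMap f P) {z w : ℂ}
    (hne : z ≠ w) (hz : AnalyticAt ℂ f z) (hw : AnalyticAt ℂ f w)
    (hseg : ∀ t : ℝ, 0 < t → t < 1 → 0 < (z + t * (w - z)).im ∧ (z + t * (w - z)).im < Real.pi) :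
    0 < ((f w - f z) / (w - z)).im := by
  have hv : w - z ≠ 0 := sub_ne_zero.2 hne.symm
  have han : ∀ t ∈ Icc (0:ℝ) 1, AnalyticAt ℂ f (z + t * (w - z)) := by
    intro t ht
    rcases ht.1.eq_or_lt with h0 | h0
    · simpa [← h0] using hz
    rcases ht.2.eq_or_lt with h1 | h1
    · simpa [h1] using hw
    exact h.analyticAt_of_interior (hseg t h0 h1).1 (hseg t h0 h1).2
  have hd : ∀ t ∈ Icc (0:ℝ) 1, HasDerivAt (fun x : ℝ => (f (z + x * (w - z)) / (w - z)).im)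
      (deriv f (z + t * (w - z))).im t := fun t ht =>
    hasDerivAt_im_comp (hasDerivAt_segment hv (han t ht).differentiableAt)
  have hmono : StrictMonoOn (fun x : ℝ => (f (z + x * (w - z)) / (w - z)).im) (Icc 0 1) := by
    apply strictMonoOn_of_deriv_pos (convex_Icc 0 1)
    · exact fun t ht => (hd t ht).continuousAt.continuousWithinAt
    · intro t ht
      rw [interior_Icc] at ht
      rw [(hd t (Ioo_subset_Icc_self ht)).deriv]
      exact h.im_deriv_pos _ (hseg t ht.1 ht.2).1 (hseg t ht.1 ht.2).2
  have := hmono (left_mem_Icc.2 zero_le_one) (right_mem_Icc.2 zero_le_one) zero_lt_one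
  simp only [ofReal_zero, zero_mul, add_zero, ofReal_one, one_mul, add_sub_cancel] at this
  rw [sub_div, sub_im]
  linarith

/-- On vertical segments inside the strip `Re f` is antitone. -/
lemma StripMap.re_antitone {f : ℂ → ℂ} {P : Set ℂ} (h : StripMap f P) (ρ : ℝ) :
    AntitoneOn (fun t : ℝ => (f ⟨ρ, t⟩).re) (Ioo 0 Real.pi) := by
  have hd : ∀ t ∈ Ioo (0:ℝ) Real.pi, HasDerivAt (fun t : ℝ => (f ⟨ρ, t⟩).re)
      (-(deriv f ⟨ρ, t⟩).im) t := by
    intro t ht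
    have e1 : ∀ x : ℝ, (⟨ρ, x⟩ : ℂ) = ρ + x * I := fun x => Complex.mk_eq_add_mul_I _ _
    have h1 : HasDerivAt (fun x : ℝ => (⟨ρ, x⟩ : ℂ)) I t := by
      simp_rw [e1]
      simpa using ((Complex.ofRealCLM.hasDerivAt (x := t)).mul_const I).const_add (ρ : ℂ)
    have h2 : DifferentiableAt ℂ f ⟨ρ, t⟩ :=
      (h.analyticAt_of_interior (ζ := ⟨ρ, t⟩) ht.1 ht.2).differentiableAt
    have h3 := hasDerivAt_re_comp (h2.hasDerivAt.scomp t h1)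
    exact h3.congr_deriv (I_mul_re _)
  apply antitoneOn_of_deriv_nonpos (convex_Ioo 0 Real.pi)
  · exact fun t ht => (hd t ht).continuousAt.continuousWithinAt
  · rw [interior_Ioo]; exact fun t ht => (hd t ht).differentiableAt.differentiableWithinAt
  · rw [interior_Ioo]
    intro t ht
    rw [(hd t ht).deriv]
    have := h.im_deriv_nonneg ⟨ρ, t⟩ ht.1 ht.2
    linarith

/-! ### Sums of strip maps -/

lemma StripMap.deriv_add {f g : ℂ → ℂ} {P R : Set ℂ} (hf : StripMap f P) (hg : StripMap g R)
    {ζ : ℂ} (h0 : 0 ≤ ζ.im) (h1 : ζ.im ≤ Real.pi) (hζ : ζ ∉ P ∪ R) :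
    deriv (f + g) ζ = deriv f ζ + deriv g ζ ∧
      deriv (deriv (f + g)) ζ = deriv (deriv f) ζ + deriv (deriv g) ζ := by
  have a1 := hf.analyticAt ζ h0 h1 (fun h => hζ (.inl h))
  have a2 := hg.analyticAt ζ h0 h1 (fun h => hζ (.inr h))
  refine ⟨_root_.deriv_add a1.differentiableAt a2.differentiableAt, ?_⟩
  have : deriv (f + g) =ᶠ[𝓝 ζ] deriv f + deriv g := by
    filter_upwards [a1.eventually_analyticAt, a2.eventually_analyticAt] with w h1 h2
    exact _root_.deriv_add h1.differentiableAt h2.differentiableAt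
  rw [this.deriv_eq]
  exact _root_.deriv_add a1.deriv.differentiableAt a2.deriv.differentiableAt

/-- The other summand cannot spoil the pole: below height π/2 its real part is at least its value at
π/2, and lowering the height further does not decrease Re f either. -/
lemma StripMap.pole_add {f g : ℂ → ℂ} {P R : Set ℂ} (hf : StripMap f P) (hg : StripMap g R)
    {ζ : ℂ} (hζ : ζ ∈ P) (hb : ζ.im = 0) (c : ℝ) :
    ∃ t : ℝ, 0 < t ∧ t < Real.pi ∧ c < (f ⟨ζ.re, t⟩).re + (g ⟨ζ.re, t⟩).re := by
  have hπ := Real.pi_pos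
  obtain ⟨t, h0, h1, ht⟩ := hf.pole ζ hζ hb (c - (g ⟨ζ.re, Real.pi / 2⟩).re)
  have hm : 0 < min t (Real.pi / 2) := lt_min h0 (by linarith)
  have hm' : min t (Real.pi / 2) < Real.pi := lt_of_le_of_lt (min_le_left _ _) h1
  refine ⟨min t (Real.pi / 2), hm, hm', ?_⟩
  have i1 := hf.re_antitone ζ.re ⟨hm, hm'⟩ ⟨h0, h1⟩ (min_le_left _ _)
  have i2 := hg.re_antitone ζ.re ⟨hm, hm'⟩ ⟨by linarith, by linarith⟩ (min_le_right t (Real.pi / 2))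
  simp only at i1 i2
  linarith

lemma StripMap.zero_add {f g : ℂ → ℂ} {P R : Set ℂ} (hf : StripMap f P) (hg : StripMap g R)
    {ζ : ℂ} (hζ : ζ ∈ P) (hb : ζ.im = Real.pi) (c : ℝ) :
    ∃ t : ℝ, 0 < t ∧ t < Real.pi ∧ (f ⟨ζ.re, t⟩).re + (g ⟨ζ.re, t⟩).re < c := by
  have hπ := Real.pi_pos
  obtain ⟨t, h0, h1, ht⟩ := hf.zero ζ hζ hb (c - (g ⟨ζ.re, Real.pi / 2⟩).re)
  have hm : 0 < max t (Real.pi / 2) := lt_max_of_lt_left h0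
  have hm' : max t (Real.pi / 2) < Real.pi := max_lt h1 (by linarith)
  refine ⟨max t (Real.pi / 2), hm, hm', ?_⟩
  have i1 := hf.re_antitone ζ.re ⟨h0, h1⟩ ⟨hm, hm'⟩ (le_max_left _ _)
  have i2 := hg.re_antitone ζ.re ⟨by linarith, by linarith⟩ ⟨hm, hm'⟩ (le_max_right t (Real.pi / 2))
  simp only at i1 i2
  linarith

lemma StripMap.add {f g : ℂ → ℂ} {P R : Set ℂ} (hf : StripMap f P) (hg : StripMap g R) :
    StripMap (f + g) (P ∪ R) where
  analyticAt ζ h0 h1 hζ := (hf.analyticAt ζ h0 h1 (fun h => hζ (.inl h))).add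
    (hg.analyticAt ζ h0 h1 (fun h => hζ (.inr h)))
  boundary ζ hζ := hζ.elim (hf.boundary ζ) (hg.boundary ζ)
  im_deriv_nonneg ζ h0 h1 := by
    rw [(hf.deriv_add hg h0.le h1.le (fun h => h.elim (hf.not_mem_of_interior h0 h1)
      (hg.not_mem_of_interior h0 h1))).1, add_im]
    exact add_nonneg (hf.im_deriv_nonneg ζ h0 h1) (hg.im_deriv_nonneg ζ h0 h1)
  im_deriv_eq_zero ζ hζ hb := by
    have hπ := Real.pi_pos
    have h0 : 0 ≤ ζ.im := by rcases hb with h | h <;> linarith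
    have h1 : ζ.im ≤ Real.pi := by rcases hb with h | h <;> linarith
    rw [(hf.deriv_add hg h0 h1 hζ).1, add_im,
      hf.im_deriv_eq_zero ζ (fun h => hζ (.inl h)) hb,
      hg.im_deriv_eq_zero ζ (fun h => hζ (.inr h)) hb, _root_.add_zero]
  bottom ζ hζ hb := by
    rw [(hf.deriv_add hg hb.ge (by rw [hb]; exact Real.pi_pos.le) hζ).2, add_re]
    exact add_nonneg (hf.bottom ζ (fun h => hζ (.inl h)) hb)
      (hg.bottom ζ (fun h => hζ (.inr h)) hb)
  top ζ hζ hb := by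
    rw [(hf.deriv_add hg (by rw [hb]; exact Real.pi_pos.le) hb.le hζ).2, add_re]
    exact add_nonpos (hf.top ζ (fun h => hζ (.inl h)) hb)
      (hg.top ζ (fun h => hζ (.inr h)) hb)
  im_mem ζ hζ hb := by
    obtain ⟨m, hm⟩ := hf.im_mem ζ (fun h => hζ (.inl h)) hb
    obtain ⟨n, hn⟩ := hg.im_mem ζ (fun h => hζ (.inr h)) hb
    exact ⟨m + n, by simp [hm, hn, add_mul]⟩
  pole ζ hζ hb c := by
    rcases hζ with hζ | hζ
    · exact hf.pole_add hg hζ hb c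
    · obtain ⟨t, h0, h1, h2⟩ := hg.pole_add hf hζ hb c
      exact ⟨t, h0, h1, by simpa [add_comm] using h2⟩
  zero ζ hζ hb c := by
    rcases hζ with hζ | hζ
    · exact hf.zero_add hg hζ hb c
    · obtain ⟨t, h0, h1, h2⟩ := hg.zero_add hf hζ hb c
      exact ⟨t, h0, h1, by simpa [add_comm] using h2⟩

lemma StrictStripMap.add {f g : ℂ → ℂ} {P R : Set ℂ} (hf : StrictStripMap f P)
    (hg : StripMap g R) : StrictStripMap (f + g) (P ∪ R) where
  toStripMap := hf.toStripMap.add hg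
  im_deriv_pos ζ h0 h1 := by
    rw [(hf.toStripMap.deriv_add hg h0.le h1.le (fun h => h.elim (hf.not_mem_of_interior h0 h1)
      (hg.not_mem_of_interior h0 h1))).1, add_im]
    exact add_pos_of_pos_of_nonneg (hf.im_deriv_pos ζ h0 h1) (hg.im_deriv_nonneg ζ h0 h1)
  bottom_pos ζ hζ hb := by
    rw [(hf.toStripMap.deriv_add hg hb.ge (by rw [hb]; exact Real.pi_pos.le) hζ).2, add_re]
    exact add_pos_of_pos_of_nonneg (hf.bottom_pos ζ (fun h => hζ (.inl h)) hb)
      (hg.bottom ζ (fun h => hζ (.inr h)) hb)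
  top_neg ζ hζ hb := by
    rw [(hf.toStripMap.deriv_add hg (by rw [hb]; exact Real.pi_pos.le) hb.le hζ).2, add_re]
    exact add_neg_of_neg_of_nonpos (hf.top_neg ζ (fun h => hζ (.inl h)) hb)
      (hg.top ζ (fun h => hζ (.inr h)) hb)

/-! ### Comparing the values of a strict strip map at two points -/

/-- This is Im((f w - f z)/(w - z)) > 0 without the denominator; the two exclusions keep the open
segment inside the strip. Vertical, horizontal and equal-real-part pairs give the next three lemmas.
-/
lemma StrictStripMap.cross_pos {f : ℂ → ℂ} {P : Set ℂ} (h : StrictStripMap f P) {z w : ℂ}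
    (hne : z ≠ w) (hz0 : 0 ≤ z.im) (hz1 : z.im ≤ Real.pi) (hw0 : 0 ≤ w.im) (hw1 : w.im ≤ Real.pi)
    (hzP : z ∉ P) (hwP : w ∉ P) (hb : ¬ (z.im = 0 ∧ w.im = 0))
    (ht : ¬ (z.im = Real.pi ∧ w.im = Real.pi)) :
    0 < (f w - f z).im * (w - z).re - (f w - f z).re * (w - z).im := by
  have key : 0 < ((f w - f z) / (w - z)).im := by
    apply h.im_slope_pos hne (h.analyticAt z hz0 hz1 hzP) (h.analyticAt w hw0 hw1 hwP)
    intro t ht0 ht1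
    have e : (z + t * (w - z)).im = (1 - t) * z.im + t * w.im := by simp; ring
    rw [e]
    have h1t : 0 < 1 - t := by linarith
    constructor
    · rcases hz0.eq_or_lt with hz | hz
      · have : 0 < w.im := lt_of_le_of_ne hw0 (fun h => hb ⟨hz.symm, h.symm⟩)
        positivity
      · have := mul_pos h1t hz
        have := mul_nonneg ht0.le hw0
        linarith
    · rcases hz1.eq_or_lt with hz | hz
      · have : w.im < Real.pi := lt_of_le_of_ne hw1 (fun h => ht ⟨hz, h⟩)
        nlinarith
      · nlinarith
  rw [Complex.div_im, ← sub_div] at key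
  have hn : 0 < normSq (w - z) := normSq_pos.2 (sub_ne_zero.2 hne.symm)
  exact (div_pos_iff_of_pos_right hn).1 key

lemma StrictStripMap.re_strictAnti {f : ℂ → ℂ} {P : Set ℂ} (h : StrictStripMap f P) {ρ s t : ℝ}
    (hs : 0 ≤ s) (hst : s < t) (ht : t ≤ Real.pi) (hsP : (⟨ρ, s⟩ : ℂ) ∉ P)
    (htP : (⟨ρ, t⟩ : ℂ) ∉ P) : (f ⟨ρ, t⟩).re < (f ⟨ρ, s⟩).re := by
  have := h.cross_pos (z := ⟨ρ, s⟩) (w := ⟨ρ, t⟩) (by simpa using hst.ne) hs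
    (hst.le.trans ht) (hs.trans hst.le) ht hsP htP
    (fun h => by have h1 := h.1; have h2 := h.2; simp only at h1 h2; linarith)
    (fun h => by have h1 := h.1; have h2 := h.2; simp only at h1 h2; linarith)
  simp at this
  nlinarith

lemma StrictStripMap.im_strictMono {f : ℂ → ℂ} {P : Set ℂ} (h : StrictStripMap f P) {ρ σ t : ℝ}
    (h0 : 0 < t) (h1 : t < Real.pi) (hρ : ρ < σ) : (f ⟨ρ, t⟩).im < (f ⟨σ, t⟩).im := by
  have := h.cross_pos (z := ⟨ρ, t⟩) (w := ⟨σ, t⟩) (by simpa using hρ.ne) h0.le h1.le h0.le h1.le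
    (h.not_mem_of_interior h0 h1) (h.not_mem_of_interior h0 h1)
    (fun h => h0.ne' h.1) (fun h => h1.ne h.1)
  simp at this
  nlinarith

lemma StrictStripMap.im_lt_of_re_eq {f : ℂ → ℂ} {P : Set ℂ} (h : StrictStripMap f P) {z w : ℂ}
    (hz0 : 0 ≤ z.im) (hz1 : z.im ≤ Real.pi) (hw0 : 0 ≤ w.im) (hw1 : w.im ≤ Real.pi)
    (hzP : z ∉ P) (hwP : w ∉ P) (hb : ¬ (z.im = 0 ∧ w.im = 0))
    (ht : ¬ (z.im = Real.pi ∧ w.im = Real.pi)) (hre : (f z).re = (f w).re) (hlt : z.re < w.re) :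
    (f z).im < (f w).im := by
  have := h.cross_pos (fun e => hlt.ne (by rw [e])) hz0 hz1 hw0 hw1 hzP hwP hb ht
  simp [hre] at this
  nlinarith

/-! ### The completed level line -/

/-- The height at which the vertical line through `ρ` meets the level line `Re f = c`. -/
noncomputable def levelAngle (f : ℂ → ℂ) (c ρ : ℝ) : ℝ :=
  sSup (insert 0 {t : ℝ | 0 < t ∧ t < Real.pi ∧ c ≤ (f ⟨ρ, t⟩).re})

/-- The level line `Re f = c`, completed by boundary segments. -/
noncomputable def levelPath (f : ℂ → ℂ) (c ρ : ℝ) : ℂ := ⟨ρ, levelAngle f c ρ⟩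

lemma levelAngle_bddAbove (f : ℂ → ℂ) (c ρ : ℝ) :
    BddAbove (insert 0 {t : ℝ | 0 < t ∧ t < Real.pi ∧ c ≤ (f ⟨ρ, t⟩).re}) :=
  ⟨Real.pi, by rintro t (rfl | ht); exacts [Real.pi_pos.le, ht.2.1.le]⟩

lemma levelAngle_nonneg (f : ℂ → ℂ) (c ρ : ℝ) : 0 ≤ levelAngle f c ρ :=
  le_csSup (levelAngle_bddAbove f c ρ) (mem_insert _ _)

lemma levelAngle_le_pi (f : ℂ → ℂ) (c ρ : ℝ) : levelAngle f c ρ ≤ Real.pi :=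
  csSup_le ⟨0, mem_insert _ _⟩ (by rintro t (rfl | ht); exacts [Real.pi_pos.le, ht.2.1.le])

lemma re_lt_of_levelAngle_lt {f : ℂ → ℂ} {c ρ t : ℝ} (h : levelAngle f c ρ < t)
    (ht : t < Real.pi) : (f ⟨ρ, t⟩).re < c := by
  by_contra! hc
  exact h.not_ge (le_csSup (levelAngle_bddAbove f c ρ)
    (Or.inr ⟨(levelAngle_nonneg f c ρ).trans_lt h, ht, hc⟩))

lemma le_levelAngle {f : ℂ → ℂ} {c ρ t : ℝ} (h0 : 0 < t) (ht : t < Real.pi)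
    (hc : c ≤ (f ⟨ρ, t⟩).re) : t ≤ levelAngle f c ρ :=
  le_csSup (levelAngle_bddAbove f c ρ) (Or.inr ⟨h0, ht, hc⟩)

section

variable {f : ℂ → ℂ} {P : Set ℂ}

lemma StrictStripMap.lt_re_of_lt_levelAngle (hf : StrictStripMap f P) {c ρ t : ℝ} (h0 : 0 < t)
    (h : t < levelAngle f c ρ) : c < (f ⟨ρ, t⟩).re := by
  obtain ⟨s, hs, hts⟩ := exists_lt_of_lt_csSup ⟨0, mem_insert _ _⟩ h
  rcases hs with rfl | hs
  · linarith
  · exact hs.2.2.trans_lt (hf.re_strictAnti h0.le hts hs.2.1.le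
      (hf.not_mem_of_interior h0 (hts.trans hs.2.1)) (hf.not_mem_of_interior hs.1 hs.2.1))

lemma StripMap.continuousAt_re (hf : StripMap f P) {ζ : ℂ} (h0 : 0 ≤ ζ.im)
    (h1 : ζ.im ≤ Real.pi) (hζ : ζ ∉ P) : ContinuousAt (fun z => (f z).re) ζ :=
  Complex.continuous_re.continuousAt.comp (hf.analyticAt ζ h0 h1 hζ).continuousAt

lemma continuous_mk_left (t : ℝ) : Continuous fun ρ : ℝ => (⟨ρ, t⟩ : ℂ) := by
  simp_rw [Complex.mk_eq_add_mul_I]; fun_prop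

lemma continuous_mk_right (ρ : ℝ) : Continuous fun t : ℝ => (⟨ρ, t⟩ : ℂ) := by
  simp_rw [Complex.mk_eq_add_mul_I]; fun_prop

/-- A height strictly between the level angle and a given bound is interior, and Re f ≠ c there.
That strict inequality survives a small change of the abscissa and keeps the nearby level angles on
the right side of the bound. Only interior heights are tested, so the boundary values 0 and π need
no separate treatment. -/
lemma StrictStripMap.continuous_levelAngle (hf : StrictStripMap f P) (c : ℝ) :
    Continuous (levelAngle f c) := by
  have hcont : ∀ ρ t : ℝ, 0 < t → t < Real.pi →
      ContinuousAt (fun σ : ℝ => (f ⟨σ, t⟩).re) ρ := fun ρ t h0 h1 =>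
    ContinuousAt.comp (f := fun σ : ℝ => (⟨σ, t⟩ : ℂ)) (g := fun z => (f z).re)
      (hf.continuousAt_re (ζ := ⟨ρ, t⟩) h0.le h1.le (hf.not_mem_of_interior h0 h1))
      (continuous_mk_left t).continuousAt
  rw [continuous_iff_continuousAt]
  intro ρ
  apply tendsto_order.2 ⟨fun b hb => ?_, fun b hb => ?_⟩
  · by_cases hb0 : b < 0
    · exact Eventually.of_forall fun σ => hb0.trans_le (levelAngle_nonneg f c σ)
    · obtain ⟨t, ht1, ht2⟩ := exists_between hb
      have h0 : 0 < t := by linarith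
      have h1 : t < Real.pi := ht2.trans_le (levelAngle_le_pi f c ρ)
      filter_upwards [(hcont ρ t h0 h1).eventually_const_lt (hf.lt_re_of_lt_levelAngle h0 ht2)]
        with σ hσ
      exact ht1.trans_le (le_levelAngle h0 h1 hσ.le)
  · by_cases hb0 : Real.pi < b
    · exact Eventually.of_forall fun σ => (levelAngle_le_pi f c σ).trans_lt hb0
    · obtain ⟨t, ht1, ht2⟩ := exists_between hb
      have h0 : 0 < t := (levelAngle_nonneg f c ρ).trans_lt ht1
      have h1 : t < Real.pi := by linarith
      filter_upwards [(hcont ρ t h0 h1).eventually_lt_const (re_lt_of_levelAngle_lt ht1 h1)]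
        with σ hσ
      refine lt_of_le_of_lt ?_ ht2
      by_contra! hlt
      exact (hf.lt_re_of_lt_levelAngle h0 hlt).not_gt hσ

/-- Above a lower singularity Re f exceeds c somewhere, which lifts the path off the lower line;
below an upper singularity Re f drops under c, which pushes it off the upper line. -/
lemma StrictStripMap.levelPath_notMem (hf : StrictStripMap f P) (c ρ : ℝ) :
    levelPath f c ρ ∉ P := by
  intro hP
  rcases hf.boundary _ hP with h | h
  · obtain ⟨t, h0, h1, ht⟩ := hf.pole _ hP h c
    have h2 := le_levelAngle (ρ := ρ) h0 h1 ht.le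
    simp only [levelPath] at h
    linarith
  · obtain ⟨t, h0, h1, ht⟩ := hf.zero _ hP h c
    have h2 := hf.lt_re_of_lt_levelAngle (c := c) (ρ := ρ) (t := t) h0
      (by simp only [levelPath] at h; rwa [h])
    exact h2.not_gt ht

lemma StrictStripMap.analyticAt_levelPath (hf : StrictStripMap f P) (c ρ : ℝ) :
    AnalyticAt ℂ f (levelPath f c ρ) :=
  hf.analyticAt _ (levelAngle_nonneg f c ρ) (levelAngle_le_pi f c ρ) (hf.levelPath_notMem c ρ)

lemma StrictStripMap.continuous_levelPath (hf : StrictStripMap f P) (c : ℝ) :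
    Continuous (levelPath f c) := by
  have := hf.continuous_levelAngle c
  have e : levelPath f c = fun ρ : ℝ => (ρ : ℂ) + levelAngle f c ρ * I := by
    ext ρ; exact Complex.mk_eq_add_mul_I _ _
  rw [e]
  fun_prop

lemma StrictStripMap.continuous_comp_levelPath (hf : StrictStripMap f P) (c : ℝ) :
    Continuous fun ρ => f (levelPath f c ρ) :=
  continuous_iff_continuousAt.2 fun ρ =>
    ContinuousAt.comp (f := levelPath f c) (hf.analyticAt_levelPath c ρ).continuousAt
      (hf.continuous_levelPath c).continuousAt

lemma StrictStripMap.re_levelPath_le (hf : StrictStripMap f P) {c ρ : ℝ}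
    (h : levelAngle f c ρ < Real.pi) : (f (levelPath f c ρ)).re ≤ c := by
  have hc : ContinuousAt (fun t : ℝ => (f ⟨ρ, t⟩).re) (levelAngle f c ρ) :=
    ContinuousAt.comp (f := fun t : ℝ => (⟨ρ, t⟩ : ℂ)) (g := fun z => (f z).re)
      (hf.continuousAt_re (ζ := levelPath f c ρ) (levelAngle_nonneg f c ρ) h.le
        (hf.levelPath_notMem c ρ)) (continuous_mk_right ρ).continuousAt
  refine le_of_tendsto (hc.tendsto.mono_left (nhdsWithin_le_nhds (s := Ioi (levelAngle f c ρ)))) ?_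
  filter_upwards [Ioo_mem_nhdsGT h] with t ht
  exact (re_lt_of_levelAngle_lt ht.1 ht.2).le

lemma StrictStripMap.le_re_levelPath (hf : StrictStripMap f P) {c ρ : ℝ}
    (h : 0 < levelAngle f c ρ) : c ≤ (f (levelPath f c ρ)).re := by
  have hc : ContinuousAt (fun t : ℝ => (f ⟨ρ, t⟩).re) (levelAngle f c ρ) :=
    ContinuousAt.comp (f := fun t : ℝ => (⟨ρ, t⟩ : ℂ)) (g := fun z => (f z).re)
      (hf.continuousAt_re (ζ := levelPath f c ρ) h.le (levelAngle_le_pi f c ρ)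
        (hf.levelPath_notMem c ρ)) (continuous_mk_right ρ).continuousAt
  refine ge_of_tendsto (hc.tendsto.mono_left (nhdsWithin_le_nhds (s := Iio (levelAngle f c ρ)))) ?_
  filter_upwards [Ioo_mem_nhdsLT h] with t ht
  exact (hf.lt_re_of_lt_levelAngle ht.1 ht.2).le

lemma StrictStripMap.levelAngle_le (hf : StrictStripMap f P) {c : ℝ} {ζ : ℂ} (h0 : 0 ≤ ζ.im)
    (hζ : ζ ∉ P) (hc : (f ζ).re ≤ c) : levelAngle f c ζ.re ≤ ζ.im := by
  by_contra! h
  obtain ⟨t, ht1, ht2⟩ := exists_between h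
  have h1 := hf.lt_re_of_lt_levelAngle (h0.trans_lt ht1) ht2
  have h2 : t < Real.pi := ht2.trans_le (levelAngle_le_pi _ _ _)
  have h3 := hf.re_strictAnti (ρ := ζ.re) h0 ht1 h2.le hζ
    (hf.not_mem_of_interior (h0.trans_lt ht1) h2)
  exact absurd (h1.trans (h3.trans_le hc)) (lt_irrefl _)

lemma StrictStripMap.le_levelAngle (hf : StrictStripMap f P) {c : ℝ} {ζ : ℂ}
    (h1 : ζ.im ≤ Real.pi) (hζ : ζ ∉ P) (hc : c ≤ (f ζ).re) : ζ.im ≤ levelAngle f c ζ.re := by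
  by_contra! h
  obtain ⟨t, ht1, ht2⟩ := exists_between h
  have h0 : 0 < t := (levelAngle_nonneg _ _ _).trans_lt ht1
  have h2 := re_lt_of_levelAngle_lt ht1 (ht2.trans_le h1)
  have h3 := hf.re_strictAnti (ρ := ζ.re) h0.le ht2 h1
    (hf.not_mem_of_interior h0 (ht2.trans_le h1)) hζ
  exact absurd (hc.trans_lt (h3.trans h2)) (lt_irrefl _)

/-- Every point of the level set lies on the level path. -/
lemma StrictStripMap.levelPath_re (hf : StrictStripMap f P) {c : ℝ} {ζ : ℂ} (h0 : 0 ≤ ζ.im)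
    (h1 : ζ.im ≤ Real.pi) (hζ : ζ ∉ P) (hc : (f ζ).re = c) : levelPath f c ζ.re = ζ :=
  Complex.ext rfl (le_antisymm (hf.levelAngle_le h0 hζ hc.le) (hf.le_levelAngle h1 hζ hc.ge))

lemma StrictStripMap.levelAngle_boundary (hf : StrictStripMap f P) {c ρ : ℝ}
    (h : (f (levelPath f c ρ)).re ≠ c) : levelAngle f c ρ = 0 ∨ levelAngle f c ρ = Real.pi := by
  by_contra! hc
  exact h (le_antisymm (hf.re_levelPath_le (lt_of_le_of_ne (levelAngle_le_pi _ _ _) hc.2))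
    (hf.le_re_levelPath (lt_of_le_of_ne (levelAngle_nonneg _ _ _) hc.1.symm)))

/-- A connected subset of a countable set of reals is a single point, and the end points follow by
continuity. -/
lemma eq_of_forall_int_mul {g : ℝ → ℝ} (hg : Continuous g) {q : ℝ} {x y : ℝ}
    (hxy : x < y) (h : ∀ t ∈ Ioo x y, ∃ n : ℤ, g t = n * q) : g x = g y := by
  have hconst : ∀ s ∈ Ioo x y, ∀ t ∈ Ioo x y, g s = g t := by
    intro s hs t ht
    have hpre : IsPreconnected (g '' Ioo x y) := isPreconnected_Ioo.image _ hg.continuousOn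
    have hsub : g '' Ioo x y ⊆ range fun n : ℤ => (n : ℝ) * q := by
      rintro _ ⟨u, hu, rfl⟩
      obtain ⟨n, hn⟩ := h u hu
      exact ⟨n, hn.symm⟩
    exact (countable_range _).isTotallyDisconnected _ hsub hpre
      (mem_image_of_mem _ hs) (mem_image_of_mem _ ht)
  obtain ⟨m, hm⟩ := nonempty_Ioo.2 hxy
  have hx : g x = g m := by
    refine tendsto_nhds_unique ((hg.tendsto x).mono_left (nhdsWithin_le_nhds (s := Ioi x)))
      (tendsto_const_nhds.congr' ?_)
    filter_upwards [Ioo_mem_nhdsGT hxy] with t ht using hconst m hm t ht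
  have hy : g y = g m := by
    refine tendsto_nhds_unique ((hg.tendsto y).mono_left (nhdsWithin_le_nhds (s := Iio y)))
      (tendsto_const_nhds.congr' ?_)
    filter_upwards [Ioo_mem_nhdsLT hxy] with t ht using hconst m hm t ht
  rw [hx, hy]

/-- `Im f` is constant along the completed level path where it leaves the level set. -/
lemma StrictStripMap.im_levelPath_eq (hf : StrictStripMap f P) {c x y : ℝ} (hxy : x < y)
    (h : ∀ t ∈ Ioo x y, (f (levelPath f c t)).re ≠ c) :
    (f (levelPath f c x)).im = (f (levelPath f c y)).im :=
  eq_of_forall_int_mul (Complex.continuous_im.comp (hf.continuous_comp_levelPath c)) hxy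
    fun t ht => hf.im_mem _ (hf.levelPath_notMem c t) (hf.levelAngle_boundary (h t ht))

lemma StrictStripMap.isClosed_level (hf : StrictStripMap f P) (c : ℝ) :
    IsClosed {t | (f (levelPath f c t)).re = c} :=
  isClosed_eq (Complex.continuous_re.comp (hf.continuous_comp_levelPath c)) continuous_const

/-- The last level point before a point of the completed level path. -/
lemma StrictStripMap.exists_level_left (hf : StrictStripMap f P) {c x y : ℝ} (hxy : x ≤ y)
    (hx : (f (levelPath f c x)).re = c) (hy : (f (levelPath f c y)).re ≠ c) :
    ∃ t, x ≤ t ∧ t < y ∧ (f (levelPath f c t)).re = c ∧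
      (f (levelPath f c t)).im = (f (levelPath f c y)).im := by
  have hcpt : IsCompact (Icc x y ∩ {t | (f (levelPath f c t)).re = c}) :=
    isCompact_Icc.inter_right (hf.isClosed_level c)
  obtain ⟨t, ⟨⟨h1, h2⟩, h3⟩, hmax⟩ := hcpt.exists_isGreatest ⟨x, ⟨le_rfl, hxy⟩, hx⟩
  have hlt : t < y := lt_of_le_of_ne h2 (fun e => hy (e ▸ h3))
  refine ⟨t, h1, hlt, h3, hf.im_levelPath_eq hlt fun u hu h => ?_⟩
  exact (hmax ⟨⟨h1.trans hu.1.le, hu.2.le⟩, h⟩).not_gt hu.1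

lemma StrictStripMap.exists_level_right (hf : StrictStripMap f P) {c x y : ℝ} (hxy : x ≤ y)
    (hx : (f (levelPath f c x)).re ≠ c) (hy : (f (levelPath f c y)).re = c) :
    ∃ t, x < t ∧ t ≤ y ∧ (f (levelPath f c t)).re = c ∧
      (f (levelPath f c t)).im = (f (levelPath f c x)).im := by
  have hcpt : IsCompact (Icc x y ∩ {t | (f (levelPath f c t)).re = c}) :=
    isCompact_Icc.inter_right (hf.isClosed_level c)
  obtain ⟨t, ⟨⟨h1, h2⟩, h3⟩, hmin⟩ := hcpt.exists_isLeast ⟨y, ⟨hxy, le_rfl⟩, hy⟩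
  have hlt : x < t := lt_of_le_of_ne h1 (fun e => hx (e ▸ h3))
  refine ⟨t, hlt, h2, h3, (hf.im_levelPath_eq hlt fun u hu h => ?_).symm⟩
  exact (hmin ⟨⟨hu.1.le, hu.2.le.trans h2⟩, h⟩).not_gt hu.2

end

/-! ### Repeated and intermediate values on a level line -/

/-- The closed strip without the singularities `P`. -/
def regularStrip (P : Set ℂ) : Set ℂ := {ζ | 0 ≤ ζ.im ∧ ζ.im ≤ Real.pi ∧ ζ ∉ P}

lemma conj_add_pi_mem_regularStrip {P : Set ℂ} {ζ : ℂ} (h : ζ ∈ regularStrip P) :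
    conj ζ + Real.pi * I ∈ regularStrip {ζ | conj ζ + Real.pi * I ∈ P} := by
  refine ⟨by simpa using h.2.1, by simpa using h.1, ?_⟩
  simpa using h.2.2

lemma flipMap_conj_add_pi (f : ℂ → ℂ) (ζ : ℂ) :
    flipMap f (conj ζ + Real.pi * I) = -conj (f ζ) := by simp [flipMap]

lemma hasDerivAt_horizontal {f : ℂ → ℂ} {ρ t : ℝ} (hf : DifferentiableAt ℂ f ⟨ρ, t⟩) :
    HasDerivAt (fun x : ℝ => f ⟨x, t⟩) (deriv f ⟨ρ, t⟩) ρ := by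
  have h1 : HasDerivAt (fun x : ℝ => (⟨x, t⟩ : ℂ)) 1 ρ := by
    simp_rw [Complex.mk_eq_add_mul_I]
    simpa using (Complex.ofRealCLM.hasDerivAt (x := ρ)).add_const (t * I : ℂ)
  exact (hf.hasDerivAt.scomp ρ h1).congr_deriv (one_smul ℂ _)

section

variable {f : ℂ → ℂ} {P : Set ℂ}

lemma StripMap.analyticAt_of_mem (hf : StripMap f P) {ζ : ℂ} (h : ζ ∈ regularStrip P) :
    AnalyticAt ℂ f ζ := hf.analyticAt ζ h.1 h.2.1 h.2.2

lemma StrictStripMap.levelPath_mem (hf : StrictStripMap f P) (c ρ : ℝ) :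
    levelPath f c ρ ∈ regularStrip P :=
  ⟨levelAngle_nonneg _ _ _, levelAngle_le_pi _ _ _, hf.levelPath_notMem c ρ⟩

lemma StrictStripMap.eq_of_re_eq (hf : StrictStripMap f P) {z w : ℂ} (hz : z ∈ regularStrip P)
    (hw : w ∈ regularStrip P) (h : (f z).re = (f w).re) (hre : z.re = w.re) : z = w := by
  have := hf.levelPath_re hz.1 hz.2.1 hz.2.2 h
  rwa [hre, hf.levelPath_re hw.1 hw.2.1 hw.2.2 rfl, eq_comm] at this

/-- Two points on the same boundary line escape the strict comparison. They are approached at a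
common interior height, where Im f increases to the right; only the weak inequality survives the
limit. -/
lemma StrictStripMap.im_le_of_re_eq (hf : StrictStripMap f P) {z w : ℂ}
    (hz : z ∈ regularStrip P) (hw : w ∈ regularStrip P) (h : (f z).re = (f w).re)
    (hlt : z.re < w.re) : (f z).im ≤ (f w).im := by
  by_cases hne : z.im = w.im
  · have hne' : (𝓝[Ioo 0 Real.pi] z.im).NeBot := by
      rw [← mem_closure_iff_nhdsWithin_neBot, closure_Ioo Real.pi_pos.ne]
      exact ⟨hz.1, hz.2.1⟩
    have lim : ∀ v : ℂ, v ∈ regularStrip P → v.im = z.im →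
        Tendsto (fun t : ℝ => (f ⟨v.re, t⟩).im) (𝓝[Ioo 0 Real.pi] z.im) (𝓝 (f v).im) := by
      intro v hv hvz
      have h1 : ContinuousAt (fun t : ℝ => f ⟨v.re, t⟩) v.im :=
        ContinuousAt.comp (f := fun t : ℝ => (⟨v.re, t⟩ : ℂ)) (g := f)
          (hf.analyticAt_of_mem hv).continuousAt (continuous_mk_right v.re).continuousAt
      rw [hvz] at h1
      have h2 := (Complex.continuous_im.continuousAt.comp h1).tendsto
      simp only [Function.comp_apply, ← hvz] at h2
      rw [← hvz]
      exact h2.mono_left nhdsWithin_le_nhds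
    refine le_of_tendsto_of_tendsto (lim z hz rfl) (lim w hw hne.symm) ?_
    filter_upwards [self_mem_nhdsWithin] with t ht
    exact (hf.im_strictMono ht.1 ht.2 hlt).le
  · refine (hf.im_lt_of_re_eq hz.1 hz.2.1 hw.1 hw.2.1 hz.2.2 hw.2.2 (fun e => hne ?_)
      (fun e => hne ?_) h hlt).le
    · rw [e.1, e.2]
    · rw [e.1, e.2]

/-- An interior level point between z and w would have Im f strictly between two equal numbers. So
the level path stays on the lower line from z to w; in particular there is no singularity on that
segment, and f' is real and strictly increasing there. By Rolle f' vanishes strictly between z and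
w, hence not at them; a further level point would give two zeros of f'. -/
lemma StrictStripMap.bottom_plateau (hf : StrictStripMap f P) {z w : ℂ}
    (hz : z ∈ regularStrip P) (hw : w ∈ regularStrip P) (h : f z = f w) (hlt : z.re < w.re)
    (hz0 : z.im = 0) (hw0 : w.im = 0) :
    deriv f z ≠ 0 ∧ deriv f w ≠ 0 ∧
      ∀ ζ ∈ regularStrip P, z.re < ζ.re → ζ.re < w.re → (f ζ).re ≠ (f z).re := by
  have hπ := Real.pi_pos
  set c := (f z).re with hc
  have hpz : levelPath f c z.re = z := hf.levelPath_re hz.1 hz.2.1 hz.2.2 rfl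
  have hpw : levelPath f c w.re = w := hf.levelPath_re hw.1 hw.2.1 hw.2.2 (by rw [hc, h])
  have haz : levelAngle f c z.re = 0 := by rw [← hz0]; exact congrArg Complex.im hpz
  have haw : levelAngle f c w.re = 0 := by rw [← hw0]; exact congrArg Complex.im hpw
  have hnot : ∀ ρ, z.re < ρ → ρ < w.re →
      ¬ (0 < levelAngle f c ρ ∧ levelAngle f c ρ < Real.pi) := by
    rintro ρ h1 h2 ⟨h3, h4⟩
    have hre : (f (levelPath f c ρ)).re = c :=
      le_antisymm (hf.re_levelPath_le h4) (hf.le_re_levelPath h3)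
    have hm := hf.levelPath_mem c ρ
    have i1 := hf.im_lt_of_re_eq hz.1 hz.2.1 hm.1 hm.2.1 hz.2.2 hm.2.2 (fun e => h3.ne' e.2)
      (fun e => h4.ne e.2) hre.symm h1
    have i2 := hf.im_lt_of_re_eq hm.1 hm.2.1 hw.1 hw.2.1 hm.2.2 hw.2.2 (fun e => h3.ne' e.1)
      (fun e => h4.ne e.1) (hre.trans (by rw [hc, h])) h2
    rw [h] at i1
    exact i1.not_gt i2
  have hzero : ∀ ρ ∈ Icc z.re w.re, levelAngle f c ρ = 0 := by
    intro ρ hρ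
    rcases hρ.1.eq_or_lt with h1 | h1
    · rw [← h1, haz]
    rcases hρ.2.eq_or_lt with h2 | h2
    · rw [h2, haw]
    by_contra hne
    have hpi : levelAngle f c ρ = Real.pi := by
      by_contra hne'
      exact hnot ρ h1 h2 ⟨lt_of_le_of_ne (levelAngle_nonneg _ _ _) (Ne.symm hne),
        lt_of_le_of_ne (levelAngle_le_pi _ _ _) hne'⟩
    -- The path cannot reach the upper line without passing through height π/2, an excluded interior
    -- position.
    obtain ⟨σ, hσ, hσ'⟩ := intermediate_value_Icc hρ.1 (hf.continuous_levelAngle c).continuousOn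
      (show Real.pi / 2 ∈ Icc _ _ by rw [haz, hpi]; constructor <;> linarith)
    have hσ1 : z.re < σ := lt_of_le_of_ne hσ.1 (fun e => by rw [← e, haz] at hσ'; linarith)
    exact hnot σ hσ1 (hσ.2.trans_lt h2) ⟨by linarith, by linarith⟩
  have hpath : ∀ ρ ∈ Icc z.re w.re, (⟨ρ, 0⟩ : ℂ) = levelPath f c ρ := fun ρ hρ => by
    rw [levelPath, hzero ρ hρ]
  have han : ∀ ρ ∈ Icc z.re w.re, AnalyticAt ℂ f ⟨ρ, 0⟩ := fun ρ hρ => by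
    rw [hpath ρ hρ]; exact hf.analyticAt_levelPath c ρ
  have hd : ∀ ρ ∈ Icc z.re w.re,
      HasDerivAt (fun x : ℝ => (f ⟨x, 0⟩).re) (deriv f ⟨ρ, 0⟩).re ρ := fun ρ hρ =>
    hasDerivAt_re_comp (hasDerivAt_horizontal (han ρ hρ).differentiableAt)
  have hd2 : ∀ ρ ∈ Icc z.re w.re, HasDerivAt (fun x : ℝ => (deriv f ⟨x, 0⟩).re)
      (deriv (deriv f) ⟨ρ, 0⟩).re ρ := fun ρ hρ =>
    hasDerivAt_re_comp (hasDerivAt_horizontal (han ρ hρ).deriv.differentiableAt)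
  have hmono : StrictMonoOn (fun x : ℝ => (deriv f ⟨x, 0⟩).re) (Icc z.re w.re) := by
    apply strictMonoOn_of_deriv_pos (convex_Icc _ _)
    · exact fun t ht => (hd2 t ht).continuousAt.continuousWithinAt
    · intro t ht
      have ht' := interior_subset ht
      rw [(hd2 t ht').deriv]
      exact hf.bottom_pos _ (by rw [hpath t ht']; exact hf.levelPath_notMem c t) rfl
  have hrolle : ∀ x ∈ Icc z.re w.re, ∀ y ∈ Icc z.re w.re, x < y →
      (f ⟨x, 0⟩).re = (f ⟨y, 0⟩).re → ∃ t ∈ Ioo x y, (deriv f ⟨t, 0⟩).re = 0 := by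
    intro x hx y hy hxy he
    refine exists_hasDerivAt_eq_zero (f := fun x : ℝ => (f ⟨x, 0⟩).re)
      (f' := fun x : ℝ => (deriv f ⟨x, 0⟩).re) hxy ?_ he ?_
    · exact fun t ht => (hd t ⟨hx.1.trans ht.1, ht.2.trans hy.2⟩).continuousAt.continuousWithinAt
    · exact fun t ht => hd t ⟨hx.1.trans ht.1.le, ht.2.le.trans hy.2⟩
  have ez : (⟨z.re, 0⟩ : ℂ) = z := Complex.ext rfl hz0.symm
  have ew : (⟨w.re, 0⟩ : ℂ) = w := Complex.ext rfl hw0.symm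
  have mz : z.re ∈ Icc z.re w.re := ⟨le_rfl, hlt.le⟩
  have mw : w.re ∈ Icc z.re w.re := ⟨hlt.le, le_rfl⟩
  obtain ⟨t, ht, ht0⟩ := hrolle _ mz _ mw hlt (by rw [ez, ew, h])
  refine ⟨fun h0 => ?_, fun h0 => ?_, fun ζ hζ h1 h2 hre => ?_⟩
  · have := hmono mz ⟨ht.1.le, ht.2.le⟩ ht.1
    simp only [ez, h0, ht0] at this
    simp at this
  · have := hmono ⟨ht.1.le, ht.2.le⟩ mw ht.2
    simp only [ew, h0, ht0] at this
    simp at this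
  · have m : ζ.re ∈ Icc z.re w.re := ⟨h1.le, h2.le⟩
    have eζ : (⟨ζ.re, 0⟩ : ℂ) = ζ := by
      rw [hpath _ m]; exact hf.levelPath_re hζ.1 hζ.2.1 hζ.2.2 hre
    obtain ⟨x, hx, hx0⟩ := hrolle _ mz _ m h1 (by rw [ez, eζ, hre])
    obtain ⟨y, hy, hy0⟩ := hrolle _ m _ mw h2 (by rw [ew, eζ, hre, ← h])
    have := hmono ⟨hx.1.le, hx.2.le.trans h2.le⟩ ⟨h1.le.trans hy.1.le, hy.2.le⟩
      (hx.2.trans hy.1)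
    simp only [hx0, hy0] at this
    exact lt_irrefl _ this

/-- Two points where `f` takes the same value lie on the same boundary line, are not critical, and
there is no further point of the level set between them. -/
lemma StrictStripMap.plateau (hf : StrictStripMap f P) {z w : ℂ}
    (hz : z ∈ regularStrip P) (hw : w ∈ regularStrip P) (h : f z = f w) (hlt : z.re < w.re) :
    (z.im = 0 ∨ z.im = Real.pi) ∧ z.im = w.im ∧ deriv f z ≠ 0 ∧ deriv f w ≠ 0 ∧
      ∀ ζ ∈ regularStrip P, z.re < ζ.re → ζ.re < w.re → (f ζ).re ≠ (f z).re := by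
  by_cases hb : z.im = 0 ∧ w.im = 0
  · exact ⟨.inl hb.1, by rw [hb.1, hb.2], hf.bottom_plateau hz hw h hlt hb.1 hb.2⟩
  by_cases ht : z.im = Real.pi ∧ w.im = Real.pi
  · obtain ⟨h1, h2, h3⟩ := hf.flip.bottom_plateau (conj_add_pi_mem_regularStrip hz)
      (conj_add_pi_mem_regularStrip hw) (by simp [flipMap, h]) (by simpa using hlt)
      (by simp [ht.1]) (by simp [ht.2])
    rw [deriv_flipMap, flipMap_conj_add_pi] at h1 h2
    refine ⟨.inr ht.1, by rw [ht.1, ht.2], by simpa using h1, by simpa using h2,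
      fun ζ hζ i1 i2 => ?_⟩
    have := h3 _ (conj_add_pi_mem_regularStrip hζ) (by simpa using i1) (by simpa using i2)
    simpa [flipMap_conj_add_pi] using this
  · exact absurd (hf.im_lt_of_re_eq hz.1 hz.2.1 hw.1 hw.2.1 hz.2.2 hw.2.2 hb ht (by rw [h]) hlt)
      (by rw [h]; exact lt_irrefl _)

/-- Between two points of a level set `Im f` takes all intermediate values. -/
lemma StrictStripMap.exists_between (hf : StrictStripMap f P) {z w : ℂ}
    (hz : z ∈ regularStrip P) (hw : w ∈ regularStrip P) (h : (f z).re = (f w).re)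
    (hlt : z.re < w.re) {v : ℝ} (h1 : (f z).im < v) (h2 : v < (f w).im) :
    ∃ ζ ∈ regularStrip P, z.re < ζ.re ∧ ζ.re < w.re ∧ (f ζ).re = (f z).re ∧ (f ζ).im = v := by
  set c := (f z).re with hc
  have hpz : levelPath f c z.re = z := hf.levelPath_re hz.1 hz.2.1 hz.2.2 rfl
  have hpw : levelPath f c w.re = w := hf.levelPath_re hw.1 hw.2.1 hw.2.2 h.symm
  obtain ⟨ρ, hρ, hρv⟩ := intermediate_value_Icc hlt.le
    (Complex.continuous_im.comp (hf.continuous_comp_levelPath c)).continuousOn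
    (show v ∈ Icc _ _ by simp only [Function.comp_apply, hpz, hpw]; exact ⟨h1.le, h2.le⟩)
  simp only [Function.comp_apply] at hρv
  -- The point found may lie where the completed path is off the level set. Im f is constant on that
  -- stretch, so the last level point before it has the same value.
  have key : ∃ t, z.re ≤ t ∧ t ≤ ρ ∧ (f (levelPath f c t)).re = c ∧
      (f (levelPath f c t)).im = v := by
    by_cases hl : (f (levelPath f c ρ)).re = c
    · exact ⟨ρ, hρ.1, le_rfl, hl, hρv⟩
    · obtain ⟨t, i1, i2, i3, i4⟩ := hf.exists_level_left hρ.1 (by rw [hpz]) hl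
      exact ⟨t, i1, i2.le, i3, i4.trans hρv⟩
  obtain ⟨t, i1, i2, i3, i4⟩ := key
  refine ⟨_, hf.levelPath_mem c t, lt_of_le_of_ne i1 fun e => ?_,
    lt_of_le_of_ne (i2.trans hρ.2) fun e => ?_, i3, i4⟩
  · change z.re = t at e
    rw [← e, hpz] at i4; exact h1.ne i4
  · change t = w.re at e
    rw [e, hpw] at i4; exact h2.ne' i4

/-- No differentiability of the path is needed: it is continuous, and it avoids z away from the
abscissa of z, so it can be inserted into the limit defining f'(z). -/
lemma StrictStripMap.tendsto_slope_levelPath (hf : StrictStripMap f P) {z : ℂ}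
    (hz : z ∈ regularStrip P) :
    Tendsto (fun x : ℝ => ((f (levelPath f (f z).re x) - f z) /
      (levelPath f (f z).re x - z)).re) (𝓝[≠] z.re) (𝓝 (deriv f z).re) := by
  have h1 := hasDerivAt_iff_tendsto_slope.1 (hf.analyticAt_of_mem hz).differentiableAt.hasDerivAt
  have hpz : levelPath f (f z).re z.re = z := hf.levelPath_re hz.1 hz.2.1 hz.2.2 rfl
  have h2 : Tendsto (levelPath f (f z).re) (𝓝[≠] z.re) (𝓝[≠] z) := by
    refine tendsto_nhdsWithin_iff.2 ⟨?_, ?_⟩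
    · have := (hf.continuous_levelPath (f z).re).tendsto z.re
      rw [hpz] at this
      exact this.mono_left nhdsWithin_le_nhds
    · filter_upwards [self_mem_nhdsWithin] with x hx e
      exact hx (congrArg Complex.re e)
  refine (Complex.continuous_re.tendsto _).comp (h1.comp h2) |>.congr fun x => ?_
  simp [slope_def_field]

/-- At a level point w of the path, the real part of the difference quotient is (Im f(w) - Im f(z))
Im w / |w - z|², which is ≥ 0 to the right of z and ≤ 0 to the left. Its limit f'(z) is real and
nonzero. If it is negative, the path leaves the level set immediately to the right of z; Im f then
stays constant until the path returns to the level set, at the latest at b, and the point of return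
is the partner. If it is positive, the same happens on the left, towards a. -/
lemma StrictStripMap.exists_same_value_bottom (hf : StrictStripMap f P) {a z b : ℂ}
    (ha : a ∈ regularStrip P) (hz : z ∈ regularStrip P) (hb : b ∈ regularStrip P)
    (haz : (f a).re = (f z).re) (hbz : (f b).re = (f z).re) (h1 : a.re < z.re) (h2 : z.re < b.re)
    (h0 : z.im = 0) (hd : deriv f z ≠ 0) :
    ∃ ζ ∈ regularStrip P, f ζ = f z ∧ ζ.re ≠ z.re := by
  set c := (f z).re with hc
  have hpz : levelPath f c z.re = z := hf.levelPath_re hz.1 hz.2.1 hz.2.2 rfl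
  have hpa : levelPath f c a.re = a := hf.levelPath_re ha.1 ha.2.1 ha.2.2 haz
  have hpb : levelPath f c b.re = b := hf.levelPath_re hb.1 hb.2.1 hb.2.2 hbz
  have hlim := hf.tendsto_slope_levelPath hz
  rw [← hc] at hlim
  have hre : (deriv f z).re ≠ 0 := fun h =>
    hd (Complex.ext h (hf.im_deriv_eq_zero z hz.2.2 (.inl h0)))
  have hslope : ∀ x, (f (levelPath f c x)).re = c →
      ((f (levelPath f c x) - f z) / (levelPath f c x - z)).re =
        ((f (levelPath f c x)).im - (f z).im) * levelAngle f c x /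
          normSq (levelPath f c x - z) := by
    intro x hx
    rw [Complex.div_re]
    simp only [sub_re, sub_im, hx, ← hc, sub_self, zero_mul, zero_div, zero_add, h0, sub_zero]
    rfl
  rcases lt_or_gt_of_ne hre with hneg | hpos
  · have hev : ∀ᶠ x in 𝓝[>] z.re, (f (levelPath f c x)).re ≠ c := by
      filter_upwards [(hlim.mono_left (nhdsGT_le_nhdsNE _)).eventually_lt_const hneg,
        self_mem_nhdsWithin] with x hx hxz hl
      rw [hslope x hl] at hx
      refine hx.not_ge (div_nonneg (mul_nonneg (sub_nonneg.2 ?_) (levelAngle_nonneg _ _ _))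
        (normSq_nonneg _))
      exact hf.im_le_of_re_eq hz (hf.levelPath_mem c x) hl.symm hxz
    obtain ⟨u, hu, hu'⟩ := mem_nhdsGT_iff_exists_Ioo_subset.1 hev
    obtain ⟨y, hy1, hy2⟩ := _root_.exists_between (lt_min hu h2)
    obtain ⟨t, i1, i2, i3, i4⟩ := hf.exists_level_right (hy2.trans_le (min_le_right _ _)).le
      (hu' ⟨hy1, hy2.trans_le (min_le_left _ _)⟩) (by rw [hpb, hbz])
    refine ⟨_, hf.levelPath_mem c t, Complex.ext i3 ?_, (hy1.trans i1).ne'⟩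
    rw [i4, ← hf.im_levelPath_eq hy1 fun x hx =>
      hu' ⟨hx.1, hx.2.trans (hy2.trans_le (min_le_left _ _))⟩, hpz]
  · have hev : ∀ᶠ x in 𝓝[<] z.re, (f (levelPath f c x)).re ≠ c := by
      filter_upwards [(hlim.mono_left (nhdsLT_le_nhdsNE _)).eventually_const_lt hpos,
        self_mem_nhdsWithin] with x hx hxz hl
      rw [hslope x hl] at hx
      refine hx.not_ge (div_nonpos_of_nonpos_of_nonneg
        (mul_nonpos_of_nonpos_of_nonneg (sub_nonpos.2 ?_) (levelAngle_nonneg _ _ _))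
        (normSq_nonneg _))
      exact hf.im_le_of_re_eq (hf.levelPath_mem c x) hz hl hxz
    obtain ⟨u, hu, hu'⟩ := mem_nhdsLT_iff_exists_Ioo_subset.1 hev
    obtain ⟨y, hy1, hy2⟩ := _root_.exists_between (max_lt hu h1)
    obtain ⟨t, i1, i2, i3, i4⟩ := hf.exists_level_left ((le_max_right _ _).trans_lt hy1).le
      (by rw [hpa, haz]) (hu' ⟨(le_max_left _ _).trans_lt hy1, hy2⟩)
    refine ⟨_, hf.levelPath_mem c t, Complex.ext i3 ?_, (i2.trans hy2).ne⟩
    rw [i4, hf.im_levelPath_eq hy2 fun x hx =>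
      hu' ⟨((le_max_left _ _).trans_lt hy1).trans hx.1, hx.2⟩, hpz]

/-- A non-critical boundary point of a level set, which is not an end point of the level set,
has a partner where `f` takes the same value. -/
lemma StrictStripMap.exists_same_value (hf : StrictStripMap f P) {a z b : ℂ}
    (ha : a ∈ regularStrip P) (hz : z ∈ regularStrip P) (hb : b ∈ regularStrip P)
    (haz : (f a).re = (f z).re) (hbz : (f b).re = (f z).re) (h1 : a.re < z.re) (h2 : z.re < b.re)
    (h0 : z.im = 0 ∨ z.im = Real.pi) (hd : deriv f z ≠ 0) :
    ∃ ζ ∈ regularStrip P, f ζ = f z ∧ ζ.re ≠ z.re := by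
  rcases h0 with h0 | h0
  · exact hf.exists_same_value_bottom ha hz hb haz hbz h1 h2 h0 hd
  · obtain ⟨ζ, hζ, h3, h4⟩ := hf.flip.exists_same_value_bottom (conj_add_pi_mem_regularStrip ha)
      (conj_add_pi_mem_regularStrip hz) (conj_add_pi_mem_regularStrip hb)
      (by simp [flipMap_conj_add_pi, haz]) (by simp [flipMap_conj_add_pi, hbz])
      (by simpa using h1) (by simpa using h2) (by simp [h0])
      (by rw [deriv_flipMap, flipMap_conj_add_pi]; simpa using hd)
    refine ⟨conj ζ + Real.pi * I, ⟨by simpa using hζ.2.1, by simpa using hζ.1, hζ.2.2⟩, ?_,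
      by simpa using h4⟩
    rw [flipMap_conj_add_pi] at h3
    have := congrArg (fun u => conj (-u)) h3
    simpa [flipMap] using this

end

/-! ### Series of holomorphic functions -/

section LocalSeries

variable {ι : Type*} {F : ι → ℂ → ℂ} {ζ : ℂ}

/-- Locally bounded families whose tails are uniformly summable can be summed locally uniformly. -/
lemma exists_ball_summable_bound {u : ι → ℝ} (hu : Summable u) {r : ℝ} (hr : 0 < r)
    (hF : ∀ i, AnalyticAt ℂ (F i) ζ)
    (hev : ∀ᶠ i in cofinite, ∀ w ∈ Metric.ball ζ r, DifferentiableAt ℂ (F i) w ∧ ‖F i w‖ ≤ u i) :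
    ∃ ε > 0, ∃ v : ι → ℝ, Summable v ∧ ∀ i, ∀ w ∈ Metric.ball ζ ε,
      DifferentiableAt ℂ (F i) w ∧ ‖F i w‖ ≤ v i := by
  classical
  set s := {i | ¬ ∀ w ∈ Metric.ball ζ r, DifferentiableAt ℂ (F i) w ∧ ‖F i w‖ ≤ u i}
  have hs : s.Finite := hev
  have h1 : ∀ i, ∀ᶠ w in 𝓝 ζ, DifferentiableAt ℂ (F i) w ∧ ‖F i w‖ ≤ ‖F i ζ‖ + 1 := by
    intro i
    have h2 : ∀ᶠ w in 𝓝 ζ, ‖F i w‖ < ‖F i ζ‖ + 1 :=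
      (hF i).continuousAt.norm.eventually_lt_const (by linarith)
    filter_upwards [(hF i).eventually_analyticAt, h2] with w h3 h4
      using ⟨h3.differentiableAt, h4.le⟩
  have h2 : ∀ᶠ w in 𝓝 ζ, ∀ i ∈ s, DifferentiableAt ℂ (F i) w ∧ ‖F i w‖ ≤ ‖F i ζ‖ + 1 :=
    (eventually_all_finite hs).2 fun i _ => h1 i
  obtain ⟨δ, hδ, hball⟩ := Metric.eventually_nhds_iff_ball.1 h2
  refine ⟨min δ r, lt_min hδ hr, fun i => if i ∈ s then ‖F i ζ‖ + 1 else u i, ?_, ?_⟩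
  · refine hu.congr_cofinite ?_
    filter_upwards [hev] with i hi
    rw [if_neg (fun h : i ∈ s => h hi)]
  · intro i w hw
    by_cases hi : i ∈ s
    · simp only [if_pos hi]
      exact hball w (Metric.ball_subset_ball (min_le_left _ _) hw) i hi
    · simp only [if_neg hi]
      exact (not_not.1 hi) w (Metric.ball_subset_ball (min_le_right _ _) hw)

/-- The first derivatives can be summed on the whole ball. Cauchy's estimate with radius ε/2 bounds
them by v i/(ε/2) on the half ball, so the sum can be differentiated once more. -/
lemma tsum_local {ε : ℝ} (hε : 0 < ε) {v : ι → ℝ} (hv : Summable v)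
    (h : ∀ i, ∀ w ∈ Metric.ball ζ ε, DifferentiableAt ℂ (F i) w ∧ ‖F i w‖ ≤ v i) :
    AnalyticAt ℂ (fun w => ∑' i, F i w) ζ ∧
      (∀ w ∈ Metric.ball ζ ε, HasSum (fun i => F i w) (∑' i, F i w)) ∧
      (∀ w ∈ Metric.ball ζ ε, HasSum (fun i => deriv (F i) w) (deriv (fun w => ∑' i, F i w) w)) ∧
      HasSum (fun i => deriv (deriv (F i)) ζ) (deriv (deriv (fun w => ∑' i, F i w)) ζ) := by
  have hd : ∀ i, DifferentiableOn ℂ (F i) (Metric.ball ζ ε) := fun i w hw =>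
    (h i w hw).1.differentiableWithinAt
  have hb : ∀ i, ∀ w ∈ Metric.ball ζ ε, ‖F i w‖ ≤ v i := fun i w hw => (h i w hw).2
  have hζ : ζ ∈ Metric.ball ζ ε := Metric.mem_ball_self hε
  have hderiv : ∀ w ∈ Metric.ball ζ ε,
      HasSum (fun i => deriv (F i) w) (deriv (fun w => ∑' i, F i w) w) := fun w hw =>
    hasSum_deriv_of_summable_norm hv hd Metric.isOpen_ball hb hw
  refine ⟨(differentiableOn_tsum_of_summable_norm hv hd Metric.isOpen_ball hb).analyticAt
    (Metric.isOpen_ball.mem_nhds hζ), fun w hw => ?_, hderiv, ?_⟩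
  · exact (hv.of_norm_bounded fun i => hb i w hw).hasSum
  · have hsub : Metric.ball ζ (ε / 2) ⊆ Metric.ball ζ ε :=
      Metric.ball_subset_ball (by linarith)
    have hζ' : ζ ∈ Metric.ball ζ (ε / 2) := Metric.mem_ball_self (by linarith)
    have key := hasSum_deriv_of_summable_norm (F := fun i => deriv (F i)) (z := ζ)
      (hv.div_const (ε / 2))
      (fun i => ((hd i).deriv Metric.isOpen_ball).mono hsub) Metric.isOpen_ball ?_ hζ'
    · have heq : deriv (fun w => ∑' i, F i w) =ᶠ[𝓝 ζ] fun w => ∑' i, deriv (F i) w := by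
        filter_upwards [Metric.isOpen_ball.mem_nhds hζ] with w hw
        exact (hderiv w hw).tsum_eq.symm
      rwa [heq.deriv_eq]
    · intro i w hw
      have hsub' : Metric.closedBall w (ε / 2) ⊆ Metric.ball ζ ε := by
        intro x hx
        rw [Metric.mem_ball] at hw ⊢
        rw [Metric.mem_closedBall] at hx
        linarith [dist_triangle x w ζ]
      refine norm_deriv_le_of_forall_mem_sphere_norm_le (by linarith) ?_
        fun x hx => hb i x (hsub' (Metric.sphere_subset_closedBall hx))
      exact ((hd i).mono hsub').diffContOnCl_ball subset_rfl

end LocalSeries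

/-! ### The logarithm of a single factor -/

/-- The logarithm with a cut along the negative imaginary axis, and with values in
`0 ≤ Im ≤ π` on the closed upper half plane. -/
noncomputable def logUp (x : ℂ) : ℂ := log (-I * x) + Real.pi / 2 * I

lemma exp_logUp {x : ℂ} (hx : x ≠ 0) : exp (logUp x) = x := by
  rw [logUp, exp_add, exp_log (by simpa using hx), exp_pi_div_two_mul_I]
  linear_combination -x * I_mul_I

lemma mem_slitPlane_of_re_pos {x : ℂ} (hx : 0 < x.re) : -I * x ∈ slitPlane := by
  rw [mem_slitPlane_iff]; right; simpa using hx.ne'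

/-- For ζ in the closed strip the factor 1 + e^ζ/a lies in the closed upper half plane, and on the
upper line it can be negative. The downward cut therefore keeps the logarithm analytic up to the
boundary, except where the factor vanishes. -/
lemma mem_slitPlane_of_im_nonneg {x : ℂ} (hx : x ≠ 0) (h : 0 ≤ x.im) : -I * x ∈ slitPlane := by
  rw [mem_slitPlane_iff]
  by_cases hr : x.re = 0
  · left
    have : x.im ≠ 0 := fun hi => hx (Complex.ext hr hi)
    simpa using lt_of_le_of_ne h this.symm
  · right; simpa using hr

lemma ne_zero_of_mem_slitPlane {x : ℂ} (h : -I * x ∈ slitPlane) : x ≠ 0 := by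
  rintro rfl; simp at h

lemma logUp_eq_log {x : ℂ} (hx : 0 < x.re) : logUp x = log x := by
  have hx0 : x ≠ 0 := by rintro rfl; simp at hx
  have harg := abs_lt.1 (abs_arg_lt_pi_div_two_iff.2 (.inl hx))
  rw [logUp, (log_mul_eq_add_log_iff (neg_ne_zero.2 I_ne_zero) hx0).2, log_neg_I]
  · ring
  · rw [arg_neg_I]; constructor <;> linarith [harg.1, harg.2, Real.pi_pos]

/-- The logarithm of the factor `1 + exp ζ / a`. -/
noncomputable def factorLog (a : ℝ) (ζ : ℂ) : ℂ := logUp (1 + exp ζ / a)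

lemma hasDerivAt_factorLog {a : ℝ} (ha : 0 < a) {ζ : ℂ}
    (h : -I * (1 + exp ζ / a) ∈ slitPlane) :
    HasDerivAt (factorLog a) (exp ζ / (a + exp ζ)) ζ := by
  have ha' : (a : ℂ) ≠ 0 := by exact_mod_cast ha.ne'
  have hne := ne_zero_of_mem_slitPlane h
  have hne' : (a : ℂ) + exp ζ ≠ 0 := by
    intro h0; apply hne; field_simp; simpa using h0
  have h1 : HasDerivAt (fun ζ : ℂ => -I * (1 + exp ζ / a)) (-I * (exp ζ / a)) ζ :=
    (((hasDerivAt_exp ζ).div_const _).const_add 1).const_mul _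
  refine ((h1.clog h).add_const (Real.pi / 2 * I : ℂ)).congr_deriv ?_
  have : (1 : ℂ) + exp ζ / a ≠ 0 := hne
  rw [mul_div_mul_left _ _ (neg_ne_zero.2 I_ne_zero)]
  field_simp

lemma eventually_slitPlane {a : ℝ} {ζ : ℂ} (h : -I * (1 + exp ζ / a) ∈ slitPlane) :
    ∀ᶠ w in 𝓝 ζ, -I * (1 + exp w / a) ∈ slitPlane := by
  have : ContinuousAt (fun w : ℂ => -I * (1 + exp w / a)) ζ := by fun_prop
  exact this.eventually_mem (isOpen_slitPlane.mem_nhds h)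

lemma analyticAt_factorLog {a : ℝ} (ha : 0 < a) {ζ : ℂ}
    (h : -I * (1 + exp ζ / a) ∈ slitPlane) : AnalyticAt ℂ (factorLog a) ζ := by
  rw [analyticAt_iff_eventually_differentiableAt]
  filter_upwards [eventually_slitPlane h] with w hw
    using (hasDerivAt_factorLog ha hw).differentiableAt

lemma deriv_deriv_factorLog {a : ℝ} (ha : 0 < a) {ζ : ℂ}
    (h : -I * (1 + exp ζ / a) ∈ slitPlane) :
    deriv (deriv (factorLog a)) ζ = a * exp ζ / (a + exp ζ) ^ 2 := by
  have ha' : (a : ℂ) ≠ 0 := by exact_mod_cast ha.ne'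
  have hne' : (a : ℂ) + exp ζ ≠ 0 := by
    intro h0; apply ne_zero_of_mem_slitPlane h; field_simp; simpa using h0
  have heq : deriv (factorLog a) =ᶠ[𝓝 ζ] fun w => exp w / (a + exp w) := by
    filter_upwards [eventually_slitPlane h] with w hw using (hasDerivAt_factorLog ha hw).deriv
  rw [heq.deriv_eq]
  have := (hasDerivAt_exp ζ).fun_div ((hasDerivAt_exp ζ).const_add (a : ℂ)) hne'
  rw [this.deriv]
  ring

lemma norm_factorLog_le {a : ℝ} {ζ : ℂ} (h : ‖exp ζ / a‖ ≤ 1 / 2) :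
    -I * (1 + exp ζ / a) ∈ slitPlane ∧ ‖factorLog a ζ‖ ≤ 3 / 2 * ‖exp ζ / a‖ := by
  have hre : 0 < (1 + exp ζ / a).re := by
    have := (abs_le.1 ((abs_re_le_norm (exp ζ / a)).trans h)).1
    rw [add_re, one_re]; linarith
  refine ⟨mem_slitPlane_of_re_pos hre, ?_⟩
  rw [factorLog, logUp_eq_log hre]
  exact norm_log_one_add_half_le_self h

lemma re_factorLog {a : ℝ} (ζ : ℂ) : (factorLog a ζ).re = Real.log ‖1 + exp ζ / a‖ := by
  simp [factorLog, logUp, log_re]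

/-! ### The logarithm of a canonical product -/

section ProductLog

variable {ι : Type*} {a : ι → ℝ}

/-- The logarithm of `∏ (1 + exp ζ / a i)`. -/
noncomputable def prodLog (a : ι → ℝ) (ζ : ℂ) : ℂ := ∑' i, factorLog (a i) ζ

/-- On the unit ball |e^w| ≤ e^{Re ζ + 1}. For all but finitely many i this makes |e^w/a_i| ≤ 1/2,
where |log(1 + x)| ≤ (3/2)|x|. -/
lemma eventually_cofinite_factor (ha : ∀ i, 0 < a i) (hs : Summable fun i => (a i)⁻¹) (ζ : ℂ) :
    ∀ᶠ i in cofinite, ∀ w ∈ Metric.ball ζ 1, -I * (1 + exp w / a i) ∈ slitPlane ∧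
      ‖factorLog (a i) w‖ ≤ 3 / 2 * (Real.exp (ζ.re + 1) * (a i)⁻¹) := by
  have h0 : Tendsto (fun i => Real.exp (ζ.re + 1) * (a i)⁻¹) cofinite (𝓝 0) := by
    simpa using hs.tendsto_cofinite_zero.const_mul (Real.exp (ζ.re + 1))
  filter_upwards [h0.eventually_le_const one_half_pos] with i hi w hw
  have hw' : w.re ≤ ζ.re + 1 := by
    have := (abs_re_le_norm (w - ζ)).trans (mem_ball_iff_norm.1 hw).le
    rw [sub_re] at this
    linarith [(abs_le.1 this).2]
  have hn : ‖exp w / a i‖ ≤ Real.exp (ζ.re + 1) * (a i)⁻¹ := by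
    rw [norm_div, norm_exp, norm_real, Real.norm_of_nonneg (ha i).le, div_eq_mul_inv]
    have := (ha i).le
    gcongr
  obtain ⟨h1, h2⟩ := norm_factorLog_le (hn.trans hi)
  exact ⟨h1, h2.trans (by gcongr)⟩

lemma prodLog_local (ha : ∀ i, 0 < a i) (hs : Summable fun i => (a i)⁻¹) {ζ : ℂ}
    (hζ : ∀ i, -I * (1 + exp ζ / a i) ∈ slitPlane) :
    AnalyticAt ℂ (prodLog a) ζ ∧
      (∀ᶠ w in 𝓝 ζ, HasSum (fun i => factorLog (a i) w) (prodLog a w)) ∧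
      HasSum (fun i => exp ζ / (a i + exp ζ)) (deriv (prodLog a) ζ) ∧
      HasSum (fun i => a i * exp ζ / (a i + exp ζ) ^ 2) (deriv (deriv (prodLog a)) ζ) := by
  obtain ⟨ε, hε, v, hv, h⟩ := exists_ball_summable_bound (F := fun i => factorLog (a i)) (ζ := ζ)
    ((hs.mul_left (Real.exp (ζ.re + 1))).mul_left (3 / 2)) one_pos
    (fun i => analyticAt_factorLog (ha i) (hζ i))
    ((eventually_cofinite_factor ha hs ζ).mono fun i hi w hw =>
      ⟨(hasDerivAt_factorLog (ha i) (hi w hw).1).differentiableAt, (hi w hw).2⟩)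
  obtain ⟨h1, h2, h3, h4⟩ := tsum_local hε hv h
  refine ⟨h1, ?_, ?_, ?_⟩
  · filter_upwards [Metric.ball_mem_nhds ζ hε] with w hw using h2 w hw
  · have := h3 ζ (Metric.mem_ball_self hε)
    simp only [fun i => (hasDerivAt_factorLog (ha i) (hζ i)).deriv] at this
    exact this
  · simp only [fun i => deriv_deriv_factorLog (ha i) (hζ i)] at h4
    exact h4

lemma eventually_forall_slitPlane (ha : ∀ i, 0 < a i) (hs : Summable fun i => (a i)⁻¹) {ζ : ℂ}
    (hζ : ∀ i, -I * (1 + exp ζ / a i) ∈ slitPlane) :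
    ∀ᶠ w in 𝓝 ζ, ∀ i, -I * (1 + exp w / a i) ∈ slitPlane := by
  set s := {i | ¬ ∀ w ∈ Metric.ball ζ 1, -I * (1 + exp w / a i) ∈ slitPlane}
  have hfin : s.Finite :=
    (eventually_cofinite_factor ha hs ζ).mono fun i hi w hw => (hi w hw).1
  filter_upwards [Metric.ball_mem_nhds ζ one_pos,
    (eventually_all_finite hfin).2 fun i _ => eventually_slitPlane (hζ i)] with w h1 h2 i
  by_cases hi : i ∈ s
  · exact h2 i hi
  · exact (not_not.1 hi) w h1

lemma hasProd_exp_prodLog {ζ : ℂ} (hζ : ∀ i, -I * (1 + exp ζ / a i) ∈ slitPlane)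
    (h : HasSum (fun i => factorLog (a i) ζ) (prodLog a ζ)) :
    HasProd (fun i => 1 + exp ζ / (a i : ℂ)) (exp (prodLog a ζ)) :=
  h.cexp.congr_fun fun i => (exp_logUp (ne_zero_of_mem_slitPlane (hζ i))).symm

lemma eventually_exp_prodLog (ha : ∀ i, 0 < a i) (hs : Summable fun i => (a i)⁻¹) {ζ : ℂ}
    (hζ : ∀ i, -I * (1 + exp ζ / a i) ∈ slitPlane) :
    ∀ᶠ w in 𝓝 ζ, exp (prodLog a w) = ∏' i, (1 + exp w / (a i : ℂ)) := by
  filter_upwards [eventually_forall_slitPlane ha hs hζ, (prodLog_local ha hs hζ).2.1] with w h1 h2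
  exact (hasProd_exp_prodLog h1 h2).tprod_eq.symm

/-- The zeros of `∏ (1 + exp ζ / a i)` in the closed strip. -/
def zeroSet (a : ι → ℝ) : Set ℂ := {ζ | ζ.im = Real.pi ∧ ∃ i, Real.exp ζ.re = a i}

lemma slitPlane_of_notMem_zeroSet (ha : ∀ i, 0 < a i) {ζ : ℂ} (h0 : 0 ≤ ζ.im)
    (h1 : ζ.im ≤ Real.pi) (h : ζ ∉ zeroSet a) (i : ι) :
    -I * (1 + exp ζ / a i) ∈ slitPlane := by
  have hs := Real.sin_nonneg_of_nonneg_of_le_pi h0 h1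
  have ha' : (a i : ℂ) ≠ 0 := by exact_mod_cast (ha i).ne'
  apply mem_slitPlane_of_im_nonneg
  · intro h2
    have h3 : exp ζ = -(a i) := by field_simp at h2; linear_combination h2
    have hn : Real.exp ζ.re = a i := by
      have := congrArg norm h3
      rwa [norm_exp, norm_neg, norm_real, Real.norm_of_nonneg (ha i).le] at this
    refine h ⟨?_, i, hn⟩
    have hre := congrArg Complex.re h3
    rw [exp_re, hn] at hre
    simp only [neg_re, ofReal_re] at hre
    have hcos : Real.cos ζ.im = Real.cos Real.pi := by
      rw [Real.cos_pi]
      have := (ha i).ne'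
      field_simp at hre
      linarith
    exact Real.injOn_cos ⟨h0, h1⟩ ⟨Real.pi_pos.le, le_rfl⟩ hcos
  · rw [add_im, one_im, zero_add, div_ofReal_im, exp_im]
    have := (ha i).le
    positivity

lemma im_exp_div (a : ℝ) (w : ℂ) :
    (w / (a + w)).im = a * w.im / normSq (a + w) := by
  rw [div_im]; simp; ring

lemma im_eq_zero_of_hasProd {g : ι → ℂ} {s : ℂ} (h : HasProd g s) (hg : ∀ i, (g i).im = 0) :
    s.im = 0 := by
  refine tendsto_nhds_unique ((Complex.continuous_im.tendsto s).comp h) ?_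
  refine tendsto_const_nhds.congr fun t => ?_
  refine (Finset.prod_induction g (fun z => z.im = 0) (fun x y hx hy => ?_) rfl
    fun i _ => hg i).symm
  simp [hx, hy]

lemma exists_int_of_im_exp {w : ℂ} (h : (exp w).im = 0) : ∃ n : ℤ, w.im = n * Real.pi := by
  rw [exp_im] at h
  obtain ⟨n, hn⟩ := Real.sin_eq_zero_iff.1 ((mul_eq_zero.1 h).resolve_left (Real.exp_pos _).ne')
  exact ⟨n, hn.symm⟩

lemma im_exp_eq_zero {ζ : ℂ} (h : ζ.im = 0 ∨ ζ.im = Real.pi) : (exp ζ).im = 0 := by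
  rw [exp_im]; rcases h with h | h <;> simp [h]

lemma strip_of_boundary {ζ : ℂ} (h : ζ.im = 0 ∨ ζ.im = Real.pi) :
    0 ≤ ζ.im ∧ ζ.im ≤ Real.pi := by
  have := Real.pi_pos
  rcases h with h | h <;> constructor <;> linarith

lemma re_second_deriv (a x : ℝ) :
    ((a : ℂ) * x / (a + x) ^ 2).re = a * x / (a + x) ^ 2 := by
  norm_cast

lemma exp_of_im_eq_zero {ζ : ℂ} (h : ζ.im = 0) : exp ζ = (Real.exp ζ.re : ℂ) :=
  Complex.ext (by simp [exp_re, h]) (by simp [exp_im, h])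

lemma exp_of_im_eq_pi {ζ : ℂ} (h : ζ.im = Real.pi) : exp ζ = ((-Real.exp ζ.re : ℝ) : ℂ) :=
  Complex.ext (by simp [exp_re, h]) (by simp [exp_im, h])

lemma normSq_one_add_mk (a ρ t : ℝ) :
    ‖1 + exp ⟨ρ, t⟩ / a‖ ^ 2 =
      1 + 2 * (Real.exp ρ / a) * Real.cos t + (Real.exp ρ / a) ^ 2 := by
  rw [← normSq_eq_norm_sq, normSq_apply]
  have h1 : (1 + exp ⟨ρ, t⟩ / a).re = 1 + Real.exp ρ / a * Real.cos t := by
    rw [add_re, div_ofReal_re, exp_re]; simp; ring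
  have h2 : (1 + exp ⟨ρ, t⟩ / a).im = Real.exp ρ / a * Real.sin t := by
    rw [add_im, div_ofReal_im, exp_im]; simp; ring
  rw [h1, h2]
  linear_combination (Real.exp ρ / a) ^ 2 * Real.sin_sq_add_cos_sq t

lemma re_factorLog_antitone {a ρ : ℝ} (ha : 0 < a) {s t : ℝ} (hs : 0 ≤ s) (hst : s ≤ t)
    (ht : t < Real.pi) : (factorLog a ⟨ρ, t⟩).re ≤ (factorLog a ⟨ρ, s⟩).re := by
  rw [re_factorLog, re_factorLog]
  have hpos : 0 < ‖1 + exp ⟨ρ, t⟩ / a‖ := by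
    rw [norm_pos_iff]
    refine ne_zero_of_mem_slitPlane (slitPlane_of_notMem_zeroSet (ι := Unit) (a := fun _ => a)
      (fun _ => ha) (ζ := ⟨ρ, t⟩) (hs.trans hst) ht.le (fun h => ht.ne h.1) ())
  apply Real.log_le_log hpos
  rw [← pow_le_pow_iff_left₀ hpos.le (norm_nonneg _) two_ne_zero, normSq_one_add_mk,
    normSq_one_add_mk]
  have := Real.cos_le_cos_of_nonneg_of_le_pi hs ht.le hst
  have : 0 < Real.exp ρ / a := by positivity
  gcongr

lemma tendsto_re_factorLog {a ρ : ℝ} (ha : 0 < a) (h : Real.exp ρ = a) :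
    Tendsto (fun t : ℝ => (factorLog a ⟨ρ, t⟩).re) (𝓝[<] Real.pi) atBot := by
  simp_rw [re_factorLog]
  have hc : Continuous fun t : ℝ => ‖1 + exp ⟨ρ, t⟩ / a‖ := by
    have := continuous_mk_right ρ
    fun_prop
  have h0 : ‖1 + exp ⟨ρ, Real.pi⟩ / a‖ = 0 := by
    rw [exp_of_im_eq_pi (ζ := ⟨ρ, Real.pi⟩) rfl, h]
    have : (a : ℂ) ≠ 0 := by exact_mod_cast ha.ne'
    simp [this]
  have hnear : ∀ᶠ t in 𝓝[<] Real.pi, ‖1 + exp ⟨ρ, t⟩ / a‖ ∈ ({0}ᶜ : Set ℝ) := by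
    filter_upwards [Ioo_mem_nhdsLT Real.pi_pos] with t ht
    have := slitPlane_of_notMem_zeroSet (ι := Unit) (a := fun _ => a)
      (fun _ => ha) (ζ := ⟨ρ, t⟩) ht.1.le ht.2.le (fun h => ht.2.ne h.1) ()
    simpa using ne_zero_of_mem_slitPlane this
  have hlim := (hc.tendsto Real.pi).mono_left (nhdsWithin_le_nhds (s := Iio Real.pi))
  rw [h0] at hlim
  exact Real.tendsto_log_nhdsNE_zero.comp (tendsto_nhdsWithin_iff.2 ⟨hlim, hnear⟩)

/-- Between height π/2 and a height t above it no term of the sum of log-moduli increases, while the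
term of the vanishing factor j tends to -∞ as t → π. -/
lemma prodLog_zero (ha : ∀ i, 0 < a i) (hs : Summable fun i => (a i)⁻¹) {ζ : ℂ}
    (hζ : ζ ∈ zeroSet a) (c : ℝ) :
    ∃ t : ℝ, 0 < t ∧ t < Real.pi ∧ (prodLog a ⟨ζ.re, t⟩).re < c := by
  classical
  have hπ := Real.pi_pos
  obtain ⟨hb, j, hj⟩ := hζ
  have hsum : ∀ t : ℝ, 0 < t → t < Real.pi →
      HasSum (fun i => (factorLog (a i) ⟨ζ.re, t⟩).re) (prodLog a ⟨ζ.re, t⟩).re := by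
    intro t h0 h1
    have := (prodLog_local ha hs (ζ := ⟨ζ.re, t⟩) (slitPlane_of_notMem_zeroSet ha
      h0.le h1.le (fun h => h1.ne h.1))).2.1.self_of_nhds
    exact Complex.hasSum_re this
  have hmid := hsum (Real.pi / 2) (by linarith) (by linarith)
  obtain ⟨t, ht, htc⟩ := ((tendsto_re_factorLog (ha j) hj).eventually_lt_atBot
    (c - (prodLog a ⟨ζ.re, Real.pi / 2⟩).re + (factorLog (a j) ⟨ζ.re, Real.pi / 2⟩).re)).and
      (Ioo_mem_nhdsLT (show Real.pi / 2 < Real.pi by linarith)) |>.exists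
  refine ⟨t, by linarith [htc.1], htc.2, ?_⟩
  -- Termwise comparison with the sum at height π/2, in which the j-th term is replaced by its value
  -- at height t.
  have hle := hasSum_le (fun i => ?_) (hsum t (by linarith [htc.1]) htc.2)
    (hmid.add (hasSum_ite_eq j ((factorLog (a j) ⟨ζ.re, t⟩).re -
      (factorLog (a j) ⟨ζ.re, Real.pi / 2⟩).re)))
  · linarith
  · by_cases hij : i = j
    · subst hij; simp
    · simpa [hij] using re_factorLog_antitone (ha i) (by linarith : 0 ≤ Real.pi / 2) htc.1.le htc.2

/-- The derivative is the sum of e^ζ/(a_i + e^ζ), with imaginary parts a_i Im e^ζ/|a_i + e^ζ|² ≥ 0.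
The second derivative is the sum of a_i e^ζ/(a_i + e^ζ)², which on the boundary has the sign of the
real number e^ζ. The product is real on the boundary, so its logarithm has imaginary part in πℤ. -/
lemma stripMap_prodLog (ha : ∀ i, 0 < a i) (hs : Summable fun i => (a i)⁻¹) :
    StripMap (prodLog a) (zeroSet a) where
  analyticAt ζ h0 h1 h2 := (prodLog_local ha hs (slitPlane_of_notMem_zeroSet ha h0 h1 h2)).1
  boundary ζ hζ := .inr hζ.1
  im_deriv_nonneg ζ h0 h1 := by
    have h := (prodLog_local ha hs (slitPlane_of_notMem_zeroSet ha h0.le h1.le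
      (fun h => h1.ne h.1))).2.2.1
    refine (Complex.hasSum_im h).nonneg fun i => ?_
    rw [im_exp_div, exp_im]
    have := Real.sin_nonneg_of_nonneg_of_le_pi h0.le h1.le
    have := (ha i).le
    have := normSq_nonneg (a i + exp ζ)
    positivity
  im_deriv_eq_zero ζ hζ hb := by
    have h := (prodLog_local ha hs (slitPlane_of_notMem_zeroSet ha (strip_of_boundary hb).1
      (strip_of_boundary hb).2 hζ)).2.2.1
    refine (Complex.hasSum_im h).unique ?_
    simp only [im_exp_div, im_exp_eq_zero hb, mul_zero, zero_div]
    exact hasSum_zero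
  bottom ζ hζ hb := by
    have h := (prodLog_local ha hs (slitPlane_of_notMem_zeroSet ha (strip_of_boundary (.inl hb)).1
      (strip_of_boundary (.inl hb)).2 hζ)).2.2.2
    refine (Complex.hasSum_re h).nonneg fun i => ?_
    rw [exp_of_im_eq_zero hb, re_second_deriv]
    have := (ha i).le
    positivity
  top ζ hζ hb := by
    have h := (prodLog_local ha hs (slitPlane_of_notMem_zeroSet ha (strip_of_boundary (.inr hb)).1
      (strip_of_boundary (.inr hb)).2 hζ)).2.2.2
    refine (Complex.hasSum_re h).nonpos fun i => ?_
    rw [exp_of_im_eq_pi hb, re_second_deriv, mul_neg, neg_div]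
    have := (ha i).le
    exact neg_nonpos.2 (by positivity)
  im_mem ζ hζ hb := by
    have hsl := slitPlane_of_notMem_zeroSet ha (strip_of_boundary hb).1 (strip_of_boundary hb).2 hζ
    refine exists_int_of_im_exp (im_eq_zero_of_hasProd
      (hasProd_exp_prodLog hsl (prodLog_local ha hs hsl).2.1.self_of_nhds) fun i => ?_)
    rw [add_im, one_im, div_ofReal_im, im_exp_eq_zero hb, zero_div, zero_add]
  pole ζ hζ hb := by
    have := Real.pi_pos
    linarith [hζ.1]
  zero ζ hζ _ := prodLog_zero ha hs hζ

lemma strictStripMap_prodLog [Nonempty ι] (ha : ∀ i, 0 < a i) (hs : Summable fun i => (a i)⁻¹) :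
    StrictStripMap (prodLog a) (zeroSet a) where
  toStripMap := stripMap_prodLog ha hs
  im_deriv_pos ζ h0 h1 := by
    have hsl := slitPlane_of_notMem_zeroSet ha h0.le h1.le (fun h => h1.ne h.1)
    have h := Complex.hasSum_im (prodLog_local ha hs hsl).2.2.1
    have hpos : ∀ i, 0 < (exp ζ / (a i + exp ζ)).im := fun i => by
      rw [im_exp_div, exp_im]
      have := Real.sin_pos_of_pos_of_lt_pi h0 h1
      have := ha i
      have : 0 < normSq (a i + exp ζ) := normSq_pos.2 fun h0 => by
        apply ne_zero_of_mem_slitPlane (hsl i)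
        have ha' : (a i : ℂ) ≠ 0 := by exact_mod_cast (ha i).ne'
        field_simp; simpa using h0
      positivity
    rw [← h.tsum_eq]
    exact h.summable.tsum_pos (fun i => (hpos i).le) (Classical.arbitrary ι) (hpos _)
  bottom_pos ζ hζ hb := by
    have h := Complex.hasSum_re (prodLog_local ha hs (slitPlane_of_notMem_zeroSet ha
      (strip_of_boundary (.inl hb)).1 (strip_of_boundary (.inl hb)).2 hζ)).2.2.2
    have hpos : ∀ i, 0 < (a i * exp ζ / (a i + exp ζ) ^ 2).re := fun i => by
      rw [exp_of_im_eq_zero hb, re_second_deriv]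
      have := ha i
      positivity
    rw [← h.tsum_eq]
    exact h.summable.tsum_pos (fun i => (hpos i).le) (Classical.arbitrary ι) (hpos _)
  top_neg ζ hζ hb := by
    have hsl := slitPlane_of_notMem_zeroSet ha
      (strip_of_boundary (.inr hb)).1 (strip_of_boundary (.inr hb)).2 hζ
    have h := (Complex.hasSum_re (prodLog_local ha hs hsl).2.2.2).neg
    have hpos : ∀ i, 0 < -(a i * exp ζ / (a i + exp ζ) ^ 2).re := fun i => by
      have hne : (a i : ℝ) + -Real.exp ζ.re ≠ 0 := fun h0 =>
        hζ ⟨hb, i, by linarith⟩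
      rw [exp_of_im_eq_pi hb, re_second_deriv, mul_neg, neg_div, neg_neg]
      have := ha i
      positivity
    rw [← neg_pos, ← h.tsum_eq]
    exact h.summable.tsum_pos (fun i => (hpos i).le) (Classical.arbitrary ι) (hpos _)

end ProductLog

/-! ### Assembling the logarithm of G^k -/

lemma StrictStripMap.add_left {f g : ℂ → ℂ} {P R : Set ℂ} (hf : StripMap f P)
    (hg : StrictStripMap g R) : StrictStripMap (f + g) (P ∪ R) := by
  rw [add_comm, union_comm]; exact hg.add hf

lemma re_natCast_mul (k : ℕ) (z : ℂ) : ((k : ℂ) * z).re = k * z.re := by simp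

lemma im_natCast_mul (k : ℕ) (z : ℂ) : ((k : ℂ) * z).im = k * z.im := by simp

lemma deriv_natCast_mul (k : ℕ) (f : ℂ → ℂ) :
    deriv (fun ζ => (k : ℂ) * f ζ) = fun ζ => (k : ℂ) * deriv f ζ :=
  funext fun _ => deriv_const_mul_field (k : ℂ)

lemma StripMap.natCast_mul {f : ℂ → ℂ} {P : Set ℂ} (h : StripMap f P) {k : ℕ} (hk : 0 < k) :
    StripMap (fun ζ => (k : ℂ) * f ζ) P where
  analyticAt ζ h0 h1 h2 := analyticAt_const.mul (h.analyticAt ζ h0 h1 h2)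
  boundary := h.boundary
  im_deriv_nonneg ζ h0 h1 := by
    rw [deriv_natCast_mul, im_natCast_mul]
    exact mul_nonneg k.cast_nonneg (h.im_deriv_nonneg ζ h0 h1)
  im_deriv_eq_zero ζ hζ hb := by
    rw [deriv_natCast_mul, im_natCast_mul, h.im_deriv_eq_zero ζ hζ hb, mul_zero]
  bottom ζ hζ hb := by
    rw [deriv_natCast_mul, deriv_natCast_mul, re_natCast_mul]
    exact mul_nonneg k.cast_nonneg (h.bottom ζ hζ hb)
  top ζ hζ hb := by
    rw [deriv_natCast_mul, deriv_natCast_mul, re_natCast_mul]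
    exact mul_nonpos_of_nonneg_of_nonpos k.cast_nonneg (h.top ζ hζ hb)
  im_mem ζ hζ hb := by
    obtain ⟨n, hn⟩ := h.im_mem ζ hζ hb
    exact ⟨k * n, by rw [im_natCast_mul, hn]; push_cast; ring⟩
  pole ζ hζ hb c := by
    obtain ⟨t, h0, h1, ht⟩ := h.pole ζ hζ hb (c / k)
    refine ⟨t, h0, h1, ?_⟩
    rwa [re_natCast_mul, ← div_lt_iff₀' (by exact_mod_cast hk)]
  zero ζ hζ hb c := by
    obtain ⟨t, h0, h1, ht⟩ := h.zero ζ hζ hb (c / k)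
    refine ⟨t, h0, h1, ?_⟩
    rwa [re_natCast_mul, ← lt_div_iff₀' (by exact_mod_cast hk)]

lemma StrictStripMap.natCast_mul {f : ℂ → ℂ} {P : Set ℂ} (h : StrictStripMap f P) {k : ℕ}
    (hk : 0 < k) : StrictStripMap (fun ζ => (k : ℂ) * f ζ) P where
  toStripMap := h.toStripMap.natCast_mul hk
  im_deriv_pos ζ h0 h1 := by
    rw [deriv_natCast_mul, im_natCast_mul]
    exact mul_pos (by exact_mod_cast hk) (h.im_deriv_pos ζ h0 h1)
  bottom_pos ζ hζ hb := by
    rw [deriv_natCast_mul, deriv_natCast_mul, re_natCast_mul]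
    exact mul_pos (by exact_mod_cast hk) (h.bottom_pos ζ hζ hb)
  top_neg ζ hζ hb := by
    rw [deriv_natCast_mul, deriv_natCast_mul, re_natCast_mul]
    exact mul_neg_of_pos_of_neg (by exact_mod_cast hk) (h.top_neg ζ hζ hb)

lemma stripMap_linear (p : ℤ) : StripMap (fun ζ : ℂ => (p : ℂ) * ζ) ∅ where
  analyticAt ζ _ _ _ := by fun_prop
  boundary ζ hζ := hζ.elim
  im_deriv_nonneg ζ _ _ := by simp
  im_deriv_eq_zero ζ _ _ := by simp
  bottom ζ _ _ := by simp
  top ζ _ _ := by simp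
  im_mem ζ _ hb := by
    rcases hb with hb | hb
    · exact ⟨0, by simp [hb]⟩
    · exact ⟨p, by simp [hb]⟩
  pole ζ hζ := hζ.elim
  zero ζ hζ := hζ.elim

lemma deriv_const_mul_exp (A : ℝ) :
    deriv (fun ζ : ℂ => (A : ℂ) * exp ζ) = fun ζ => (A : ℂ) * exp ζ :=
  funext fun ζ => ((hasDerivAt_exp ζ).const_mul (A : ℂ)).deriv

lemma stripMap_exp {A : ℝ} (hA : 0 ≤ A) : StripMap (fun ζ : ℂ => (A : ℂ) * exp ζ) ∅ where
  analyticAt ζ _ _ _ := by fun_prop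
  boundary ζ hζ := hζ.elim
  im_deriv_nonneg ζ h0 h1 := by
    rw [deriv_const_mul_exp, im_ofReal_mul, exp_im]
    have := Real.sin_nonneg_of_nonneg_of_le_pi h0.le h1.le
    positivity
  im_deriv_eq_zero ζ _ hb := by
    rw [deriv_const_mul_exp, im_ofReal_mul, im_exp_eq_zero hb, mul_zero]
  bottom ζ _ hb := by
    rw [deriv_const_mul_exp, deriv_const_mul_exp, re_ofReal_mul, exp_of_im_eq_zero hb, ofReal_re]
    positivity
  top ζ _ hb := by
    rw [deriv_const_mul_exp, deriv_const_mul_exp, re_ofReal_mul, exp_of_im_eq_pi hb, ofReal_re]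
    exact mul_nonpos_of_nonneg_of_nonpos hA (neg_nonpos.2 (Real.exp_pos _).le)
  im_mem ζ _ hb := ⟨0, by rw [im_ofReal_mul, im_exp_eq_zero hb]; simp⟩
  pole ζ hζ := hζ.elim
  zero ζ hζ := hζ.elim

lemma strictStripMap_exp {A : ℝ} (hA : 0 < A) :
    StrictStripMap (fun ζ : ℂ => (A : ℂ) * exp ζ) ∅ where
  toStripMap := stripMap_exp hA.le
  im_deriv_pos ζ h0 h1 := by
    rw [deriv_const_mul_exp, im_ofReal_mul, exp_im]
    have := Real.sin_pos_of_pos_of_lt_pi h0 h1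
    positivity
  bottom_pos ζ _ hb := by
    rw [deriv_const_mul_exp, deriv_const_mul_exp, re_ofReal_mul, exp_of_im_eq_zero hb, ofReal_re]
    positivity
  top_neg ζ _ hb := by
    rw [deriv_const_mul_exp, deriv_const_mul_exp, re_ofReal_mul, exp_of_im_eq_pi hb, ofReal_re]
    exact mul_neg_of_pos_of_neg hA (neg_neg_of_pos (Real.exp_pos _))

section LogG

variable {ι₁ ι₂ ι₃ ι₄ : Type*} {A A₀ : ℝ} {a : ι₁ → ℝ} {b : ι₂ → ℝ} {c : ι₃ → ℝ} {d : ι₄ → ℝ}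

/-- The logarithm of `G` without the power factor, in the variable `ζ = log (z ^ k)`. -/
noncomputable def logR (A A₀ : ℝ) (a : ι₁ → ℝ) (b : ι₂ → ℝ) (c : ι₃ → ℝ) (d : ι₄ → ℝ) : ℂ → ℂ :=
  (fun ζ : ℂ => (A : ℂ) * exp ζ) + (invMap (fun ζ : ℂ => (A₀ : ℂ) * exp ζ) +
    (prodLog a + (flipMap (prodLog b) + (invMap (prodLog c) + invMap (flipMap (prodLog d))))))

/-- The zeros and poles of `G` in the closed strip. -/
def singularSet (a : ι₁ → ℝ) (b : ι₂ → ℝ) (c : ι₃ → ℝ) (d : ι₄ → ℝ) : Set ℂ :=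
  ∅ ∪ ({ζ | -conj ζ ∈ (∅ : Set ℂ)} ∪ (zeroSet a ∪ ({ζ | conj ζ + Real.pi * I ∈ zeroSet b} ∪
    ({ζ | -conj ζ ∈ zeroSet c} ∪ {ζ | -conj ζ ∈ {ζ | conj ζ + Real.pi * I ∈ zeroSet d}}))))

/-- The logarithm of `G ^ k` in the variable `ζ = log (z ^ k)`. -/
noncomputable def logG (k : ℕ) (p : ℤ) (A A₀ : ℝ) (a : ι₁ → ℝ) (b : ι₂ → ℝ) (c : ι₃ → ℝ)
    (d : ι₄ → ℝ) : ℂ → ℂ :=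
  (fun ζ : ℂ => (p : ℂ) * ζ) + fun ζ => (k : ℂ) * logR A A₀ a b c d ζ

/-- One strict summand makes the whole sum strict. `hne` is the form in which G ≢ z^p enters. -/
lemma strictStripMap_logG {k : ℕ} (hk : 0 < k) (p : ℤ) (hA : 0 ≤ A) (hA₀ : 0 ≤ A₀)
    (ha : ∀ ν, 0 < a ν) (hb : ∀ μ, 0 < b μ) (hc : ∀ ν, 0 < c ν) (hd : ∀ μ, 0 < d μ)
    (hsa : Summable fun ν => (a ν)⁻¹) (hsb : Summable fun μ => (b μ)⁻¹)
    (hsc : Summable fun ν => (c ν)⁻¹) (hsd : Summable fun μ => (d μ)⁻¹)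
    (hne : 0 < A ∨ 0 < A₀ ∨ Nonempty ι₁ ∨ Nonempty ι₂ ∨ Nonempty ι₃ ∨ Nonempty ι₄) :
    StrictStripMap (logG k p A A₀ a b c d) (∅ ∪ singularSet a b c d) := by
  refine StrictStripMap.add_left (stripMap_linear p) (StrictStripMap.natCast_mul ?_ hk)
  have w1 := stripMap_exp hA
  have w2 := (stripMap_exp hA₀).inv
  have w3 := stripMap_prodLog ha hsa
  have w4 := (stripMap_prodLog hb hsb).flip
  have w5 := (stripMap_prodLog hc hsc).inv
  have w6 := (stripMap_prodLog hd hsd).flip.inv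
  rcases hne with h | h | h | h | h | h
  · exact (strictStripMap_exp h).add (w2.add (w3.add (w4.add (w5.add w6))))
  · exact .add_left w1 ((strictStripMap_exp h).inv.add (w3.add (w4.add (w5.add w6))))
  · exact .add_left w1 (.add_left w2 ((strictStripMap_prodLog ha hsa).add (w4.add (w5.add w6))))
  · exact .add_left w1 (.add_left w2 (.add_left w3
      ((strictStripMap_prodLog hb hsb).flip.add (w5.add w6))))
  · exact .add_left w1 (.add_left w2 (.add_left w3 (.add_left w4
      ((strictStripMap_prodLog hc hsc).inv.add w6))))
  · exact .add_left w1 (.add_left w2 (.add_left w3 (.add_left w4 (.add_left w5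
      (strictStripMap_prodLog hd hsd).flip.inv))))

end LogG

/-! ### Roots of unity and G in the strip coordinate -/

lemma e_eq (k : ℕ) (m : ℤ) : e k m = exp (m / k * Real.pi * I) := by
  rw [e]; push_cast; ring_nf

lemma e_add (k : ℕ) (m n : ℤ) : e k (m + n) = e k m * e k n := by
  rw [e_eq, e_eq, e_eq, ← exp_add]; push_cast; ring_nf

lemma e_zero (k : ℕ) : e k 0 = 1 := by simp [e_eq]

lemma e_ne_zero (k : ℕ) (m : ℤ) : e k m ≠ 0 := by rw [e_eq]; exact exp_ne_zero _

lemma norm_e (k : ℕ) (m : ℤ) : ‖e k m‖ = 1 := by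
  have : (m / k * Real.pi * I : ℂ) = ((m / k * Real.pi : ℝ) : ℂ) * I := by push_cast; ring
  rw [e_eq, this, norm_exp_ofReal_mul_I]

lemma conj_e (k : ℕ) (m : ℤ) : conj (e k m) = e k (-m) := by
  rw [e_eq, e_eq, ← exp_conj]; simp [neg_div]

lemma e_mul_e_neg (k : ℕ) (m : ℤ) : e k m * e k (-m) = 1 := by
  rw [← e_add, add_neg_cancel, e_zero]

lemma e_zpow (k : ℕ) (m p : ℤ) : e k m ^ p = e k (p * m) := by
  rw [e_eq, e_eq, ← exp_int_mul]; push_cast; ring_nf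

lemma e_two_mul_pow {k : ℕ} (hk : 0 < k) (m : ℤ) : e k (2 * m) ^ k = 1 := by
  have hk' : (k : ℂ) ≠ 0 := by exact_mod_cast hk.ne'
  rw [e_eq, ← exp_nat_mul, exp_eq_one_iff]
  exact ⟨m, by push_cast; field_simp⟩

lemma e_two_mul_eq_iff {k : ℕ} (hk : 0 < k) (m n : ℤ) :
    e k (2 * m) = e k (2 * n) ↔ (k : ℤ) ∣ m - n := by
  have hk' : (k : ℂ) ≠ 0 := by exact_mod_cast hk.ne'
  have hπ : (Real.pi : ℂ) ≠ 0 := by exact_mod_cast Real.pi_ne_zero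
  rw [e_eq, e_eq, exp_eq_exp_iff_exists_int]
  constructor
  · rintro ⟨j, hj⟩
    refine ⟨j, ?_⟩
    have h2 : (2 * Real.pi * I : ℂ) ≠ 0 := two_pi_I_ne_zero
    have : ((m - n : ℤ) : ℂ) * (2 * Real.pi * I) = (k * j : ℤ) * (2 * Real.pi * I) := by
      push_cast at hj ⊢
      field_simp at hj
      linear_combination 2 * Real.pi * I * hj
    exact_mod_cast mul_right_cancel₀ h2 this
  · rintro ⟨j, hj⟩
    refine ⟨j, ?_⟩
    have hj' : (m : ℂ) = n + k * j := by
      have : m = n + k * j := by linarith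
      exact_mod_cast this
    push_cast
    rw [hj']
    field_simp

/-- The parametrization of the sector `Q_{2m}` by the strip `0 < Im ζ < π`. -/
noncomputable def sectorMap (k : ℕ) (m : ℤ) (ζ : ℂ) : ℂ := e k (2 * m) * exp (ζ / k)

lemma sectorMap_ne_zero (k : ℕ) (m : ℤ) (ζ : ℂ) : sectorMap k m ζ ≠ 0 :=
  mul_ne_zero (e_ne_zero _ _) (exp_ne_zero _)

lemma sectorMap_pow {k : ℕ} (hk : 0 < k) (m : ℤ) (ζ : ℂ) : sectorMap k m ζ ^ k = exp ζ := by
  have hk' : (k : ℂ) ≠ 0 := by exact_mod_cast hk.ne'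
  rw [sectorMap, mul_pow, e_two_mul_pow hk, one_mul, ← exp_nat_mul, mul_div_cancel₀ _ hk']

lemma norm_sectorMap (k : ℕ) (m : ℤ) (ζ : ℂ) : ‖sectorMap k m ζ‖ = Real.exp (ζ.re / k) := by
  rw [sectorMap, norm_mul, norm_e, one_mul, norm_exp, div_natCast_re]

lemma sectorMap_zpow (k : ℕ) (m p : ℤ) (ζ : ℂ) :
    sectorMap k m ζ ^ p = e k (2 * (p * m)) * exp (p * ζ / k) := by
  rw [sectorMap, mul_zpow, e_zpow, ← exp_int_mul]
  ring_nf

lemma conj_tprod {ι : Type*} (f : ι → ℂ) : conj (∏' i, f i) = ∏' i, conj (f i) :=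
  Function.LeftInverse.map_tprod f (g := starRingEnd ℂ) continuous_conj continuous_conj
    Complex.conj_conj

lemma conj_tprod_one_add {ι : Type*} (a : ι → ℝ) (x : ℂ) :
    conj (∏' i, (1 + x / (a i : ℂ))) = ∏' i, (1 + conj x / (a i : ℂ)) := by
  rw [conj_tprod]; simp

lemma conj_tprod_one_sub {ι : Type*} (a : ι → ℝ) (x : ℂ) :
    conj (∏' i, (1 - x / (a i : ℂ))) = ∏' i, (1 - conj x / (a i : ℂ)) := by
  rw [conj_tprod]; simp

lemma eventually_exp_flipMap_prodLog {ι : Type*} {b : ι → ℝ} (hb : ∀ i, 0 < b i)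
    (hs : Summable fun i => (b i)⁻¹) {ζ : ℂ} (h0 : 0 ≤ ζ.im) (h1 : ζ.im ≤ Real.pi)
    (hζ : conj ζ + Real.pi * I ∉ zeroSet b) :
    ∀ᶠ w in 𝓝 ζ, exp (flipMap (prodLog b) w) = (∏' i, (1 - exp w / (b i : ℂ)))⁻¹ := by
  have h := eventually_exp_prodLog hb hs (slitPlane_of_notMem_zeroSet hb
    (ζ := conj ζ + Real.pi * I) (by simpa using h1) (by simpa using h0) hζ)
  have hc : Continuous fun w : ℂ => conj w + Real.pi * I := by fun_prop
  filter_upwards [(hc.tendsto ζ).eventually h] with w hw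
  rw [flipMap, exp_neg, exp_conj, hw, conj_tprod_one_add]
  congr 2
  ext i
  rw [exp_add, exp_pi_mul_I, map_mul, ← exp_conj, Complex.conj_conj]
  simp [sub_eq_add_neg, neg_div]

lemma eventually_exp_invMap {g h : ℂ → ℂ} {ζ : ℂ} (hh : ∀ x, conj (h x) = h (conj x))
    (hg : ∀ᶠ w in 𝓝 (-conj ζ), exp (g w) = h (exp w)) :
    ∀ᶠ w in 𝓝 ζ, exp (invMap g w) = h (exp w)⁻¹ := by
  have hc : Continuous fun w : ℂ => -conj w := by fun_prop
  filter_upwards [(hc.tendsto ζ).eventually hg] with w hw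
  rw [invMap, exp_conj, hw, hh, ← exp_conj, ← exp_neg]
  simp

section

variable {ι₁ ι₂ ι₃ ι₄ : Type*} {A A₀ : ℝ} {a : ι₁ → ℝ} {b : ι₂ → ℝ} {c : ι₃ → ℝ} {d : ι₄ → ℝ}

lemma G_conj (k : ℕ) (p : ℤ) (z : ℂ) :
    G k p A A₀ a b c d (conj z) = conj (G k p A A₀ a b c d z) := by
  simp only [G, map_mul, map_div₀, conj_tprod_one_add, conj_tprod_one_sub, ← exp_conj, map_add,
    map_pow, map_inv₀, map_zpow₀, conj_ofReal]

lemma eventually_exp_logR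
    (ha : ∀ ν, 0 < a ν) (hb : ∀ μ, 0 < b μ) (hc : ∀ ν, 0 < c ν) (hd : ∀ μ, 0 < d μ)
    (hsa : Summable fun ν => (a ν)⁻¹) (hsb : Summable fun μ => (b μ)⁻¹)
    (hsc : Summable fun ν => (c ν)⁻¹) (hsd : Summable fun μ => (d μ)⁻¹) {ζ : ℂ}
    (h0 : 0 ≤ ζ.im) (h1 : ζ.im ≤ Real.pi) (hζ : ζ ∉ singularSet a b c d) :
    ∀ᶠ w in 𝓝 ζ, exp (logR A A₀ a b c d w) =
      exp (A * exp w + A₀ * (exp w)⁻¹) *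
        ((∏' ν, (1 + exp w / (a ν : ℂ))) / (∏' μ, (1 - exp w / (b μ : ℂ)))) *
        ((∏' ν, (1 + (exp w)⁻¹ / (c ν : ℂ))) / (∏' μ, (1 - (exp w)⁻¹ / (d μ : ℂ)))) := by
  simp only [singularSet, mem_union, mem_empty_iff_false, false_or, mem_ofPred_eq, not_or] at hζ
  obtain ⟨na, nb, nc, nd⟩ := hζ
  have i0 : 0 ≤ (-conj ζ).im := by simpa using h0
  have i1 : (-conj ζ).im ≤ Real.pi := by simpa using h1
  have ea := eventually_exp_prodLog ha hsa (slitPlane_of_notMem_zeroSet ha h0 h1 na)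
  have eb := eventually_exp_flipMap_prodLog hb hsb h0 h1 nb
  have ec := eventually_exp_invMap (h := fun x => ∏' i, (1 + x / (c i : ℂ)))
    (conj_tprod_one_add c)
    (eventually_exp_prodLog hc hsc (slitPlane_of_notMem_zeroSet hc i0 i1 nc))
  have ed := eventually_exp_invMap (h := fun x => (∏' i, (1 - x / (d i : ℂ)))⁻¹)
    (fun x => by rw [map_inv₀, conj_tprod_one_sub])
    (eventually_exp_flipMap_prodLog hd hsd i0 i1 nd)
  filter_upwards [ea, eb, ec, ed] with w wa wb wc wd
  simp only [logR, Pi.add_apply, exp_add, wa, wb, wc, wd]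
  have : exp (invMap (fun ζ => (A₀ : ℂ) * exp ζ) w) = exp (A₀ * (exp w)⁻¹) := by
    simp [invMap, ← exp_neg, ← exp_conj]
  rw [this]
  ring

lemma eventually_G_sectorMap {k : ℕ} (hk : 0 < k) (p : ℤ)
    (ha : ∀ ν, 0 < a ν) (hb : ∀ μ, 0 < b μ) (hc : ∀ ν, 0 < c ν) (hd : ∀ μ, 0 < d μ)
    (hsa : Summable fun ν => (a ν)⁻¹) (hsb : Summable fun μ => (b μ)⁻¹)
    (hsc : Summable fun ν => (c ν)⁻¹) (hsd : Summable fun μ => (d μ)⁻¹) {ζ : ℂ}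
    (h0 : 0 ≤ ζ.im) (h1 : ζ.im ≤ Real.pi) (hζ : ζ ∉ ∅ ∪ singularSet a b c d) (m : ℤ) :
    ∀ᶠ w in 𝓝 ζ, G k p A A₀ a b c d (sectorMap k m w) =
      e k (2 * (p * m)) * exp (logG k p A A₀ a b c d w / k) := by
  have hk' : (k : ℂ) ≠ 0 := by exact_mod_cast hk.ne'
  filter_upwards [eventually_exp_logR (A := A) (A₀ := A₀) ha hb hc hd hsa hsb hsc hsd h0 h1
    (by simpa using hζ)] with w hw
  rw [G, sectorMap_pow hk, sectorMap_zpow, logG, Pi.add_apply, add_div,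
    mul_div_cancel_left₀ _ hk', exp_add (p * w / k : ℂ), hw]
  ring

lemma one_add_exp_div_of_mem_zeroSet {ι : Type*} {a : ι → ℝ} (ha : ∀ i, 0 < a i) {ζ : ℂ}
    (h : ζ ∈ zeroSet a) : ∏' i, (1 + exp ζ / (a i : ℂ)) = 0 := by
  obtain ⟨h0, i, hi⟩ := h
  refine tprod_of_exists_eq_zero ⟨i, ?_⟩
  have : (a i : ℂ) ≠ 0 := by exact_mod_cast (ha i).ne'
  rw [exp_of_im_eq_pi h0, hi]
  push_cast
  field_simp
  ring

lemma one_sub_exp_div_of_mem_zeroSet {ι : Type*} {b : ι → ℝ} (hb : ∀ i, 0 < b i) {ζ : ℂ}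
    (h : conj ζ + Real.pi * I ∈ zeroSet b) : ∏' i, (1 - exp ζ / (b i : ℂ)) = 0 := by
  have h1 := congrArg conj (one_add_exp_div_of_mem_zeroSet hb h)
  rw [conj_tprod_one_add, ← exp_conj, map_zero] at h1
  rw [← h1]
  congr 1
  ext i
  simp [exp_add, sub_eq_add_neg, neg_div]

/-- At a pole a product in a denominator vanishes, and division by zero gives 0, just as at a zero
of G. So no singular point is an α-point for α ≠ 0. -/
lemma G_sectorMap_of_mem_singularSet {k : ℕ} (hk : 0 < k) (p : ℤ)
    (ha : ∀ ν, 0 < a ν) (hb : ∀ μ, 0 < b μ) (hc : ∀ ν, 0 < c ν) (hd : ∀ μ, 0 < d μ) {ζ : ℂ}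
    (hζ : ζ ∈ ∅ ∪ singularSet a b c d) (m : ℤ) :
    G k p A A₀ a b c d (sectorMap k m ζ) = 0 := by
  simp only [singularSet, mem_union, mem_empty_iff_false, false_or, mem_ofPred_eq] at hζ
  have hinv : (exp ζ)⁻¹ = conj (exp (-conj ζ)) := by rw [← exp_conj, ← exp_neg]; simp
  rw [G, sectorMap_pow hk]
  rcases hζ with h | h | h | h
  · rw [one_add_exp_div_of_mem_zeroSet ha h]; simp
  · rw [one_sub_exp_div_of_mem_zeroSet hb h]; simp
  · rw [hinv, ← conj_tprod_one_add, one_add_exp_div_of_mem_zeroSet hc h]; simp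
  · rw [hinv, ← conj_tprod_one_sub, one_sub_exp_div_of_mem_zeroSet hd h]; simp

end

/-! ### The reflection and the sectors -/

lemma reflPt_sectorMap (k : ℕ) (s m : ℤ) (ζ : ℂ) :
    reflPt k s (sectorMap k m ζ) = sectorMap k (-m - s) (conj ζ) := by
  rw [reflPt, sectorMap, sectorMap, map_mul, conj_e, ← exp_conj, map_div₀, map_natCast,
    mul_right_comm, ← e_add]
  ring_nf

lemma reflPt_reflPt (k : ℕ) (s : ℤ) (z : ℂ) : reflPt k s (reflPt k s z) = z := by
  rw [reflPt, reflPt, map_mul, Complex.conj_conj, conj_e, mul_assoc, ← e_add]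
  simp [e_zero]

lemma norm_reflPt (k : ℕ) (s : ℤ) (z : ℂ) : ‖reflPt k s z‖ = ‖z‖ := by
  rw [reflPt, norm_mul, norm_e, mul_one, norm_conj]

lemma reflPt_ne_zero {k : ℕ} {s : ℤ} {z : ℂ} (h : z ≠ 0) : reflPt k s z ≠ 0 := by
  rwa [← norm_ne_zero_iff, norm_reflPt, norm_ne_zero_iff]

lemma sectorMap_eq_of_dvd {k : ℕ} (hk : 0 < k) {m n : ℤ} (h : (k : ℤ) ∣ m - n) (ζ : ℂ) :
    sectorMap k m ζ = sectorMap k n ζ := by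
  rw [sectorMap, sectorMap, (e_two_mul_eq_iff hk m n).2 h]

lemma sectorMap_sub_two_pi {k : ℕ} (hk : 0 < k) (m : ℤ) (ζ : ℂ) :
    sectorMap k m (ζ - 2 * Real.pi * I) = sectorMap k (m - 1) ζ := by
  have hk' : (k : ℂ) ≠ 0 := by exact_mod_cast hk.ne'
  rw [sectorMap, sectorMap, e_eq, e_eq, ← exp_add, ← exp_add]
  congr 1
  push_cast
  field_simp
  ring

lemma exists_sectorMap_eq {k : ℕ} (hk : 0 < k) {z : ℂ} (hz : z ≠ 0) :
    ∃ (m : ℤ) (ζ : ℂ), -Real.pi < ζ.im ∧ ζ.im ≤ Real.pi ∧ z = sectorMap k m ζ := by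
  have hk' : (k : ℂ) ≠ 0 := by exact_mod_cast hk.ne'
  have h : exp (k * log z) = exp (log (z ^ k)) := by
    rw [exp_log (pow_ne_zero _ hz), exp_nat_mul, exp_log hz]
  obtain ⟨m, hm⟩ := exp_eq_exp_iff_exists_int.1 h
  refine ⟨m, log (z ^ k), neg_pi_lt_log_im _, log_im_le_pi _, ?_⟩
  rw [sectorMap, e_eq, ← exp_add, ← exp_log hz]
  congr 1
  rw [exp_log hz]
  push_cast
  field_simp
  linear_combination hm

/-- The principal value of log z^k has imaginary part in (-π, π]. If it is negative, z lies in an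
odd sector and its mirror image lies in an even one. -/
lemma exists_sectorMap {k : ℕ} (hk : 0 < k) (s : ℤ) {z : ℂ} (hz : z ≠ 0) :
    ∃ (m : ℤ) (ζ : ℂ), 0 ≤ ζ.im ∧ ζ.im ≤ Real.pi ∧
      (z = sectorMap k m ζ ∨ reflPt k s z = sectorMap k m ζ) := by
  obtain ⟨m, ζ, h0, h1, rfl⟩ := exists_sectorMap_eq hk hz
  rcases le_total 0 ζ.im with h | h
  · exact ⟨m, ζ, h, h1, .inl rfl⟩
  · exact ⟨-m - s, conj ζ, by simpa using h, by rw [conj_im]; linarith,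
      .inr (reflPt_sectorMap k s m ζ)⟩

/-- The reflection turns a sector over: in the strip coordinate it becomes ζ ↦ conj ζ + πi, and
sector j goes to sector -2s - j - 1. -/
lemma reflPt_e_mul_exp {k : ℕ} (hk : 0 < k) (s j : ℤ) (ζ : ℂ) :
    reflPt k s (e k j * exp (ζ / k)) =
      e k (-2 * s - j - 1) * exp ((conj ζ + Real.pi * I) / k) := by
  have hk' : (k : ℂ) ≠ 0 := by exact_mod_cast hk.ne'
  rw [reflPt, map_mul, conj_e, ← exp_conj, map_div₀, map_natCast, mul_right_comm, ← e_add,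
    e_eq, e_eq, ← exp_add, ← exp_add]
  congr 1
  push_cast
  field_simp
  ring

lemma arg_exp_of_strip {k : ℕ} (hk : 2 ≤ k) {ζ : ℂ} (h0 : 0 ≤ ζ.im) (h1 : ζ.im ≤ Real.pi) :
    arg (exp (ζ / k)) = ζ.im / k := by
  have hk' : (2 : ℝ) ≤ k := by exact_mod_cast hk
  have hπ := Real.pi_pos
  rw [arg_exp, div_natCast_im, toIocMod_eq_self]
  constructor
  · have : 0 ≤ ζ.im / k := by positivity
    linarith
  · have : ζ.im / k ≤ ζ.im := div_le_self h0 (by linarith)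
    linarith

lemma eq_e_mul_exp {k : ℕ} (hk : 0 < k) (j : ℤ) {z : ℂ} (hz : z ≠ 0) :
    z = e k j * exp ((k * log (z * e k (-j))) / k) := by
  have hk' : (k : ℂ) ≠ 0 := by exact_mod_cast hk.ne'
  rw [mul_div_cancel_left₀ _ hk', exp_log (mul_ne_zero hz (e_ne_zero _ _)), mul_left_comm,
    e_mul_e_neg, mul_one]

lemma mem_Q_iff {k : ℕ} (hk : 2 ≤ k) (j : ℤ) (z : ℂ) :
    z ∈ Q k j ↔ ∃ ζ : ℂ, 0 < ζ.im ∧ ζ.im < Real.pi ∧ z = e k j * exp (ζ / k) := by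
  have hk0 : (0 : ℝ) < k := by exact_mod_cast (by omega : 0 < k)
  constructor
  · rintro ⟨hz, h0, h1⟩
    refine ⟨k * log (z * e k (-j)), ?_, ?_, eq_e_mul_exp (by omega) j hz⟩
    · rw [im_natCast_mul, log_im]; positivity
    · rw [im_natCast_mul, log_im]; rwa [lt_div_iff₀' hk0] at h1
  · rintro ⟨ζ, h0, h1, rfl⟩
    refine ⟨mul_ne_zero (e_ne_zero _ _) (exp_ne_zero _), ?_⟩
    rw [mul_right_comm, e_mul_e_neg, one_mul, arg_exp_of_strip hk h0.le h1.le]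
    exact ⟨by positivity, by gcongr⟩

lemma mem_closure_Q_iff {k : ℕ} (hk : 2 ≤ k) (j : ℤ) {z : ℂ} (hz : z ≠ 0) :
    z ∈ closure (Q k j) ↔ ∃ ζ : ℂ, 0 ≤ ζ.im ∧ ζ.im ≤ Real.pi ∧ z = e k j * exp (ζ / k) := by
  have hk0 : (0 : ℝ) < k := by exact_mod_cast (by omega : 0 < k)
  have hkC : (k : ℂ) ≠ 0 := by exact_mod_cast hk0.ne'
  have hπ := Real.pi_pos
  constructor
  · intro h
    -- The closed half planes bounded by the two sides of the sector; since k ≥ 2, their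
    -- intersection contains no nonzero point outside the closed sector.
    have hsub : Q k j ⊆ {z | 0 ≤ (z * e k (-j)).im} ∩
        {z | (z * e k (-j) * e k (-1)).im ≤ 0} := by
      intro w hw
      obtain ⟨ζ, h0, h1, rfl⟩ := (mem_Q_iff hk j w).1 hw
      have hkπ : ζ.im / k ≤ ζ.im := div_le_self h0.le (by exact_mod_cast (by omega : 1 ≤ k))
      rw [mem_inter_iff, mem_ofPred_eq, mem_ofPred_eq, mul_right_comm, e_mul_e_neg, one_mul]
      constructor
      · rw [exp_im, div_natCast_im]
        have := Real.sin_nonneg_of_nonneg_of_le_pi (x := ζ.im / k) (by positivity) (by linarith)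
        positivity
      · have : exp (ζ / k) * e k (-1) = exp ((ζ - Real.pi * I) / k) := by
          rw [e_eq, ← exp_add]; congr 1; push_cast; field_simp; ring
        rw [this, exp_im, div_natCast_im]
        have him : (ζ - Real.pi * I).im = ζ.im - Real.pi := by simp
        rw [him]
        refine mul_nonpos_of_nonneg_of_nonpos (Real.exp_pos _).le
          (Real.sin_nonpos_of_nonpos_of_neg_pi_le ?_ ?_)
        · exact div_nonpos_of_nonpos_of_nonneg (by linarith) hk0.le
        · have : Real.pi / k ≤ Real.pi := div_le_self hπ.le (by exact_mod_cast (by omega : 1 ≤ k))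
          rw [sub_div]
          have : 0 ≤ ζ.im / k := by positivity
          linarith
    have hcl : IsClosed ({z | 0 ≤ (z * e k (-j)).im} ∩
        {z : ℂ | (z * e k (-j) * e k (-1)).im ≤ 0}) :=
      (isClosed_le continuous_const (by fun_prop)).inter
        (isClosed_le (by fun_prop) continuous_const)
    obtain ⟨c0, c1⟩ := closure_minimal hsub hcl h
    rw [mem_ofPred_eq] at c0 c1
    have hy : z * e k (-j) ≠ 0 := mul_ne_zero hz (e_ne_zero _ _)
    set y := z * e k (-j) with hydef
    have ha0 : 0 ≤ arg y := arg_nonneg_iff.2 c0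
    refine ⟨k * log y, ?_, ?_, eq_e_mul_exp (by omega) j hz⟩
    · rw [im_natCast_mul, log_im]; positivity
    · rw [im_natCast_mul, log_im, ← le_div_iff₀' hk0]
      by_contra! hlt
      have hexp : y * e k (-1) = exp (log y + (-(Real.pi / k) : ℝ) * I) := by
        rw [exp_add, exp_log hy, e_eq]; congr 2; push_cast; ring
      rw [hexp, exp_im] at c1
      have him : (log y + (-(Real.pi / k) : ℝ) * I).im = arg y - Real.pi / k := by
        rw [add_im, log_im, im_ofReal_mul, I_im]; ring
      rw [him] at c1
      have h2 : 0 < Real.pi / k := by positivity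
      have := Real.sin_pos_of_pos_of_lt_pi (x := arg y - Real.pi / k) (by linarith)
        (by linarith [arg_le_pi y])
      have := mul_pos (Real.exp_pos (log y + (-(Real.pi / k) : ℝ) * I).re) this
      linarith
  · rintro ⟨ζ, h0, h1, rfl⟩
    have hc : Continuous fun w : ℂ => e k j * exp (w / k) := by fun_prop
    have hmem : ζ ∈ closure (im ⁻¹' Ioo 0 Real.pi) := by
      rw [← Complex.isOpenMap_im.preimage_closure_eq_closure_preimage continuous_im,
        closure_Ioo hπ.ne]
      exact ⟨h0, h1⟩
    refine map_mem_closure (f := fun w : ℂ => e k j * exp (w / k)) hc hmem fun w hw => ?_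
    exact (mem_Q_iff hk j _).2 ⟨w, hw.1, hw.2, rfl⟩

lemma reflPt_mem_Q_iff {k : ℕ} (hk : 2 ≤ k) (s j : ℤ) (z : ℂ) :
    reflPt k s z ∈ Q k j ↔ z ∈ Q k (-2 * s - j - 1) := by
  have key : ∀ (j : ℤ) (z : ℂ), z ∈ Q k j → reflPt k s z ∈ Q k (-2 * s - j - 1) := by
    intro j z h
    obtain ⟨ζ, h0, h1, rfl⟩ := (mem_Q_iff hk j z).1 h
    exact (mem_Q_iff hk _ _).2 ⟨_, by simpa using h1, by simpa using h0,
      reflPt_e_mul_exp (by omega) s j ζ⟩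
  refine ⟨fun h => ?_, fun h => ?_⟩
  · simpa [reflPt_reflPt] using key j _ h
  · have := key _ z h
    have e : -2 * s - (-2 * s - j - 1) - 1 = j := by ring
    rwa [e] at this

lemma reflPt_mem_closure_Q_iff {k : ℕ} (hk : 2 ≤ k) (s j : ℤ) {z : ℂ} (hz : z ≠ 0) :
    reflPt k s z ∈ closure (Q k j) ↔ z ∈ closure (Q k (-2 * s - j - 1)) := by
  have key : ∀ (j : ℤ) (z : ℂ), z ≠ 0 → z ∈ closure (Q k j) →
      reflPt k s z ∈ closure (Q k (-2 * s - j - 1)) := by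
    intro j z hz h
    obtain ⟨ζ, h0, h1, rfl⟩ := (mem_closure_Q_iff hk j hz).1 h
    exact (mem_closure_Q_iff hk _ (reflPt_ne_zero hz)).2 ⟨_, by simpa using h1, by simpa using h0,
      reflPt_e_mul_exp (by omega) s j ζ⟩
  refine ⟨fun h => ?_, fun h => ?_⟩
  · simpa [reflPt_reflPt] using key j _ (reflPt_ne_zero hz) h
  · have := key _ z hz h
    have e : -2 * s - (-2 * s - j - 1) - 1 = j := by ring
    rwa [e] at this

/-! ### The strip model and multiplicities -/

/-- `f` is a logarithm of `g ^ k` in the variable `ζ = log (z ^ k)`, with singularities `P`. -/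
structure StripModel (g : ℂ → ℂ) (k : ℕ) (p : ℤ) (f : ℂ → ℂ) (P : Set ℂ) : Prop where
  strict : StrictStripMap f P
  -- Required on a full neighbourhood even at boundary points, so that the derivatives of g can be
  -- read off there.
  eventually_eq : ∀ ζ ∈ regularStrip P, ∀ m : ℤ, ∀ᶠ w in 𝓝 ζ,
    g (sectorMap k m w) = e k (2 * (p * m)) * exp (f w / k)
  eq_zero : ∀ ζ ∈ P, ∀ m : ℤ, g (sectorMap k m ζ) = 0
  map_conj : ∀ z, g (conj z) = conj (g z)
  map_rotate : ∀ (j : ℤ) (z : ℂ), g (z * e k (2 * j)) = g z * e k (2 * (p * j))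
  map_zero : g 0 = 0

/-- Taking logarithms, u/k + 2πiq/k = log α + 2πiN for some integer N, so n = kN - q. -/
lemma e_mul_exp_eq_iff {k : ℕ} (hk : 0 < k) {α : ℂ} (hα : α ≠ 0) (q : ℤ) (u : ℂ) :
    e k (2 * q) * exp (u / k) = α ↔
      ∃ n : ℤ, u = k * log α + 2 * Real.pi * I * n ∧ (k : ℤ) ∣ n + q := by
  have hk' : (k : ℂ) ≠ 0 := by exact_mod_cast hk.ne'
  nth_rw 1 [← exp_log hα]
  rw [e_eq, ← exp_add, exp_eq_exp_iff_exists_int]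
  constructor
  · rintro ⟨N, hN⟩
    refine ⟨k * N - q, ?_, ⟨N, by ring⟩⟩
    push_cast at hN ⊢
    field_simp at hN
    linear_combination hN
  · rintro ⟨n, hn, N, hN⟩
    refine ⟨N, ?_⟩
    have hn' : (n : ℂ) = k * N - q := by
      have : n = k * N - q := by linarith
      exact_mod_cast this
    rw [hn, hn']
    push_cast
    field_simp
    ring

section Multiplicity

variable {g f : ℂ → ℂ} {α z ζ : ℂ}

lemma isSimple_iff : IsSimple g α z ↔ g z = α ∧ deriv g z ≠ 0 := by
  simp only [IsSimple, IsAlphaPointOfMult, le_refl, true_and, iteratedDeriv_one]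
  refine and_congr_right fun _ => and_iff_right fun j h1 h2 => by omega

lemma isDouble_iff :
    IsDouble g α z ↔ g z = α ∧ deriv g z = 0 ∧ deriv (deriv g) z ≠ 0 := by
  have h2 : iteratedDeriv 2 g = deriv (deriv g) := by
    rw [iteratedDeriv_succ, iteratedDeriv_one]
  rw [IsDouble, IsAlphaPointOfMult, h2]
  refine and_congr_right fun _ => ⟨fun ⟨_, h, h'⟩ => ⟨?_, h'⟩, fun ⟨h, h'⟩ => ⟨by norm_num, ?_, h'⟩⟩
  · have := h 1 le_rfl one_lt_two
    rwa [iteratedDeriv_one] at this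
  · intro j h1 h2
    obtain rfl : j = 1 := by omega
    rwa [iteratedDeriv_one]

variable {k : ℕ} {p : ℤ} {P : Set ℂ}

/-- Near z₀ the map φ(z) = k log(z/z₀) + ζ inverts `sectorMap`, so g is a constant times exp((f ∘
φ)/k) and g' = g · (f' ∘ φ)/z. In g'' every term but one contains f' and drops out at a critical
point. -/
lemma StripModel.deriv_sectorMap (h : StripModel g k p f P) (hk : 0 < k)
    (hζ : ζ ∈ regularStrip P) (m : ℤ) :
    deriv g (sectorMap k m ζ) = g (sectorMap k m ζ) * deriv f ζ / sectorMap k m ζ ∧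
      (deriv f ζ = 0 → deriv (deriv g) (sectorMap k m ζ) =
        g (sectorMap k m ζ) * k * deriv (deriv f) ζ / sectorMap k m ζ ^ 2) := by
  have hk' : (k : ℂ) ≠ 0 := by exact_mod_cast hk.ne'
  set z₀ := sectorMap k m ζ with hz₀
  have hz₀' : z₀ ≠ 0 := sectorMap_ne_zero _ _ _
  set φ : ℂ → ℂ := fun z => k * log (z / z₀) + ζ with hφ
  have hφ0 : φ z₀ = ζ := by simp [hφ, div_self hz₀']
  have hslit : ∀ᶠ z in 𝓝 z₀, z / z₀ ∈ slitPlane := by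
    have hc : ContinuousAt (fun z : ℂ => z / z₀) z₀ := by fun_prop
    refine hc.eventually_mem (isOpen_slitPlane.mem_nhds ?_)
    rw [div_self hz₀']; exact one_mem_slitPlane
  have hφd : ∀ z, z / z₀ ∈ slitPlane → HasDerivAt φ (k / z) z := by
    intro z hz
    have hz0 : z ≠ 0 := by rintro rfl; simp at hz
    refine ((((hasDerivAt_id z).div_const z₀).clog hz).const_mul (k : ℂ)).add_const ζ
      |>.congr_deriv ?_
    simp only [id]
    field_simp
  have hφc : Tendsto φ (𝓝 z₀) (𝓝 ζ) := by
    have := (hφd z₀ hslit.self_of_nhds).continuousAt.tendsto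
    rwa [hφ0] at this
  have hg : g =ᶠ[𝓝 z₀] fun z => e k (2 * (p * m)) * exp (f (φ z) / k) := by
    filter_upwards [hφc.eventually (h.eventually_eq ζ hζ m), hslit] with z hz hs
    rw [← hz]
    congr 1
    have hz0 : z ≠ 0 := by rintro rfl; simp at hs
    rw [sectorMap, hφ]
    simp only
    rw [add_div, mul_div_cancel_left₀ _ hk', exp_add, exp_log (div_ne_zero hz0 hz₀'),
      mul_left_comm, ← sectorMap, ← hz₀, div_mul_cancel₀ _ hz₀']
  have han := h.strict.analyticAt_of_mem hζ
  have hgd : ∀ᶠ z in 𝓝 z₀, HasDerivAt g (g z * deriv f (φ z) / z) z := by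
    filter_upwards [hg.eventuallyEq_nhds, hslit, hφc.eventually han.eventually_analyticAt]
      with z h1 h2 h3
    have h4 := (h3.differentiableAt.hasDerivAt.comp z (hφd z h2)).div_const (k : ℂ)
    refine (((h4.cexp).const_mul (e k (2 * (p * m)))).congr_of_eventuallyEq h1).congr_deriv ?_
    rw [h1.self_of_nhds]
    simp only [Function.comp_apply]
    field_simp
  have hd0 := hgd.self_of_nhds
  refine ⟨by rw [hd0.deriv, hφ0], fun hf0 => ?_⟩
  have hgd' : deriv g =ᶠ[𝓝 z₀] fun z => g z * deriv f (φ z) / z := hgd.mono fun z hz => hz.deriv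
  rw [hgd'.deriv_eq]
  have hdf : HasDerivAt (fun z => deriv f (φ z)) (deriv (deriv f) ζ * (k / z₀)) z₀ := by
    have h5 : HasDerivAt (deriv f) (deriv (deriv f) ζ) (φ z₀) := by
      rw [hφ0]; exact han.deriv.differentiableAt.hasDerivAt
    exact h5.comp z₀ (hφd z₀ hslit.self_of_nhds)
  rw [((hd0.fun_mul hdf).fun_div (hasDerivAt_id' z₀) hz₀').deriv, hφ0, hf0]
  field_simp
  ring

lemma StripModel.deriv_reflPt (h : StripModel g k p f P) (s : ℤ) (z : ℂ)
    (hd : deriv g z ≠ 0) : deriv g (reflPt k s z) ≠ 0 := by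
  have h1 : g = fun w => e k (2 * (p * -s)) * (conj ∘ (fun v => g (v * e k (2 * -s))) ∘ conj) w := by
    ext w
    simp only [Function.comp_apply]
    rw [h.map_rotate, h.map_conj, map_mul, Complex.conj_conj, conj_e, mul_left_comm,
      e_mul_e_neg, mul_one]
  have h2 : ∀ w, deriv g w = e k (2 * (p * -s)) * conj (e k (2 * -s) *
      deriv g (reflPt k s w)) := by
    intro w
    conv_lhs => rw [h1]
    rw [deriv_const_mul_field, deriv_conj_conj]
    simp only [Function.comp_apply]
    have := deriv_comp_mul_left (e k (2 * -s)) g (conj w)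
    simp only [smul_eq_mul] at this
    rw [show (fun v => g (v * e k (2 * -s))) = fun v => g (e k (2 * -s) * v) from
      funext fun v => by rw [mul_comm], this]
    rw [reflPt, mul_comm (conj w)]
    simp
  intro h0
  rw [h2 z, h0] at hd
  simp at hd

end Multiplicity

/-! ### α-points as points of a level line -/

/-- The standing assumptions on a strip model, a value `α` and the reflection `z ↦ z*`. -/
structure ReflSetting (g : ℂ → ℂ) (k : ℕ) (p : ℤ) (f : ℂ → ℂ) (P : Set ℂ) (α : ℂ) (s : ℤ) :
    Prop where
  model : StripModel g k p f P
  two_le : 2 ≤ k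
  coprime : IsCoprime (k : ℤ) p
  ne_zero : α ≠ 0
  im_eq_zero : (α * e k (p * s)).im = 0

/-- `z` or `z*` is the point of the sector with number `2m` which corresponds to `ζ`, and
`f ζ = k log α + 2πin`, where `n` is a number for which `z` is an `α`-point. -/
structure IsRep (k : ℕ) (p : ℤ) (f : ℂ → ℂ) (P : Set ℂ) (α : ℂ) (s : ℤ) (z : ℂ) (m : ℤ) (ζ : ℂ)
    (n : ℤ) : Prop where
  mem : ζ ∈ regularStrip P
  eq : z = sectorMap k m ζ ∨ reflPt k s z = sectorMap k m ζ
  val : f ζ = k * log α + 2 * Real.pi * I * n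
  dvd : (k : ℤ) ∣ n + p * m

section

variable {g : ℂ → ℂ} {k : ℕ} {p : ℤ} {f : ℂ → ℂ} {P : Set ℂ} {α : ℂ} {s : ℤ}

lemma ReflSetting.pos (S : ReflSetting g k p f P α s) : 0 < k := by
  have := S.two_le; omega

/-- The value at z* is conj(α) e_{-2ps}, which equals α because α e_{ps} is real. -/
lemma ReflSetting.map_reflPt (S : ReflSetting g k p f P α s) {z : ℂ} (h : g z = α) :
    g (reflPt k s z) = α := by
  have h1 : conj (α * e k (p * s)) = α * e k (p * s) := conj_eq_iff_im.2 S.im_eq_zero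
  rw [map_mul, conj_e] at h1
  have h2 : (-2 * s : ℤ) = 2 * -s := by ring
  have h3 : (2 * (p * -s) : ℤ) = -(p * s) + -(p * s) := by ring
  rw [reflPt, h2, S.model.map_rotate, S.model.map_conj, h, h3, e_add, ← mul_assoc, h1, mul_assoc,
    e_mul_e_neg, mul_one]

lemma ReflSetting.ne_zero_of_map (S : ReflSetting g k p f P α s) {z : ℂ} (h : g z = α) :
    z ≠ 0 := by
  rintro rfl
  exact S.ne_zero (h.symm.trans S.model.map_zero)

lemma ReflSetting.isRep_sectorMap (S : ReflSetting g k p f P α s) {m : ℤ} {ζ z : ℂ}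
    (h0 : 0 ≤ ζ.im) (h1 : ζ.im ≤ Real.pi) (h : g (sectorMap k m ζ) = α)
    (hz : z = sectorMap k m ζ ∨ reflPt k s z = sectorMap k m ζ) :
    ∃ n, IsRep k p f P α s z m ζ n := by
  have hP : ζ ∉ P := fun hP => S.ne_zero (h.symm.trans (S.model.eq_zero ζ hP m))
  have hmem : ζ ∈ regularStrip P := ⟨h0, h1, hP⟩
  rw [(S.model.eventually_eq ζ hmem m).self_of_nhds, e_mul_exp_eq_iff S.pos S.ne_zero] at h
  obtain ⟨n, h2, h3⟩ := h
  exact ⟨n, hmem, hz, h2, h3⟩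

lemma ReflSetting.exists_isRep (S : ReflSetting g k p f P α s) {z : ℂ} (h : g z = α) :
    ∃ m ζ n, IsRep k p f P α s z m ζ n := by
  obtain ⟨m, ζ, h0, h1, h2⟩ := exists_sectorMap S.pos s (S.ne_zero_of_map h)
  have h3 : g (sectorMap k m ζ) = α := by
    rcases h2 with h2 | h2
    · rw [← h2, h]
    · rw [← h2, S.map_reflPt h]
  obtain ⟨n, hn⟩ := S.isRep_sectorMap h0 h1 h3 h2
  exact ⟨m, ζ, n, hn⟩

lemma IsRep.map_sectorMap {z ζ : ℂ} {m n : ℤ} (R : IsRep k p f P α s z m ζ n)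
    (S : ReflSetting g k p f P α s) : g (sectorMap k m ζ) = α := by
  rw [(S.model.eventually_eq ζ R.mem m).self_of_nhds, e_mul_exp_eq_iff S.pos S.ne_zero]
  exact ⟨n, R.val, R.dvd⟩

/-- By Bézout p is invertible modulo k, so n + pm ≡ 0 has a solution m: every n is realized in some
sector. -/
lemma ReflSetting.exists_isRep_of_val (S : ReflSetting g k p f P α s) {ζ : ℂ} {n : ℤ}
    (h : ζ ∈ regularStrip P) (hv : f ζ = k * log α + 2 * Real.pi * I * n) :
    ∃ m, IsRep k p f P α s (sectorMap k m ζ) m ζ n := by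
  obtain ⟨u, v, huv⟩ := S.coprime
  exact ⟨-(n * v), h, .inl rfl, hv, n * u, by linear_combination (-n) * huv⟩

lemma IsRep.norm_eq {z ζ : ℂ} {m n : ℤ} (R : IsRep k p f P α s z m ζ n) :
    ‖z‖ = Real.exp (ζ.re / k) := by
  rcases R.eq with h | h
  · rw [h, norm_sectorMap]
  · rw [← norm_reflPt k s, h, norm_sectorMap]

lemma IsRep.re_lt_iff {z ζ w η : ℂ} {m n m' n' : ℤ} (R : IsRep k p f P α s z m ζ n)
    (T : IsRep k p f P α s w m' η n') (S : ReflSetting g k p f P α s) :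
    ζ.re < η.re ↔ ‖z‖ < ‖w‖ := by
  have : (0 : ℝ) < k := by exact_mod_cast S.pos
  rw [R.norm_eq, T.norm_eq, Real.exp_lt_exp, div_lt_div_iff_of_pos_right this]

lemma IsRep.re_val {z ζ : ℂ} {m n : ℤ} (R : IsRep k p f P α s z m ζ n) :
    (f ζ).re = (k * log α).re := by rw [R.val]; simp

lemma IsRep.im_val {z ζ : ℂ} {m n : ℤ} (R : IsRep k p f P α s z m ζ n) :
    (f ζ).im = (k * log α).im + 2 * Real.pi * n := by rw [R.val]; simp

lemma ReflSetting.dvd_sub (S : ReflSetting g k p f P α s) {m m' n : ℤ} (h : (k : ℤ) ∣ n + p * m)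
    (h' : (k : ℤ) ∣ n + p * m') : (k : ℤ) ∣ m - m' := by
  refine S.coprime.dvd_of_dvd_mul_left ?_
  have := _root_.dvd_sub h h'
  rwa [show n + p * m - (n + p * m') = p * (m - m') by ring] at this

/-- The modulus gives Re ζ, a vertical line meets the level set at most once, f(ζ) gives n, and n
gives m modulo k. This is the core of (a). -/
lemma IsRep.unique {z ζ w η : ℂ} {m n m' n' : ℤ} (R : IsRep k p f P α s z m ζ n)
    (T : IsRep k p f P α s w m' η n') (S : ReflSetting g k p f P α s) (h : ‖z‖ = ‖w‖) :
    ζ = η ∧ n = n' ∧ (k : ℤ) ∣ m - m' := by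
  have hk : (0 : ℝ) < k := by exact_mod_cast S.pos
  have hre : ζ.re = η.re := by
    rw [R.norm_eq, T.norm_eq, Real.exp_eq_exp] at h
    field_simp at h
    exact h
  have h1 := S.model.strict.eq_of_re_eq R.mem T.mem (R.re_val.trans T.re_val.symm) hre
  subst h1
  have h2 : n = n' := by
    have := R.im_val.symm.trans T.im_val
    have hπ := Real.pi_pos
    have : (n : ℝ) = n' := by
      have h3 : 2 * Real.pi * (n : ℝ) = 2 * Real.pi * n' := by linarith
      exact mul_left_cancel₀ (by positivity) h3
    exact_mod_cast this
  subst h2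
  exact ⟨rfl, rfl, S.dvd_sub R.dvd T.dvd⟩

lemma IsRep.eq_or_eq {z ζ w : ℂ} {m n : ℤ} (R : IsRep k p f P α s z m ζ n)
    (S : ReflSetting g k p f P α s) (hw : g w = α) (h : ‖w‖ = ‖z‖) :
    w = z ∨ w = reflPt k s z := by
  obtain ⟨m', η, n', T⟩ := S.exists_isRep hw
  obtain ⟨rfl, -, h1⟩ := T.unique R S h
  have h2 := sectorMap_eq_of_dvd S.pos h1 η
  rcases T.eq with h3 | h3 <;> rcases R.eq with h4 | h4
  · exact .inl (by rw [h3, h4, h2])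
  · exact .inr (by rw [h3, h4, h2])
  · exact .inr (by rw [h4, ← h2, ← h3, reflPt_reflPt])
  · exact .inl (by rw [← reflPt_reflPt k s w, h3, h2, ← h4, reflPt_reflPt])

lemma IsRep.map_eq {z ζ : ℂ} {m n : ℤ} (R : IsRep k p f P α s z m ζ n)
    (S : ReflSetting g k p f P α s) : g z = α := by
  have h := R.map_sectorMap S
  rcases R.eq with h1 | h1
  · rw [h1, h]
  · rw [← reflPt_reflPt k s z, h1, S.map_reflPt h]

/-- If z* = z, then z^k is real and so Im ζ ∈ {0, π}. Conversely, on a boundary line z* has the same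
strip coordinate as z in some sector m'; both being α-points, m' ≡ m by coprimality. -/
lemma IsRep.fixed_iff {z ζ : ℂ} {m n : ℤ} (R : IsRep k p f P α s z m ζ n)
    (S : ReflSetting g k p f P α s) :
    reflPt k s z = z ↔ ζ.im = 0 ∨ ζ.im = Real.pi := by
  have key : reflPt k s z = z ↔ reflPt k s (sectorMap k m ζ) = sectorMap k m ζ := by
    rcases R.eq with h | h
    · rw [h]
    · rw [← h, reflPt_reflPt, eq_comm]
  rw [key]
  constructor
  · intro h
    rw [reflPt_sectorMap] at h
    have h1 := congrArg (· ^ k) h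
    simp only [sectorMap_pow S.pos] at h1
    rw [exp_conj, conj_eq_iff_im, exp_im] at h1
    have h2 := (mul_eq_zero.1 h1).resolve_left (Real.exp_pos _).ne'
    by_contra! h3
    have := Real.sin_pos_of_pos_of_lt_pi (lt_of_le_of_ne R.mem.1 h3.1.symm)
      (lt_of_le_of_ne R.mem.2.1 h3.2)
    exact this.ne' h2
  · intro h
    have h1 : ∃ m', reflPt k s (sectorMap k m ζ) = sectorMap k m' ζ := by
      rw [reflPt_sectorMap]
      rcases h with h | h
      · exact ⟨-m - s, by rw [conj_eq_iff_im.2 h]⟩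
      · refine ⟨-m - s - 1, ?_⟩
        have : conj ζ = ζ - 2 * Real.pi * I := by
          apply Complex.ext <;> simp [h]; ring
        rw [this, sectorMap_sub_two_pi S.pos]
    obtain ⟨m', hm'⟩ := h1
    have h2 := S.map_reflPt (R.map_sectorMap S)
    rw [hm'] at h2
    obtain ⟨n₁, R₁⟩ := S.isRep_sectorMap R.mem.1 R.mem.2.1 (R.map_sectorMap S) (.inl rfl)
    obtain ⟨n₂, R₂⟩ := S.isRep_sectorMap R.mem.1 R.mem.2.1 h2 (.inl rfl)
    rw [hm']
    exact sectorMap_eq_of_dvd S.pos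
      (R₂.unique R₁ S (by rw [norm_sectorMap, norm_sectorMap])).2.2 ζ

lemma IsRep.eq_sectorMap {z ζ : ℂ} {m n : ℤ} (R : IsRep k p f P α s z m ζ n)
    (h : reflPt k s z = z) : z = sectorMap k m ζ := by
  rcases R.eq with h1 | h1
  · exact h1
  · rw [← h, h1]

lemma IsRep.mem_Q {z ζ : ℂ} {m n : ℤ} (R : IsRep k p f P α s z m ζ n)
    (S : ReflSetting g k p f P α s) (h0 : 0 < ζ.im) (h1 : ζ.im < Real.pi) :
    z ∈ Q k (2 * m) ∪ Q k (-2 * s - 2 * m - 1) := by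
  have h : sectorMap k m ζ ∈ Q k (2 * m) := (mem_Q_iff S.two_le _ _).2 ⟨ζ, h0, h1, rfl⟩
  rcases R.eq with h2 | h2
  · exact .inl (h2 ▸ h)
  · exact .inr ((reflPt_mem_Q_iff S.two_le s _ z).1 (h2 ▸ h))

lemma ReflSetting.isRep_of_mem_Q (S : ReflSetting g k p f P α s) {z : ℂ} {m : ℤ} (hz : g z = α)
    (h : z ∈ Q k (2 * m) ∪ Q k (-2 * s - 2 * m - 1)) :
    ∃ ζ n, IsRep k p f P α s z m ζ n ∧ 0 < ζ.im ∧ ζ.im < Real.pi := by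
  rcases h with h | h
  · obtain ⟨ζ, h0, h1, h2⟩ := (mem_Q_iff S.two_le _ _).1 h
    rw [← sectorMap] at h2
    obtain ⟨n, R⟩ := S.isRep_sectorMap h0.le h1.le (by rw [← h2, hz]) (.inl h2)
    exact ⟨ζ, n, R, h0, h1⟩
  · obtain ⟨ζ, h0, h1, h2⟩ :=
      (mem_Q_iff S.two_le _ _).1 ((reflPt_mem_Q_iff S.two_le s _ z).2 h)
    rw [← sectorMap] at h2
    obtain ⟨n, R⟩ := S.isRep_sectorMap h0.le h1.le (by rw [← h2, S.map_reflPt hz]) (.inr h2)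
    exact ⟨ζ, n, R, h0, h1⟩

lemma IsRep.mem_closure_Q {z ζ : ℂ} {m n l : ℤ} (R : IsRep k p f P α s z m ζ n)
    (S : ReflSetting g k p f P α s) (hl : (k : ℤ) ∣ m - l) :
    z ∈ closure (Q k (2 * l)) ∪ closure (Q k (-2 * s - 2 * l - 1)) := by
  have h : sectorMap k m ζ ∈ closure (Q k (2 * l)) := by
    rw [sectorMap_eq_of_dvd S.pos hl]
    exact (mem_closure_Q_iff S.two_le _ (sectorMap_ne_zero _ _ _)).2
      ⟨ζ, R.mem.1, R.mem.2.1, rfl⟩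
  rcases R.eq with h2 | h2
  · exact .inl (h2 ▸ h)
  · exact .inr ((reflPt_mem_closure_Q_iff S.two_le s _ (S.ne_zero_of_map (R.map_eq S))).1 (h2 ▸ h))

lemma ReflSetting.isRep_of_mem_closure_Q (S : ReflSetting g k p f P α s) {z : ℂ} {m : ℤ}
    (hz : g z = α) (h : z ∈ closure (Q k (2 * m))) : ∃ ζ n, IsRep k p f P α s z m ζ n := by
  obtain ⟨ζ, h0, h1, h2⟩ := (mem_closure_Q_iff S.two_le _ (S.ne_zero_of_map hz)).1 h
  rw [← sectorMap] at h2
  obtain ⟨n, R⟩ := S.isRep_sectorMap h0 h1 (by rw [← h2, hz]) (.inl h2)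
  exact ⟨ζ, n, R⟩

lemma IsRep.deriv_ne_zero {z ζ : ℂ} {m n : ℤ} (R : IsRep k p f P α s z m ζ n)
    (S : ReflSetting g k p f P α s) (h : deriv f ζ ≠ 0) :
    deriv g (sectorMap k m ζ) ≠ 0 := by
  rw [(S.model.deriv_sectorMap S.pos R.mem m).1, R.map_sectorMap S]
  exact div_ne_zero (mul_ne_zero S.ne_zero h) (sectorMap_ne_zero _ _ _)

lemma IsRep.isSimple {z ζ : ℂ} {m n : ℤ} (R : IsRep k p f P α s z m ζ n)
    (S : ReflSetting g k p f P α s) (h : deriv f ζ ≠ 0) :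
    IsSimple g α z ∧ IsSimple g α (reflPt k s z) := by
  have h1 := R.deriv_ne_zero S h
  have h2 := S.model.deriv_reflPt s _ h1
  have h3 := R.map_eq S
  simp only [isSimple_iff, h3, S.map_reflPt h3, true_and]
  rcases R.eq with h4 | h4
  · rw [h4]; exact ⟨h1, h2⟩
  · rw [← h4, reflPt_reflPt] at h2
    rw [← h4] at h1
    exact ⟨h2, h1⟩

/-- On the boundary Re f'' ≠ 0, so a critical point there is nondegenerate. -/
lemma IsRep.isDouble {z ζ : ℂ} {m n : ℤ} (R : IsRep k p f P α s z m ζ n)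
    (S : ReflSetting g k p f P α s) (hz : reflPt k s z = z) (h : deriv f ζ = 0) :
    IsDouble g α z := by
  have h1 := S.model.deriv_sectorMap S.pos R.mem m
  rw [← R.eq_sectorMap hz, R.map_eq S] at h1
  have hz0 := S.ne_zero_of_map (R.map_eq S)
  refine isDouble_iff.2 ⟨R.map_eq S, by rw [h1.1, h]; simp, ?_⟩
  rw [h1.2 h]
  have hk : (k : ℂ) ≠ 0 := by exact_mod_cast S.pos.ne'
  refine div_ne_zero (mul_ne_zero (mul_ne_zero S.ne_zero hk) fun h0 => ?_) (pow_ne_zero _ hz0)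
  rcases (R.fixed_iff S).1 hz with hb | hb
  · have := S.model.strict.bottom_pos ζ R.mem.2.2 hb
    rw [h0] at this; simp at this
  · have := S.model.strict.top_neg ζ R.mem.2.2 hb
    rw [h0] at this; simp at this

lemma not_isDouble_of_isSimple {z : ℂ} (h : IsSimple g α z) : ¬ IsDouble g α z := fun h' =>
  (isSimple_iff.1 h).2 (isDouble_iff.1 h').2.1

lemma IsRep.isSimple_iff {z ζ : ℂ} {m n : ℤ} (R : IsRep k p f P α s z m ζ n)
    (S : ReflSetting g k p f P α s) (hz : reflPt k s z = z) :
    IsSimple g α z ↔ deriv f ζ ≠ 0 :=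
  ⟨fun h h0 => not_isDouble_of_isSimple h (R.isDouble S hz h0), fun h => (R.isSimple S h).1⟩

lemma IsRep.isDouble_iff {z ζ : ℂ} {m n : ℤ} (R : IsRep k p f P α s z m ζ n)
    (S : ReflSetting g k p f P α s) (hz : reflPt k s z = z) :
    IsDouble g α z ↔ deriv f ζ = 0 :=
  ⟨fun h => by_contra fun h0 => not_isDouble_of_isSimple (R.isSimple S h0).1 h, R.isDouble S hz⟩

/-- Moving along a ray shifts ζ by a real number and keeps the sector number, so w lies on the same
boundary line in the same sector. -/
lemma IsRep.of_arg_eq {z ζ w : ℂ} {m n : ℤ} (R : IsRep k p f P α s z m ζ n)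
    (S : ReflSetting g k p f P α s) (hz : reflPt k s z = z) (hw : g w = α) (h : arg z = arg w) :
    ∃ η n', IsRep k p f P α s w m η n' ∧ reflPt k s w = w := by
  have hz0 := S.ne_zero_of_map (R.map_eq S)
  have hw0 := S.ne_zero_of_map hw
  have hk' : (k : ℂ) ≠ 0 := by exact_mod_cast S.pos.ne'
  have h1 := (arg_eq_arg_iff hz0 hw0).1 h
  set t := ‖w‖ / ‖z‖ with ht
  have ht0 : 0 < t := div_pos (norm_pos_iff.2 hw0) (norm_pos_iff.2 hz0)
  have h2 : w = sectorMap k m (ζ + (k * Real.log t : ℝ)) := by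
    rw [← h1, R.eq_sectorMap hz, sectorMap, sectorMap, add_div, exp_add, ofReal_mul,
      ofReal_natCast, mul_div_cancel_left₀ _ hk', ← ofReal_exp, Real.exp_log ht0, ht]
    push_cast
    rw [R.eq_sectorMap hz, sectorMap]
    ring
  obtain ⟨n', T⟩ := S.isRep_sectorMap (ζ := ζ + (k * Real.log t : ℝ))
    (by simpa using R.mem.1) (by simpa using R.mem.2.1) (by rw [← h2, hw]) (.inl h2)
  exact ⟨_, n', T, (T.fixed_iff S).2 (by simpa using (R.fixed_iff S).1 hz)⟩

lemma IsRep.arg_eq {z ζ w η : ℂ} {m n m' : ℤ} (R : IsRep k p f P α s z m ζ n)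
    (T : IsRep k p f P α s w m' η n) (S : ReflSetting g k p f P α s) (hz : reflPt k s z = z)
    (hw : reflPt k s w = w) (h : ζ.im = η.im) : arg z = arg w := by
  rw [R.eq_sectorMap hz, T.eq_sectorMap hw, sectorMap_eq_of_dvd S.pos (S.dvd_sub R.dvd T.dvd)]
  have : η = ζ + ((η.re - ζ.re : ℝ) : ℂ) := by apply Complex.ext <;> simp [h]
  rw [this, sectorMap, sectorMap, add_div, exp_add, ← mul_assoc,
    ← ofReal_natCast, ← ofReal_div, ← ofReal_exp, arg_mul_real (Real.exp_pos _)]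

lemma IsRep.le_of_lt {z ζ w η : ℂ} {m n m' n' : ℤ} (R : IsRep k p f P α s z m ζ n)
    (T : IsRep k p f P α s w m' η n') (S : ReflSetting g k p f P α s) (h : ‖z‖ < ‖w‖) :
    n ≤ n' := by
  have h1 := S.model.strict.im_le_of_re_eq R.mem T.mem (R.re_val.trans T.re_val.symm)
    ((R.re_lt_iff T S).2 h)
  rw [R.im_val, T.im_val] at h1
  have : (n : ℝ) ≤ n' := by
    have hπ := Real.pi_pos
    exact le_of_mul_le_mul_left (by linarith) (by positivity : 0 < 2 * Real.pi)
  exact_mod_cast this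

lemma IsRep.plateau {z ζ w η : ℂ} {m n m' : ℤ} (R : IsRep k p f P α s z m ζ n)
    (T : IsRep k p f P α s w m' η n) (S : ReflSetting g k p f P α s) (h : ‖z‖ < ‖w‖) :
    reflPt k s z = z ∧ reflPt k s w = w ∧ arg z = arg w ∧ deriv f ζ ≠ 0 ∧ deriv f η ≠ 0 ∧
      ∀ u, g u = α → ‖z‖ < ‖u‖ → ¬ ‖u‖ < ‖w‖ := by
  obtain ⟨h1, h2, h3, h4, h5⟩ := S.model.strict.plateau R.mem T.mem (R.val.trans T.val.symm)
    ((R.re_lt_iff T S).2 h)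
  have hz := (R.fixed_iff S).2 h1
  have hw := (T.fixed_iff S).2 (h2 ▸ h1)
  refine ⟨hz, hw, R.arg_eq T S hz hw h2, h3, h4, fun u hu i1 i2 => ?_⟩
  obtain ⟨m₁, θ, n₁, U⟩ := S.exists_isRep hu
  exact h5 θ U.mem ((R.re_lt_iff U S).2 i1) ((U.re_lt_iff T S).2 i2)
    (U.re_val.trans R.re_val.symm)

lemma ReflSetting.norm_mem_Xi (S : ReflSetting g k p f P α s) {w : ℂ} (hw : g w = α) :
    ‖w‖ ∈ Xi g α := by
  refine ⟨norm_pos_iff.2 (S.ne_zero_of_map hw), arg w, arg_mem_Ioc w, ?_⟩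
  rw [mul_comm I, norm_mul_exp_arg_mul_I, hw]

lemma ReflSetting.mem_Xi_iff (S : ReflSetting g k p f P α s) {t : ℝ} :
    t ∈ Xi g α ↔ ∃ w, g w = α ∧ ‖w‖ = t := by
  constructor
  · rintro ⟨ht, θ, -, h⟩
    exact ⟨_, h, by rw [norm_mul, mul_comm I, norm_exp_ofReal_mul_I, mul_one, norm_real,
      Real.norm_of_nonneg ht.le]⟩
  · rintro ⟨w, hw, rfl⟩
    exact S.norm_mem_Xi hw

/-! ### Consecutive α-points -/

section Enumeration

variable {I : Set ℤ} {z : ℤ → ℂ}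

lemma IsEnumeration.norm_lt_iff (E : IsEnumeration g α I z) {i j : ℤ} (hi : i ∈ I) (hj : j ∈ I) :
    ‖z i‖ < ‖z j‖ ↔ i < j := E.strictMonoOn.lt_iff_lt hi hj

lemma IsEnumeration.exists_index (E : IsEnumeration g α I z) (S : ReflSetting g k p f P α s)
    {w : ℂ} (hw : g w = α) : ∃ j ∈ I, ‖z j‖ = ‖w‖ := by
  have := S.norm_mem_Xi hw
  rwa [← E.image_eq] at this

/-- If n' ≥ n + 2, the value belonging to n + 1 is taken at a level point strictly between, and by
coprimality this yields an α-point of intermediate modulus. -/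
lemma IsEnumeration.step (E : IsEnumeration g α I z) (S : ReflSetting g k p f P α s) {i : ℤ}
    (hi : i ∈ I) (hi' : i + 1 ∈ I) {ζ η : ℂ} {m n m' n' : ℤ}
    (R : IsRep k p f P α s (z i) m ζ n) (T : IsRep k p f P α s (z (i + 1)) m' η n') :
    n' = n ∨ n' = n + 1 := by
  have hlt : ‖z i‖ < ‖z (i + 1)‖ := (E.norm_lt_iff hi hi').2 (by omega)
  have hle := R.le_of_lt T S hlt
  by_contra! h
  have h2 : n + 1 < n' := by omega
  have h2' : (n : ℝ) + 1 < n' := by exact_mod_cast h2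
  have hπ := Real.pi_pos
  obtain ⟨θ, h3, h4, h5, h6, h7⟩ := S.model.strict.exists_between R.mem T.mem
    (R.re_val.trans T.re_val.symm) ((R.re_lt_iff T S).2 hlt)
    (v := (k * log α).im + 2 * Real.pi * (n + 1))
    (by rw [R.im_val]; nlinarith) (by rw [T.im_val]; nlinarith)
  obtain ⟨m₁, U⟩ := S.exists_isRep_of_val (n := n + 1) h3 <| by
    apply Complex.ext
    · rw [h6, R.re_val]; simp
    · rw [h7]; simp
  obtain ⟨j, hj, hjn⟩ := E.exists_index S (U.map_eq S)
  have i1 := (R.re_lt_iff U S).1 h4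
  have i2 := (U.re_lt_iff T S).1 h5
  rw [← hjn] at i1 i2
  rw [E.norm_lt_iff hi hj] at i1
  rw [E.norm_lt_iff hj hi'] at i2
  omega

lemma ReflSetting.eq_of_dvd (S : ReflSetting g k p f P α s) {m n n' : ℤ}
    (h : (k : ℤ) ∣ n + p * m) (h' : (k : ℤ) ∣ n' + p * m) (hn : n' = n ∨ n' = n + 1) :
    n' = n := by
  refine hn.resolve_right fun h1 => ?_
  have h2 := _root_.dvd_sub h' h
  rw [show n' + p * m - (n + p * m) = 1 by omega] at h2
  have h3 := Int.le_of_dvd one_pos h2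
  have := S.two_le
  omega

/-- Equal arguments put both points into the same sector m, so n' ≡ n mod k; a step of 1 is then
impossible because k ≥ 2. -/
lemma IsEnumeration.step_eq_of_arg (E : IsEnumeration g α I z) (S : ReflSetting g k p f P α s)
    {i : ℤ} (hi : i ∈ I) (hi' : i + 1 ∈ I) {ζ η : ℂ} {m n m' n' : ℤ}
    (R : IsRep k p f P α s (z i) m ζ n) (T : IsRep k p f P α s (z (i + 1)) m' η n')
    (hfix : reflPt k s (z i) = z i ∨ reflPt k s (z (i + 1)) = z (i + 1))
    (harg : arg (z i) = arg (z (i + 1))) : n' = n := by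
  have hstep := E.step S hi hi' R T
  rcases hfix with h | h
  · obtain ⟨η', n₁, U, -⟩ := R.of_arg_eq S h (E.map_eq _ hi') harg
    have h1 := (U.unique T S rfl).2.1
    subst h1
    exact S.eq_of_dvd R.dvd U.dvd hstep
  · obtain ⟨ζ', n₁, U, -⟩ := T.of_arg_eq S h (E.map_eq _ hi) harg.symm
    have h1 := (U.unique R S rfl).2.1
    subst h1
    exact S.eq_of_dvd U.dvd T.dvd hstep

/-- Subtracting the congruences for n and n + 1 gives p(m - m') ≡ 1 ≡ p(m - l), and p cancels. -/
lemma ReflSetting.dvd_of_modEq (S : ReflSetting g k p f P α s) {m m' l n : ℤ}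
    (h : (k : ℤ) ∣ n + p * m) (h' : (k : ℤ) ∣ n + 1 + p * m')
    (hl : p * (m - l) ≡ 1 [ZMOD k]) : (k : ℤ) ∣ m' - l := by
  refine S.coprime.dvd_of_dvd_mul_left ?_
  have h1 := hl.symm.dvd
  have h2 := dvd_add (_root_.dvd_sub h' h) h1
  rwa [show n + 1 + p * m' - (n + p * m) + (p * (m - l) - 1) = p * (m' - l) by ring] at h2

/-- A step 0 would be a plateau, with a fixed point and equal arguments. So the step is 1, which
determines the next sector. -/
lemma IsEnumeration.next_mem_closure (E : IsEnumeration g α I z)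
    (S : ReflSetting g k p f P α s) {i : ℤ} (hi : i ∈ I) (hi' : i + 1 ∈ I) {ζ : ℂ} {m n l : ℤ}
    (R : IsRep k p f P α s (z i) m ζ n)
    (hne : ¬ (reflPt k s (z i) = z i ∧ arg (z i) = arg (z (i + 1))))
    (hl : p * (m - l) ≡ 1 [ZMOD k]) :
    z (i + 1) ∈ closure (Q k (2 * l)) ∪ closure (Q k (-2 * s - 2 * l - 1)) := by
  obtain ⟨m', η, n', T⟩ := S.exists_isRep (E.map_eq _ hi')
  have hlt : ‖z i‖ < ‖z (i + 1)‖ := (E.norm_lt_iff hi hi').2 (by omega)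
  rcases E.step S hi hi' R T with rfl | rfl
  · have := R.plateau T S hlt
    exact absurd ⟨this.1, this.2.2.1⟩ hne
  · exact T.mem_closure_Q S (S.dvd_of_modEq R.dvd T.dvd hl)

/-- A fixed `α`-point which is not critical has the same argument as a neighbour. -/
lemma IsEnumeration.arg_eq_of_deriv_ne_zero (E : IsEnumeration g α I z)
    (S : ReflSetting g k p f P α s) {i : ℤ} (hi : i ∈ I) (hp : i - 1 ∈ I) (hs : i + 1 ∈ I)
    {ζ : ℂ} {m n : ℤ} (R : IsRep k p f P α s (z i) m ζ n) (hz : reflPt k s (z i) = z i)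
    (hd : deriv f ζ ≠ 0) (hne : arg (z i) ≠ arg (z (i + 1))) : arg (z i) = arg (z (i - 1)) := by
  obtain ⟨m₁, ζ₁, n₁, R₁⟩ := S.exists_isRep (E.map_eq _ hp)
  obtain ⟨m₂, ζ₂, n₂, R₂⟩ := S.exists_isRep (E.map_eq _ hs)
  have l1 : ‖z (i - 1)‖ < ‖z i‖ := (E.norm_lt_iff hp hi).2 (by omega)
  have l2 : ‖z i‖ < ‖z (i + 1)‖ := (E.norm_lt_iff hi hs).2 (by omega)
  obtain ⟨η, hη, hv, hre⟩ := S.model.strict.exists_same_value R₁.mem R.mem R₂.mem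
    (R₁.re_val.trans R.re_val.symm) (R₂.re_val.trans R.re_val.symm) ((R₁.re_lt_iff R S).2 l1)
    ((R.re_lt_iff R₂ S).2 l2) ((R.fixed_iff S).1 hz) hd
  obtain ⟨m₃, U⟩ := S.exists_isRep_of_val hη (hv.trans R.val)
  obtain ⟨j, hj, hjn⟩ := E.exists_index S (U.map_eq S)
  -- No α-point has its modulus strictly between those of a plateau pair, so the partner has index i
  -- - 1 or i + 1; the latter contradicts `hne`.
  rcases lt_or_gt_of_ne hre with h | h
  · have hU := (U.re_lt_iff R S).1 h
    obtain ⟨-, -, h3, -, -, h4⟩ := U.plateau R S hU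
    have hji : j < i := by rwa [← hjn, E.norm_lt_iff hj hi] at hU
    rcases (show j = i - 1 ∨ j < i - 1 by omega) with rfl | hj1
    · have hm := R₁.unique U S hjn
      obtain ⟨rfl, rfl, -⟩ := hm
      exact (R₁.plateau R S l1).2.2.1.symm
    · refine absurd l1 (h4 _ (E.map_eq _ hp) ?_)
      rwa [← hjn, E.norm_lt_iff hj hp]
  · have hU := (R.re_lt_iff U S).1 h
    obtain ⟨-, -, h3, -, -, h4⟩ := R.plateau U S hU
    have hji : i < j := by rwa [← hjn, E.norm_lt_iff hi hj] at hU
    rcases (show j = i + 1 ∨ i + 1 < j by omega) with rfl | hj1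
    · obtain ⟨rfl, rfl, -⟩ := R₂.unique U S hjn
      exact absurd (R.plateau R₂ S l2).2.2.1 hne
    · refine absurd ?_ (h4 _ (E.map_eq _ hs) l2)
      rwa [← hjn, E.norm_lt_iff hs hj]

end Enumeration

/-! ### Existence of the numbering -/

/-- The integer n is monotone in the modulus and each of its values occurs at most twice: of three
moduli with the same n, the middle one would lie inside a plateau. -/
lemma ReflSetting.finite_Icc (S : ReflSetting g k p f P α s) (x y : Xi g α) :
    (Icc x y).Finite := by
  have hrep : ∀ t : Xi g α, ∃ w m ζ n, ‖w‖ = t ∧ IsRep k p f P α s w m ζ n := by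
    intro t
    obtain ⟨w, hw, hwt⟩ := S.mem_Xi_iff.1 t.2
    obtain ⟨m, ζ, n, R⟩ := S.exists_isRep hw
    exact ⟨w, m, ζ, n, hwt, R⟩
  choose w m ζ n hw R using hrep
  have hlt : ∀ {t u : Xi g α}, t < u → ‖w t‖ < ‖w u‖ := fun {t u} h => by
    rw [hw, hw]; exact h
  have hmono : Monotone n := by
    intro t u htu
    rcases htu.eq_or_lt with rfl | h
    · exact le_rfl
    · exact (R t).le_of_lt (R u) S (hlt h)
  have hfib : ∀ N : ℤ, {t | n t = N}.Finite := by
    intro N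
    by_contra hinf
    obtain ⟨T, hT, hcard⟩ := Set.Infinite.exists_subset_card_eq hinf 3
    have hmem : ∀ i, n (T.orderEmbOfFin hcard i) = N := fun i =>
      hT (Finset.orderEmbOfFin_mem T hcard i)
    set t := T.orderEmbOfFin hcard
    have h01 : t 0 < t 1 := t.strictMono (by decide)
    have h12 : t 1 < t 2 := t.strictMono (by decide)
    have R0 := R (t 0)
    have R2 := R (t 2)
    rw [hmem] at R0 R2
    exact (R0.plateau R2 S (hlt (h01.trans h12))).2.2.2.2.2 _ ((R (t 1)).map_eq S) (hlt h01)
      (hlt h12)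
  refine ((Set.finite_Icc (n x) (n y)).biUnion fun N _ => hfib N).subset fun t ht => ?_
  exact mem_biUnion (x := n t) ⟨hmono ht.1, hmono ht.2⟩ rfl

/-- A locally finite linear order can be numbered by an interval of integers. -/
lemma exists_strictMono_int_ordConnected {β : Type*} [LinearOrder β]
    (h : ∀ x y : β, (Icc x y).Finite) :
    ∃ φ : β → ℤ, StrictMono φ ∧ (range φ).OrdConnected := by
  classical
  rcases isEmpty_or_nonempty β with hβ | ⟨⟨i₀⟩⟩
  · exact ⟨fun x => hβ.elim x, fun x => hβ.elim x, by rw [range_eq_empty]; exact ordConnected_empty⟩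
  let _ : LocallyFiniteOrder β := LocallyFiniteOrder.ofFiniteIcc h
  let _ : SuccOrder β := LinearLocallyFiniteOrder.succOrder β
  let _ : PredOrder β := LinearLocallyFiniteOrder.predOrder β
  refine ⟨toZ i₀, toZ_strictMono, ⟨?_⟩⟩
  rintro _ ⟨x, rfl⟩ _ ⟨y, rfl⟩ N ⟨h1, h2⟩
  rcases le_total 0 N with hN | hN
  · obtain ⟨M, rfl⟩ := Int.eq_ofNat_of_zero_le hN
    -- If the M-th successor is already maximal, its index is at most M, so the index of y is
    -- squeezed to M.
    by_cases hmax : IsMax (Order.succ^[M] i₀)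
    · have := toZ_iterate_succ_le (i0 := i₀) M
      have h3 : toZ i₀ y ≤ toZ i₀ (Order.succ^[M] i₀) :=
        toZ_strictMono.monotone (hmax.isTop y)
      exact ⟨y, by omega⟩
    · exact ⟨_, toZ_iterate_succ_of_not_isMax M hmax⟩
  · obtain ⟨M, hM⟩ := Int.eq_ofNat_of_zero_le (neg_nonneg.2 hN)
    by_cases hmin : IsMin (Order.pred^[M] i₀)
    · have := toZ_iterate_pred_ge (i0 := i₀) M
      have h3 : toZ i₀ (Order.pred^[M] i₀) ≤ toZ i₀ x :=
        toZ_strictMono.monotone (hmin.isBot x)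
      exact ⟨x, by omega⟩
    · exact ⟨_, (toZ_iterate_pred_of_not_isMin M hmin).trans (by omega)⟩

lemma ReflSetting.exists_isEnumeration (S : ReflSetting g k p f P α s) :
    ∃ (I : Set ℤ) (z : ℤ → ℂ), IsEnumeration g α I z := by
  obtain ⟨φ, hφ, hconn⟩ := exists_strictMono_int_ordConnected S.finite_Icc
  have hpt : ∀ t : Xi g α, ∃ w, g w = α ∧ ‖w‖ = t := fun t => S.mem_Xi_iff.1 t.2
  choose w hw hwt using hpt
  have hz : ∀ t, Function.extend φ w 0 (φ t) = w t := hφ.injective.extend_apply w 0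
  refine ⟨range φ, Function.extend φ w 0, hconn, ?_, ?_, ?_⟩
  · rintro _ ⟨t, rfl⟩ _ ⟨u, rfl⟩ htu
    simp only [hz, hwt]
    exact hφ.lt_iff_lt.1 htu
  · rw [← range_comp]
    ext t
    constructor
    · rintro ⟨u, rfl⟩
      simp only [Function.comp_apply, hz, hwt, u.2]
    · intro ht
      exact ⟨⟨t, ht⟩, by simp only [Function.comp_apply, hz, hwt]⟩
  · rintro _ ⟨t, rfl⟩
    rw [hz, hw]

end

end AlphaPoints

/-! ### The model for G and the theorem -/

namespace AlphaPoints

lemma stripModel_G {ι₁ ι₂ ι₃ ι₄ : Type*} {k : ℕ} (hk : 2 ≤ k) {p : ℤ} (hp : p ≠ 0)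
    {A A₀ : ℝ} (hA : 0 ≤ A) (hA₀ : 0 ≤ A₀)
    {a : ι₁ → ℝ} {b : ι₂ → ℝ} {c : ι₃ → ℝ} {d : ι₄ → ℝ}
    (ha : ∀ ν, 0 < a ν) (hb : ∀ μ, 0 < b μ) (hc : ∀ ν, 0 < c ν) (hd : ∀ μ, 0 < d μ)
    (hsa : Summable fun ν => (a ν)⁻¹) (hsb : Summable fun μ => (b μ)⁻¹)
    (hsc : Summable fun ν => (c ν)⁻¹) (hsd : Summable fun μ => (d μ)⁻¹)
    (hG : G k p A A₀ a b c d ≠ fun z => z ^ p) :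
    StripModel (G k p A A₀ a b c d) k p (logG k p A A₀ a b c d)
      (∅ ∪ singularSet a b c d) where
  strict := by
    refine strictStripMap_logG (by omega) p hA hA₀ ha hb hc hd hsa hsb hsc hsd ?_
    -- If both exponents vanish and all four products are empty, then G is z^p.
    by_contra! h
    obtain ⟨h1, h2, _, _, _, _⟩ := h
    obtain rfl := le_antisymm h1 hA
    obtain rfl := le_antisymm h2 hA₀
    exact hG (funext fun z => by simp [G])
  eventually_eq ζ hζ m := eventually_G_sectorMap (by omega) p ha hb hc hd hsa hsb hsc hsd
    hζ.1 hζ.2.1 hζ.2.2 m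
  eq_zero ζ hζ m := G_sectorMap_of_mem_singularSet (by omega) p ha hb hc hd hζ m
  map_conj := G_conj k p
  map_rotate j z := by
    have h1 : (z * e k (2 * j)) ^ k = z ^ k := by
      rw [mul_pow, e_two_mul_pow (by omega), mul_one]
    have h2 : p * (2 * j) = 2 * (p * j) := by ring
    simp only [G, h1, mul_zpow, e_zpow, h2]
    ring
  map_zero := by simp [G, zero_zpow p hp]

end AlphaPoints

theorem mainTheorem2 {ι₁ ι₂ ι₃ ι₄ : Type*} (k : ℕ) (hk : 2 ≤ k) (p : ℤ)
    (hpk : Nat.Coprime p.natAbs k)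
    (A A₀ : ℝ) (hA : 0 ≤ A) (hA₀ : 0 ≤ A₀)
    (a : ι₁ → ℝ) (b : ι₂ → ℝ) (c : ι₃ → ℝ) (d : ι₄ → ℝ)
    (ha : ∀ ν, 0 < a ν) (hb : ∀ μ, 0 < b μ) (hc : ∀ ν, 0 < c ν) (hd : ∀ μ, 0 < d μ)
    (hsa : Summable fun ν => (a ν)⁻¹) (hsb : Summable fun μ => (b μ)⁻¹)
    (hsc : Summable fun ν => (c ν)⁻¹) (hsd : Summable fun μ => (d μ)⁻¹)
    (hG : G k p A A₀ a b c d ≠ fun z => z ^ p)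
    (α : ℂ) (hα : α ≠ 0) (hαk : (α ^ k).im = 0)
    (s : ℤ) (hs : (α * e k (p * s)).im = 0) :
    -- the numbering of the points exists
    (∃ (I : Set ℤ) (z : ℤ → ℂ), IsEnumeration (G k p A A₀ a b c d) α I z) ∧
    ∀ (I : Set ℤ) (z : ℤ → ℂ), IsEnumeration (G k p A A₀ a b c d) α I z → ∀ i ∈ I,
      -- (a)
      (∀ w : ℂ, (G k p A A₀ a b c d w = α ∧ ‖w‖ = ‖z i‖) ↔
        w ∈ ({z i, reflPt k s (z i)} : Set ℂ)) ∧
      -- (b)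
      (reflPt k s (z i) ≠ z i → ∃ m : ℤ, z i ∈ Q k (2 * m) ∪ Q k (-2 * s - 2 * m - 1)) ∧
      (∀ m : ℤ, z i ∈ Q k (2 * m) ∪ Q k (-2 * s - 2 * m - 1) →
        reflPt k s (z i) ≠ z i ∧
        IsSimple (G k p A A₀ a b c d) α (z i) ∧
        IsSimple (G k p A A₀ a b c d) α (reflPt k s (z i)) ∧
        ∀ l : ℤ, p * (m - l) ≡ 1 [ZMOD k] → i + 1 ∈ I →
          z (i + 1) ∈ closure (Q k (2 * l)) ∪ closure (Q k (-2 * s - 2 * l - 1))) ∧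
      -- (c)
      (reflPt k s (z i) = z i → i + 1 ∈ I → Complex.arg (z i) = Complex.arg (z (i + 1)) →
        IsSimple (G k p A A₀ a b c d) α (z i) ∧
        IsSimple (G k p A A₀ a b c d) α (z (i + 1)) ∧
        (i - 1 ∈ I → Complex.arg (z i) ≠ Complex.arg (z (i - 1))) ∧
        (i + 2 ∈ I → Complex.arg (z (i + 1)) ≠ Complex.arg (z (i + 2)))) ∧
      -- (d)
      (reflPt k s (z i) = z i → i + 1 ∈ I → Complex.arg (z i) ≠ Complex.arg (z (i + 1)) →
        (IsSimple (G k p A A₀ a b c d) α (z i) ∨ IsDouble (G k p A A₀ a b c d) α (z i)) ∧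
        (i - 1 ∈ I →
          (IsSimple (G k p A A₀ a b c d) α (z i) ↔
            Complex.arg (z i) = Complex.arg (z (i - 1))) ∧
          (IsDouble (G k p A A₀ a b c d) α (z i) ↔
            Complex.arg (z i) ≠ Complex.arg (z (i - 1)))) ∧
        (∃ m : ℤ, z i ∈ closure (Q k (2 * m)) ∩ closure (Q k (-2 * s - 2 * m - 1))) ∧
        (∀ m l : ℤ, z i ∈ closure (Q k (2 * m)) ∩ closure (Q k (-2 * s - 2 * m - 1)) →
          p * (m - l) ≡ 1 [ZMOD k] →
          z (i + 1) ∈ closure (Q k (2 * l)) ∪ closure (Q k (-2 * s - 2 * l - 1)))) ∧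
      -- (e)
      (reflPt k s (z i) = z i → i + 1 ∉ I →
        ∃ n ≤ 2, IsAlphaPointOfMult (G k p A A₀ a b c d) α (z i) n) := by
  have hp : p ≠ 0 := by
    rintro rfl
    have : k = 1 := by simpa using hpk
    omega
  have hcop : IsCoprime (k : ℤ) p :=
    (Int.isCoprime_iff_gcd_eq_one.2 (by simpa [Int.gcd] using hpk)).symm
  have S : ReflSetting (G k p A A₀ a b c d) k p (logG k p A A₀ a b c d)
      (∅ ∪ singularSet a b c d) α s :=
    ⟨stripModel_G hk hp hA hA₀ ha hb hc hd hsa hsb hsc hsd hG, hk, hcop, hα, hs⟩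
  refine ⟨S.exists_isEnumeration, fun I z E i hi => ?_⟩
  obtain ⟨m, ζ, n, R⟩ := S.exists_isRep (E.map_eq i hi)
  have hnext : i + 1 ∈ I → ‖z i‖ < ‖z (i + 1)‖ := fun h => (E.norm_lt_iff hi h).2 (by omega)
  refine ⟨fun w => ⟨fun h => R.eq_or_eq S h.1 h.2, ?_⟩, fun hne => ?_, fun M hM => ?_,
    fun hz hi' harg => ?_, fun hz hi' harg => ?_, fun hz _ => ?_⟩
  · rintro (rfl | rfl)
    · exact ⟨R.map_eq S, rfl⟩
    · exact ⟨S.map_reflPt (R.map_eq S), norm_reflPt _ _ _⟩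
  · rw [ne_eq, R.fixed_iff S, not_or] at hne
    exact ⟨m, R.mem_Q S (lt_of_le_of_ne R.mem.1 (Ne.symm hne.1))
      (lt_of_le_of_ne R.mem.2.1 hne.2)⟩
  · obtain ⟨η, N, T, h0, h1⟩ := S.isRep_of_mem_Q (R.map_eq S) hM
    have hne : reflPt k s (z i) ≠ z i := by
      rw [ne_eq, T.fixed_iff S, not_or]
      exact ⟨h0.ne', h1.ne⟩
    have hd' : deriv (logG k p A A₀ a b c d) η ≠ 0 := fun h => by
      have := S.model.strict.im_deriv_pos η h0 h1
      rw [h] at this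
      simp at this
    exact ⟨hne, (T.isSimple S hd').1, (T.isSimple S hd').2, fun l hl hi' =>
      E.next_mem_closure S hi hi' T (fun h => hne h.1) hl⟩
  · obtain ⟨m', η, n', T⟩ := S.exists_isRep (E.map_eq _ hi')
    -- Equal arguments mean a step 0, so the two points form a plateau.
    obtain rfl := E.step_eq_of_arg S hi hi' R T (.inl hz) harg
    obtain ⟨-, hz', -, hd1, hd2, hbet⟩ := R.plateau T S (hnext hi')
    refine ⟨(R.isSimple S hd1).1, (T.isSimple S hd2).1, fun hp' harg' => ?_, fun hs' harg' => ?_⟩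
    · obtain ⟨m₁, ζ₁, n₁, R₁⟩ := S.exists_isRep (E.map_eq _ hp')
      have hlt : ‖z (i - 1)‖ < ‖z i‖ := (E.norm_lt_iff hp' hi).2 (by omega)
      have hi1 : i - 1 + 1 = i := by ring
      have h1 : n' = n₁ := E.step_eq_of_arg S hp' (hi1.symm ▸ hi) R₁ (hi1.symm ▸ R)
        (.inr (hi1.symm ▸ hz)) (by rw [hi1]; exact harg'.symm)
      subst h1
      -- A third point with the same n would put z i inside the plateau from z (i - 1) to z (i + 1).
      exact (R₁.plateau T S (hlt.trans (hnext hi'))).2.2.2.2.2 _ (R.map_eq S) hlt (hnext hi')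
    · have hi2 : i + 1 + 1 = i + 2 := by ring
      obtain ⟨m₂, ζ₂, n₂, R₂⟩ := S.exists_isRep (E.map_eq _ hs')
      have hlt : ‖z (i + 1)‖ < ‖z (i + 2)‖ := (E.norm_lt_iff hi' hs').2 (by omega)
      have h1 : n₂ = n' := E.step_eq_of_arg S hi' (hi2.symm ▸ hs') T (hi2.symm ▸ R₂)
        (.inl hz') (by rw [hi2]; exact harg')
      subst h1
      exact (R.plateau R₂ S ((hnext hi').trans hlt)).2.2.2.2.2 _ (T.map_eq S) (hnext hi') hlt
  · have hsd' : ∀ h : deriv (logG k p A A₀ a b c d) ζ ≠ 0, i - 1 ∈ I →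
        Complex.arg (z i) = Complex.arg (z (i - 1)) := fun h hp' =>
      E.arg_eq_of_deriv_ne_zero S hi hp' hi' R hz h harg
    -- Equal arguments with the previous point form a plateau, whose end points are not critical.
    have hds : i - 1 ∈ I → Complex.arg (z i) = Complex.arg (z (i - 1)) →
        deriv (logG k p A A₀ a b c d) ζ ≠ 0 := fun hp' harg' => by
      obtain ⟨m₁, ζ₁, n₁, R₁⟩ := S.exists_isRep (E.map_eq _ hp')
      have hi1 : i - 1 + 1 = i := by ring
      have h1 : n = n₁ := E.step_eq_of_arg S hp' (hi1.symm ▸ hi) R₁ (hi1.symm ▸ R)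
        (.inr (hi1.symm ▸ hz)) (by rw [hi1]; exact harg'.symm)
      subst h1
      exact (R₁.plateau R S ((E.norm_lt_iff hp' hi).2 (by omega))).2.2.2.2.1
    rw [R.isSimple_iff S hz, R.isDouble_iff S hz]
    refine ⟨(em _).symm, fun hp' => ⟨⟨fun h => hsd' h hp', hds hp'⟩,
      ⟨fun h h' => hds hp' h' h, fun h => by_contra fun h' => h (hsd' h' hp')⟩⟩, ?_, ?_⟩
    -- As z i is fixed and the reflection exchanges the two closed sectors, lying in one of them
    -- means lying in both.
    · have h1 : z i ∈ closure (Q k (2 * m)) := by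
        rcases R.mem_closure_Q S (l := m) (by simp) with h | h
        · exact h
        · rw [← reflPt_mem_closure_Q_iff hk s _ (S.ne_zero_of_map (R.map_eq S)), hz] at h
          exact h
      refine ⟨m, h1, ?_⟩
      rw [← reflPt_mem_closure_Q_iff hk s _ (S.ne_zero_of_map (R.map_eq S)), hz]
      exact h1
    · intro M l hM hl
      obtain ⟨η, N, T⟩ := S.isRep_of_mem_closure_Q (R.map_eq S) hM.1
      exact E.next_mem_closure S hi hi' T (fun h => harg h.2) hl
  · by_cases hd' : deriv (logG k p A A₀ a b c d) ζ = 0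
    · exact ⟨2, le_rfl, R.isDouble S hz hd'⟩
    · exact ⟨1, one_le_two, (R.isSimple S hd').1⟩
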